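/- Let $(\mathcal M,g_{ab})$ be a smooth four-dimensional Lorentzian spacetime (signature $(+,-,-,-)$) with spinor structure, Levi-Civita connection $\nabla_{AA'}$, and let $(o^A,\iota^A)$ be a smooth spin dyad on $\mathcal M$, $o_A\iota^A=1$. Write $\ell_a=o_A\bar o_{A'}$, $n_a=\iota_A\bar\iota_{A'}$, $m_a=o_A\bar\iota_{A'}$, $\bar m_a=\iota_A\bar o_{A'}$, and, with the standard GHP spin coefficients of the dyad, $$\omega_a=-\epsilon n_a+\epsilon'\ell_a-\beta' m_a+\beta\bar m_a,\qquad B_a=-\rho n_a+\tau\bar m_a,\qquad f_a=\rho n_a+\rho'\ell_a-\tau' m_a-\tau\bar m_a .$$ The conformal-GHP connection of the dyad acts on scalars $\psi$, resp. spinors $\psi_B$, of GHP weight $\{p,0\}$ and conformal weight $w$ by $$\mathcal C_{AA'}\psi=\nabla_{AA'}\psi+\big(wf_{AA'}+p(\omega_{AA'}+B_{AA'})\big)\psi,$$ $$\mathcal C_{AA'}\psi_B=\nabla_{AA'}\psi_B+\big(wf_{AA'}+p(\omega_{AA'}+B_{AA'})\big)\psi_B-f_{BA'}\psi_A,$$ and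 its projection is $\tilde{\mathcal C}_{A'}=o^A\mathcal C_{AA'}$. Suppose that $o^A$ is a shear-free ray, i.e. $o^Ao^B\nabla_{AA'}o_B=0$. 1. The dyad spinors $o_B$ (weights $\{1,0\}$, $w=1$) and $\iota_B$ (weights $\{-1,0\}$, $w=0$) are parallel for the projected connection: $$\tilde{\mathcal C}_{A'}o_B=0,\qquad \tilde{\mathcal C}_{A'}\iota_B=0 .$$ 2. Suppose in addition that the spacetime and the dyad are real-analytic and that $o^A$ is a repeated principal spinor of the Weyl spinor, $\Psi_{ABCD}o^Bo^Co^D=0$. Then every point of $\mathcal M$ has an open neighbourhood $U$ carrying complex-valued real-analytic scalars $\phi$ (nowhere zero, weights $\{0,0\}$, $w=-1$) and $\eta$ (weights $\{-2,0\}$, $w=-1$) with $$f_{AA'}=\nabla_{AA'}\log\phi-o_A\tilde{\mathcal C}_{A'}\eta\quad\text{on }U,\qquad(*)$$ where $\nabla_{AA'}\log\phi=\phi^{-1}\nabla_{AA'}\phi$. Moreover, for any open $U\subseteq\mathcal M$ and any $C^1$ complex scalars $\phi,\eta$ on $U$, $\phi$ nowhere zero, that satisfy $(*)$, the spinor field $$K_{AB}=\phi^{-1}\big[o_{(A}\iota_{B)}-\eta\,o_Ao_B\big]$$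 satisfies the projected Killing spinor equation $o^A\nabla_{A'(A}K_{BC)}=0$ on $U$. No Einstein condition is assumed. -/

import Mathlib

open scoped Manifold ContDiff Bundle

noncomputable section

/-! ### Index conventions

Spinor indices `A` and `A'` range over `Fin 2`.  The spin metric has `ε₀₁ = ε⁰¹ = 1`; indices are
moved by `κ_A = κ^B ε_{BA}`, `κ^A = ε^{AB} κ_B`.  The metric has signature `(+,-,-,-)`. -/

/-- The components `ε_{AB}` (equivalently `ε^{AB}`, `ε_{A'B'}`, `ε^{A'B'}`) of the spin metric. -/
def spinEps : Matrix (Fin 2) (Fin 2) ℂ := !![0, 1; -1, 0]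

/-- The diagonal entries of the Minkowski metric. -/
def minkowskiSign (i : Fin 4) : ℝ := if i = 0 then 1 else -1

/-- The Infeld-van der Waerden symbols `s_i^{AA'}`: the vector `V = V^i E_i` has the spinor
components `V^{AA'} = V^i s_i^{AA'}`, that is
`V^{AA'} = (1/√2) [[V⁰ + V³, V¹ + i V²], [V¹ - i V², V⁰ - V³]]`. -/
def ivdw (i : Fin 4) : Matrix (Fin 2) (Fin 2) ℂ :=
  ((Real.sqrt 2 : ℝ) : ℂ)⁻¹ •
    (![!![1, 0; 0, 1], !![0, 1; 1, 0], !![0, Complex.I; -Complex.I, 0], !![1, 0; 0, -1]] i)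

/-- The inverse symbols `s^i_{AA'} = η^{ii} s_i^{BB'} ε_{BA} ε_{B'A'}`: a covector `α` has the
spinor components `α_{AA'} = s^i_{AA'} α(E_i)`. -/
def ivdwInv (i : Fin 4) (A A' : Fin 2) : ℂ :=
  (minkowskiSign i : ℂ) * ∑ B, ∑ B', ivdw i B B' * spinEps B A * spinEps B' A'

/-- Lowering of a spinor index: `κ_A = κ^B ε_{BA}`. -/
def lowerIdx (κ : Fin 2 → ℂ) (A : Fin 2) : ℂ := ∑ B, κ B * spinEps B A

/-- The totally symmetric part `T_{(ABC)}`. -/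
def symm3 (T : Fin 2 → Fin 2 → Fin 2 → ℂ) (A B C : Fin 2) : ℂ :=
  (T A B C + T A C B + T B A C + T B C A + T C A B + T C B A) / 6

/-- The totally symmetric part `T_{(ABCD)}`. -/
def symm4 (T : Fin 2 → Fin 2 → Fin 2 → Fin 2 → ℂ) (A B C D : Fin 2) : ℂ :=
  (∑ σ : Equiv.Perm (Fin 4),
    T (![A, B, C, D] (σ 0)) (![A, B, C, D] (σ 1)) (![A, B, C, D] (σ 2)) (![A, B, C, D] (σ 3))) / 24

/-- A smooth Lorentzian 4-manifold `(M, g)` with a (trivialized) spinor structure.  The spin bundle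
`𝕊` is trivialized, `𝕊 = M × ℂ²`, with the constant spin metric `spinEps`; this trivialization
amounts to a smooth `g`-orthonormal frame `E₀, …, E₃`, and the isomorphism `TM ⊗ ℂ ≅ 𝕊 ⊗ 𝕊'` with
`g_{ab} = ε_{AB} ε_{A'B'}` sends `V^i E_i` to `V^i s_i^{AA'}`.  (A global spin dyad always
trivializes the spin bundle.)  Symmetry, nondegeneracy, signature and smoothness of `g` follow from
the existence of the smooth orthonormal frame. -/
structure SpinSpacetime (M : Type*) [TopologicalSpace M]
    [ChartedSpace (EuclideanSpace ℝ (Fin 4)) M] [IsManifold (𝓡 4) ∞ M] where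
  /-- the Lorentzian metric -/
  g : ∀ x : M, LinearMap.BilinForm ℝ (TangentSpace (𝓡 4) x)
  /-- the orthonormal frame -/
  E : Fin 4 → ∀ x : M, TangentSpace (𝓡 4) x
  contMDiff_E : ∀ i, ContMDiff (𝓡 4) (𝓡 4).tangent ∞
    (fun x => (⟨x, E i x⟩ : TangentBundle (𝓡 4) M))
  orthonormal : ∀ x i j, g x (E i x) (E j x) = if i = j then minkowskiSign i else 0

/-- A smooth spin dyad `(o^A, ι^A)`, normalized by `o_A ι^A = 1`. -/
structure SpinDyad (M : Type*) [TopologicalSpace M]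
    [ChartedSpace (EuclideanSpace ℝ (Fin 4)) M] where
  /-- the components `o^A` -/
  o : M → Fin 2 → ℂ
  /-- the components `ι^A` -/
  iota : M → Fin 2 → ℂ
  contMDiff_o : ContMDiff (𝓡 4) 𝓘(ℝ, Fin 2 → ℂ) ∞ o
  contMDiff_iota : ContMDiff (𝓡 4) 𝓘(ℝ, Fin 2 → ℂ) ∞ iota
  normalized : ∀ x, ∑ A, lowerIdx (o x) A * iota x A = 1

namespace SpinDyad

variable {M : Type*} [TopologicalSpace M] [ChartedSpace (EuclideanSpace ℝ (Fin 4)) M]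

/-- `o_A` -/
def oLow (D : SpinDyad M) (x : M) : Fin 2 → ℂ := lowerIdx (D.o x)

/-- `ι_A` -/
def iotaLow (D : SpinDyad M) (x : M) : Fin 2 → ℂ := lowerIdx (D.iota x)

/-- The complex conjugate `ō^{A'}`. -/
def oBar (D : SpinDyad M) (x : M) (A' : Fin 2) : ℂ := star (D.o x A')

/-- The complex conjugate `ῑ^{A'}`. -/
def iotaBar (D : SpinDyad M) (x : M) (A' : Fin 2) : ℂ := star (D.iota x A')

/-- The null covector `ℓ_a = o_A ō_{A'}`. -/
def l (D : SpinDyad M) (x : M) (A A' : Fin 2) : ℂ := D.oLow x A * lowerIdx (D.oBar x) A'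

/-- The null covector `n_a = ι_A ῑ_{A'}`. -/
def n (D : SpinDyad M) (x : M) (A A' : Fin 2) : ℂ := D.iotaLow x A * lowerIdx (D.iotaBar x) A'

/-- The null covector `m_a = o_A ῑ_{A'}`. -/
def m (D : SpinDyad M) (x : M) (A A' : Fin 2) : ℂ := D.oLow x A * lowerIdx (D.iotaBar x) A'

/-- The null covector `m̄_a = ι_A ō_{A'}`. -/
def mBar (D : SpinDyad M) (x : M) (A A' : Fin 2) : ℂ := D.iotaLow x A * lowerIdx (D.oBar x) A'

/-- The dyad is real-analytic. -/
def IsAnalytic (D : SpinDyad M) : Prop :=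
  ContMDiff (𝓡 4) 𝓘(ℝ, Fin 2 → ℂ) ω D.o ∧ ContMDiff (𝓡 4) 𝓘(ℝ, Fin 2 → ℂ) ω D.iota

end SpinDyad

namespace SpinSpacetime

variable {M : Type*} [TopologicalSpace M] [ChartedSpace (EuclideanSpace ℝ (Fin 4)) M]
  [IsManifold (𝓡 4) ∞ M]

/-- The spacetime (with its spinor structure) is real-analytic: the frame is real-analytic for the
real-analytic structure of `M`.  (Hence so is the metric.) -/
def IsAnalytic (S : SpinSpacetime M) : Prop :=
  ∀ i, ContMDiff (𝓡 4) (𝓡 4).tangent ω (fun x => (⟨x, S.E i x⟩ : TangentBundle (𝓡 4) M))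

/-! ### Levi-Civita connection and curvature -/

/-- The right-hand side of the Koszul formula: `2 g(∇_X Y, Z)`. -/
def koszul (S : SpinSpacetime M) (X Y Z : ∀ x : M, TangentSpace (𝓡 4) x) (x : M) : ℝ :=
  mvfderiv (𝓡 4) (fun y => S.g y (Y y) (Z y)) x (X x)
    + mvfderiv (𝓡 4) (fun y => S.g y (X y) (Z y)) x (Y x)
    - mvfderiv (𝓡 4) (fun y => S.g y (X y) (Y y)) x (Z x)
    + S.g x (VectorField.mlieBracket (𝓡 4) X Y x) (Z x)
    - S.g x (VectorField.mlieBracket (𝓡 4) X Z x) (Y x)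
    - S.g x (VectorField.mlieBracket (𝓡 4) Y Z x) (X x)

/-- The Levi-Civita connection `∇_X Y` of `g`: the vector with `2 g(∇_X Y, E_k)` given by the
Koszul formula. -/
def leviCivita (S : SpinSpacetime M) (X Y : ∀ x : M, TangentSpace (𝓡 4) x) (x : M) :
    TangentSpace (𝓡 4) x :=
  ∑ k, (minkowskiSign k * (S.koszul X Y (S.E k) x / 2)) • S.E k x

/-- The curvature `R(X,Y)Z = ∇_X ∇_Y Z - ∇_Y ∇_X Z - ∇_{[X,Y]} Z`. -/
def curvature (S : SpinSpacetime M) (X Y Z : ∀ x : M, TangentSpace (𝓡 4) x) (x : M) :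
    TangentSpace (𝓡 4) x :=
  S.leviCivita X (S.leviCivita Y Z) x - S.leviCivita Y (S.leviCivita X Z) x
    - S.leviCivita (VectorField.mlieBracket (𝓡 4) X Y) Z x

/-- The frame components `R_{ijkl} = g(R(E_i,E_j)E_k, E_l)` of the Riemann tensor `R_{abcd}`, where
`(∇_a ∇_b - ∇_b ∇_a) V^d = R_{abc}{}^d V^c`. -/
def riemann (S : SpinSpacetime M) (x : M) (i j k l : Fin 4) : ℝ :=
  S.g x (S.curvature (S.E i) (S.E j) (S.E k) x) (S.E l x)

/-- The curvature spinor
`X_{ABCD} = (1/4) R_{AA'BB'CC'DD'} ε^{A'B'} ε^{C'D'}`. -/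
def curvSpinor (S : SpinSpacetime M) (x : M) (A B C D : Fin 2) : ℂ :=
  (∑ A', ∑ B', ∑ C', ∑ D', spinEps A' B' * spinEps C' D' *
    ∑ i, ∑ j, ∑ k, ∑ l, ivdwInv i A A' * ivdwInv j B B' * ivdwInv k C C' * ivdwInv l D D' *
      (S.riemann x i j k l : ℂ)) / 4

/-- The Weyl conformal spinor `Ψ_{ABCD} = X_{(ABCD)}`. -/
def weylSpinor (S : SpinSpacetime M) (x : M) : Fin 2 → Fin 2 → Fin 2 → Fin 2 → ℂ :=
  symm4 (S.curvSpinor x)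

/-! ### Spin connection -/

/-- The Levi-Civita spin connection coefficients `Γ_i{}^A{}_B` in the direction `E_i`,
`∇_i κ^A = E_i κ^A + Γ_i{}^A{}_B κ^B`.  They are determined by tracelessness (`∇ ε = 0`) and
`(∇_i V)^{AA'} = E_i V^{AA'} + Γ_i{}^A{}_B V^{BA'} + conj(Γ_i{}^{A}{}_{B}) V^{AB'}`, i.e.
`Γ_i{}^A{}_B = (1/2) (∇_{E_i} E_j)^{AA'} s^j_{BA'}`. -/
def spinConn (S : SpinSpacetime M) (x : M) (i : Fin 4) (A B : Fin 2) : ℂ :=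
  (∑ A', ∑ j, ∑ k,
    ((minkowskiSign k * S.g x (S.leviCivita (S.E i) (S.E j) x) (S.E k x) : ℝ) : ℂ) *
      ivdw k A A' * ivdwInv j B A') / 2

/-- `∇_{AA'} f` for a complex scalar field. -/
def nabla0 (S : SpinSpacetime M) (f : M → ℂ) (x : M) (A A' : Fin 2) : ℂ :=
  ∑ i, ivdwInv i A A' * mvfderiv (𝓡 4) f x (S.E i x)

/-- `∇_{AA'} κ_B` for a spinor field `κ_B`. -/
def nabla1 (S : SpinSpacetime M) (κ : M → Fin 2 → ℂ) (x : M) (A A' B : Fin 2) : ℂ :=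
  ∑ i, ivdwInv i A A' *
    (mvfderiv (𝓡 4) (fun y => κ y B) x (S.E i x) - ∑ C, S.spinConn x i C B * κ x C)

/-- `∇_{AA'} K_{BC}` for a spinor field `K_{BC}`. -/
def nabla2 (S : SpinSpacetime M) (K : M → Fin 2 → Fin 2 → ℂ) (x : M) (A A' B C : Fin 2) : ℂ :=
  ∑ i, ivdwInv i A A' *
    (mvfderiv (𝓡 4) (fun y => K y B C) x (S.E i x)
      - ∑ P, S.spinConn x i P B * K x P C - ∑ P, S.spinConn x i P C * K x B P)

/-- `o^A` is a shear-free ray: `o^A o^B ∇_{AA'} o_B = 0`. -/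
def IsShearFreeRay (S : SpinSpacetime M) (D : SpinDyad M) : Prop :=
  ∀ x A', ∑ A, ∑ B, D.o x A * D.o x B * S.nabla1 D.oLow x A A' B = 0

/-- `o^A` is a repeated principal spinor: `Ψ_{ABCD} o^B o^C o^D = 0`. -/
def IsRepeatedPrincipal (S : SpinSpacetime M) (D : SpinDyad M) : Prop :=
  ∀ x A, ∑ B, ∑ C, ∑ P, S.weylSpinor x A B C P * D.o x B * D.o x C * D.o x P = 0

/-! ### GHP spin coefficients -/

/-- The contraction `ξ^B α^A β^{A'} ∇_{AA'} κ_B`. -/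
def contract (S : SpinSpacetime M) (ξ α β : M → Fin 2 → ℂ) (κ : M → Fin 2 → ℂ) (x : M) : ℂ :=
  ∑ A, ∑ A', ∑ B, ξ x B * α x A * β x A' * S.nabla1 κ x A A' B

/-- `ρ = o^B (ι^A ō^{A'} ∇_{AA'}) o_B` -/
def rho (S : SpinSpacetime M) (D : SpinDyad M) (x : M) : ℂ :=
  S.contract D.o D.iota D.oBar D.oLow x

/-- `τ = o^B (ι^A ῑ^{A'} ∇_{AA'}) o_B` -/
def tau (S : SpinSpacetime M) (D : SpinDyad M) (x : M) : ℂ :=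
  S.contract D.o D.iota D.iotaBar D.oLow x

/-- `ρ' = -ι^B (o^A ῑ^{A'} ∇_{AA'}) ι_B` -/
def rho' (S : SpinSpacetime M) (D : SpinDyad M) (x : M) : ℂ :=
  -S.contract D.iota D.o D.iotaBar D.iotaLow x

/-- `τ' = -ι^B (o^A ō^{A'} ∇_{AA'}) ι_B` -/
def tau' (S : SpinSpacetime M) (D : SpinDyad M) (x : M) : ℂ :=
  -S.contract D.iota D.o D.oBar D.iotaLow x

/-- `ε = ι^B (o^A ō^{A'} ∇_{AA'}) o_B` -/
def epsilon (S : SpinSpacetime M) (D : SpinDyad M) (x : M) : ℂ :=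
  S.contract D.iota D.o D.oBar D.oLow x

/-- `β = ι^B (o^A ῑ^{A'} ∇_{AA'}) o_B` -/
def beta (S : SpinSpacetime M) (D : SpinDyad M) (x : M) : ℂ :=
  S.contract D.iota D.o D.iotaBar D.oLow x

/-- `ε' = -o^B (ι^A ῑ^{A'} ∇_{AA'}) ι_B` -/
def epsilon' (S : SpinSpacetime M) (D : SpinDyad M) (x : M) : ℂ :=
  -S.contract D.o D.iota D.iotaBar D.iotaLow x

/-- `β' = -o^B (ι^A ō^{A'} ∇_{AA'}) ι_B` -/
def beta' (S : SpinSpacetime M) (D : SpinDyad M) (x : M) : ℂ :=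
  -S.contract D.o D.iota D.oBar D.iotaLow x

/-! ### The conformal-GHP connection -/

/-- `ω_a = -ε n_a + ε' ℓ_a - β' m_a + β m̄_a` -/
def omegaForm (S : SpinSpacetime M) (D : SpinDyad M) (x : M) (A A' : Fin 2) : ℂ :=
  -S.epsilon D x * D.n x A A' + S.epsilon' D x * D.l x A A'
    - S.beta' D x * D.m x A A' + S.beta D x * D.mBar x A A'

/-- `B_a = -ρ n_a + τ m̄_a` -/
def bForm (S : SpinSpacetime M) (D : SpinDyad M) (x : M) (A A' : Fin 2) : ℂ :=
  -S.rho D x * D.n x A A' + S.tau D x * D.mBar x A A'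

/-- `f_a = ρ n_a + ρ' ℓ_a - τ' m_a - τ m̄_a` -/
def fForm (S : SpinSpacetime M) (D : SpinDyad M) (x : M) (A A' : Fin 2) : ℂ :=
  S.rho D x * D.n x A A' + S.rho' D x * D.l x A A'
    - S.tau' D x * D.m x A A' - S.tau D x * D.mBar x A A'

/-- The conformal-GHP derivative `𝒞_{AA'} ψ` of a scalar of GHP weight `{p,0}` and conformal
weight `w`. -/
def conf0 (S : SpinSpacetime M) (D : SpinDyad M) (p w : ℤ) (ψ : M → ℂ) (x : M)
    (A A' : Fin 2) : ℂ :=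
  S.nabla0 ψ x A A'
    + (w * S.fForm D x A A' + p * (S.omegaForm D x A A' + S.bForm D x A A')) * ψ x

/-- The conformal-GHP derivative `𝒞_{AA'} ψ_B` of a spinor field `ψ_B` of GHP weight `{p,0}` and
conformal weight `w`. -/
def conf1 (S : SpinSpacetime M) (D : SpinDyad M) (p w : ℤ) (ψ : M → Fin 2 → ℂ) (x : M)
    (A A' B : Fin 2) : ℂ :=
  S.nabla1 ψ x A A' B
    + (w * S.fForm D x A A' + p * (S.omegaForm D x A A' + S.bForm D x A A')) * ψ x B
    - S.fForm D x B A' * ψ x A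

/-- The projected connection `𝒞̃_{A'} ψ = o^A 𝒞_{AA'} ψ` on weighted scalars. -/
def confProj0 (S : SpinSpacetime M) (D : SpinDyad M) (p w : ℤ) (ψ : M → ℂ) (x : M)
    (A' : Fin 2) : ℂ :=
  ∑ A, D.o x A * S.conf0 D p w ψ x A A'

/-- The projected connection `𝒞̃_{A'} ψ_B = o^A 𝒞_{AA'} ψ_B` on weighted spinors `ψ_B`. -/
def confProj1 (S : SpinSpacetime M) (D : SpinDyad M) (p w : ℤ) (ψ : M → Fin 2 → ℂ) (x : M)
    (A' B : Fin 2) : ℂ :=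
  ∑ A, D.o x A * S.conf1 D p w ψ x A A' B

/-! ### Potentials and the projected Killing spinor equation -/

/-- The scalars `φ` (nowhere zero, weights `{0,0}`, `-1`) and `η` (weights `{-2,0}`, `-1`) satisfy
`f_{AA'} = ∇_{AA'} log φ - o_A 𝒞̃_{A'} η` on `U`, where `∇ log φ = φ⁻¹ ∇ φ`. -/
def IsPotentialPair (S : SpinSpacetime M) (D : SpinDyad M) (φ η : M → ℂ) (U : Set M) : Prop :=
  ∀ x ∈ U, φ x ≠ 0 ∧ ∀ A A', S.fForm D x A A' =
    (φ x)⁻¹ * S.nabla0 φ x A A' - D.oLow x A * S.confProj0 D (-2) (-1) η x A'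

/-- `K_{AB}` solves the projected Killing spinor equation `o^A ∇_{A'(A} K_{BC)} = 0` on `U`. -/
def IsProjectedKillingSpinor (S : SpinSpacetime M) (D : SpinDyad M)
    (K : M → Fin 2 → Fin 2 → ℂ) (U : Set M) : Prop :=
  ∀ x ∈ U, ∀ A' B C,
    ∑ A, D.o x A * symm3 (fun P Q R => S.nabla2 K x P A' Q R) A B C = 0

end SpinSpacetime

/-- The field `K_{AB} = φ⁻¹ (o_{(A} ι_{B)} - η o_A o_B)`. -/
def projKillingField {M : Type*} [TopologicalSpace M]
    [ChartedSpace (EuclideanSpace ℝ (Fin 4)) M] (D : SpinDyad M) (φ η : M → ℂ)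
    (x : M) (A B : Fin 2) : ℂ :=
  (φ x)⁻¹ * ((D.oLow x A * D.iotaLow x B + D.oLow x B * D.iotaLow x A) / 2
    - η x * D.oLow x A * D.oLow x B)

end

/-! Write Γ_{aA'}^i_j for `conn a A' i j`, the spin connection in the dyad ε_0 = o, ε_1 = ι, and put
X_{A'} = o^A ∇_{AA'}, Y_{A'} = ι^A ∇_{AA'}. The ray condition says Γ_{0A'}^1_0 = 0. The GHP
coefficients are components of Γ, and the three forms collapse to f_{AA'} = ι_A Γ_{1A'}^1_0 - o_A
Γ_{0A'}^0_1, ω_{AA'} = ι_A Γ_{0A'}^0_0 - o_A Γ_{1A'}^0_0, B_{AA'} = -ι_A Γ_{1A'}^1_0 (`fForm_eq`,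
`omegaForm_eq`, `bForm_eq`). Contracting with o^A leaves only the ι_A terms, and the parallelism of
o_B and ι_B is a cancellation.

For the potentials put φ = exp u and split the equation for f along o_A and ι_A. It becomes two
overdetermined systems, solved one after the other: X_{A'} u = -Γ_{1A'}^1_0, and X_{A'} η + (2
Γ_{0A'}^0_0 - Γ_{1A'}^1_0) η = Y_{A'} u + Γ_{0A'}^0_1. Shear-freeness makes the span of X_{0'},
X_{1'} involutive (`ray_commutator`). The integrability conditions (`ray_closed`, `ray_flat`,
`ray_compat`) hold because certain components of the spin curvature vanish. Each of these is either
a component of X_{ABCD} contracted with three o's or the difference X_{0011} - X_{1100}, which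
vanishes by pair symmetry. Contraction with three o's does not distinguish X_{ABCD} from its
symmetric part Ψ_{ABCD}, and the trace-free Ricci spinor sits in the other half of the curvature;
this is why no Einstein condition is needed (`rotCurv_of_principal`).

The fields X_{A'} are complex, so the real Frobenius theorem does not apply; analyticity is used
instead. `exists_frobenius` follows from existence and uniqueness for a single noncharacteristic
linear equation (`exists_cauchy`, `cauchy_unique`). Existence is a linear Cauchy-Kovalevskaya
theorem (`exists_formal_cauchy`): the integrated equation is solved by a Neumann series in a
weighted ℓ¹ space of power series, the weight being chosen so that a transversal derivative followed
by integration in the distinguished variable is bounded with small norm.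

The moving-frame identities are pure algebra, proved over any commutative ℂ-algebra with four
derivations and then read off in the algebra of functions smooth on an open set. Finally, that
potentials give a projected Killing spinor is the Leibniz rule, with ∇ log φ eliminated through the
equation for f. -/

noncomputable section

/-! ### Weighted `ℓ¹` norms of formal power series -/

namespace MvPowerSeries

open scoped ENNReal NNReal

variable {σ : Type*}

/-- The weighted `ℓ¹` norm of a formal power series. -/
def wnorm (w : (σ →₀ ℕ) → ℝ≥0∞) (u : MvPowerSeries σ ℂ) : ℝ≥0∞ := ∑' α, ‖coeff α u‖ₑ * w α

lemma wnorm_add_le (w : (σ →₀ ℕ) → ℝ≥0∞) (u v : MvPowerSeries σ ℂ) :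
    wnorm w (u + v) ≤ wnorm w u + wnorm w v := by
  unfold wnorm
  rw [← ENNReal.tsum_add]
  refine ENNReal.tsum_le_tsum fun α => ?_
  rw [← add_mul, map_add]
  gcongr
  exact enorm_add_le _ _

@[simp] lemma wnorm_zero (w : (σ →₀ ℕ) → ℝ≥0∞) : wnorm w (0 : MvPowerSeries σ ℂ) = 0 := by
  simp [wnorm]

lemma wnorm_neg (w : (σ →₀ ℕ) → ℝ≥0∞) (u : MvPowerSeries σ ℂ) : wnorm w (-u) = wnorm w u := by
  simp [wnorm]

lemma wnorm_sum_le {ι : Type*} (w : (σ →₀ ℕ) → ℝ≥0∞) (s : Finset ι) (u : ι → MvPowerSeries σ ℂ) :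
    wnorm w (∑ k ∈ s, u k) ≤ ∑ k ∈ s, wnorm w (u k) := by
  classical
  induction s using Finset.induction_on with
  | empty => simp
  | insert a s ha ih =>
    rw [Finset.sum_insert ha, Finset.sum_insert ha]
    exact (wnorm_add_le _ _ _).trans (by gcongr)

/-- The product of the norms is a double sum over pairs of exponents. Grouping the pairs by their
sum produces the Cauchy product; with values in `ℝ≥0∞` this rearrangement needs no summability. -/
lemma wnorm_mul_le (w : (σ →₀ ℕ) → ℝ≥0∞) (hw : ∀ α β, w (α + β) ≤ w α * w β)
    (u v : MvPowerSeries σ ℂ) : wnorm w (u * v) ≤ wnorm w u * wnorm w v := by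
  classical
  have h1 : wnorm w u * wnorm w v =
      ∑' p : (σ →₀ ℕ) × (σ →₀ ℕ), (‖coeff p.1 u‖ₑ * w p.1) * (‖coeff p.2 v‖ₑ * w p.2) := by
    rw [ENNReal.tsum_prod (f := fun a b => (‖coeff a u‖ₑ * w a) * (‖coeff b v‖ₑ * w b))]
    simp_rw [ENNReal.tsum_mul_left, ENNReal.tsum_mul_right]
    rfl
  rw [h1, ← Finset.HasAntidiagonal.sigmaAntidiagonalEquivProd.tsum_eq, ENNReal.tsum_sigma']
  refine ENNReal.tsum_le_tsum fun α => ?_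
  rw [coeff_mul]
  simp only [Finset.HasAntidiagonal.sigmaAntidiagonalEquivProd]
  simp only [Equiv.coe_fn_mk]
  rw [tsum_fintype, Finset.sum_coe_sort (Finset.HasAntidiagonal.antidiagonal α)
    (fun p : (σ →₀ ℕ) × (σ →₀ ℕ) => (‖coeff p.1 u‖ₑ * w p.1) * (‖coeff p.2 v‖ₑ * w p.2))]
  calc ‖∑ p ∈ Finset.HasAntidiagonal.antidiagonal α, coeff p.1 u * coeff p.2 v‖ₑ * w α
      ≤ (∑ p ∈ Finset.HasAntidiagonal.antidiagonal α, ‖coeff p.1 u * coeff p.2 v‖ₑ) * w α := by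
        gcongr; exact enorm_sum_le _ _
    _ = ∑ p ∈ Finset.HasAntidiagonal.antidiagonal α, ‖coeff p.1 u * coeff p.2 v‖ₑ * w α := Finset.sum_mul _ _ _
    _ ≤ _ := by
        refine Finset.sum_le_sum fun p hp => ?_
        rw [← Finset.HasAntidiagonal.mem_antidiagonal.1 hp, enorm_mul]
        calc _ ≤ ‖coeff p.1 u‖ₑ * ‖coeff p.2 v‖ₑ * (w p.1 * w p.2) := by gcongr; exact hw _ _
          _ = _ := by ring

lemma wnorm_mono {w w' : (σ →₀ ℕ) → ℝ≥0∞} (h : ∀ α, w α ≤ w' α) (u : MvPowerSeries σ ℂ) :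
    wnorm w u ≤ wnorm w' u :=
  ENNReal.tsum_le_tsum fun α => by gcongr; exact h α

lemma eq_zero_of_wnorm_eq_zero {w : (σ →₀ ℕ) → ℝ≥0∞} (hw : ∀ α, w α ≠ 0) {u : MvPowerSeries σ ℂ}
    (h : wnorm w u = 0) : u = 0 := by
  ext α
  have := ENNReal.tsum_eq_zero.1 h α
  simpa [hw α] using this

/-- A linear map which halves a weighted norm admits a fixed point `u = δ + T u` of finite norm. -/
lemma exists_fixedPoint {w : (σ →₀ ℕ) → ℝ≥0∞} (hw : ∀ α, w α ≠ 0)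
    (T : MvPowerSeries σ ℂ →ₗ[ℂ] MvPowerSeries σ ℂ)
    (hT : ∀ u, wnorm w (T u) ≤ 2⁻¹ * wnorm w u) (δ : MvPowerSeries σ ℂ) (hδ : wnorm w δ ≠ ⊤) :
    ∃ u, u = δ + T u ∧ wnorm w u ≠ ⊤ := by
  have hpow : ∀ n, wnorm w ((T ^ n) δ) ≤ 2⁻¹ ^ n * wnorm w δ := by
    intro n
    induction n with
    | zero => simp
    | succ n ih =>
      rw [pow_succ', Module.End.mul_apply]
      calc _ ≤ _ := hT _
        _ ≤ 2⁻¹ * (2⁻¹ ^ n * wnorm w δ) := by gcongr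
        _ = _ := by ring
  have htail : ∀ k, ∑' n, wnorm w ((T ^ (n + k)) δ) ≤ 2⁻¹ ^ k * (2 * wnorm w δ) := by
    intro k
    calc _ ≤ ∑' n, (2⁻¹ : ℝ≥0∞) ^ n * (2⁻¹ ^ k * wnorm w δ) := by
          refine ENNReal.tsum_le_tsum fun n => (hpow _).trans (le_of_eq ?_)
          rw [pow_add]; ring
      _ = _ := by
          rw [ENNReal.tsum_mul_right, ENNReal.tsum_geometric, ENNReal.one_sub_inv_two, inv_inv]
          ring
  -- A divergent coefficient sum, multiplied by its nonzero weight, would make `∑ ‖Tⁿ δ‖` infinite.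
  have hfin : ∀ α, ∑' n, ‖coeff α ((T ^ n) δ)‖ₑ ≠ ⊤ := by
    intro α h
    have h1 : ∑' n, wnorm w ((T ^ n) δ) ≠ ⊤ := by
      refine ne_top_of_le_ne_top ?_ (htail 0)
      simp [ENNReal.mul_eq_top, hδ]
    apply h1
    rw [eq_top_iff]
    calc ⊤ = (∑' n, ‖coeff α ((T ^ n) δ)‖ₑ) * w α := by
          rw [h, ENNReal.top_mul (hw α)]
      _ = ∑' n, ‖coeff α ((T ^ n) δ)‖ₑ * w α := ENNReal.tsum_mul_right.symm
      _ ≤ _ := ENNReal.tsum_le_tsum fun n => ENNReal.le_tsum α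
  have hsum : ∀ α, Summable fun n => coeff α ((T ^ n) δ) := fun α =>
    Summable.of_enorm (hfin α)
  -- The Neumann series `∑ Tⁿ δ`, summed coefficient by coefficient.
  let u : MvPowerSeries σ ℂ := fun α => ∑' n, coeff α ((T ^ n) δ)
  have hu : ∀ α, coeff α u = ∑' n, coeff α ((T ^ n) δ) := fun α => rfl
  have hrem : ∀ k, wnorm w (u - ∑ n ∈ Finset.range k, (T ^ n) δ) ≤ 2⁻¹ ^ k * (2 * wnorm w δ) := by
    intro k
    refine le_trans ?_ (htail k)
    unfold wnorm
    rw [ENNReal.tsum_comm]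
    refine ENNReal.tsum_le_tsum fun α => ?_
    rw [ENNReal.tsum_mul_right]
    gcongr
    rw [map_sub, hu, map_sum, ← (hsum α).sum_add_tsum_nat_add k, add_sub_cancel_left]
    exact enorm_tsum_le_tsum_enorm
  refine ⟨u, ?_, ?_⟩
  · rw [← sub_eq_zero]
    apply eq_zero_of_wnorm_eq_zero hw
    -- The defect of `u` is the remainder after `k + 1` terms minus `T` of the remainder after `k`
    -- terms, hence of size `2⁻ᵏ` for every `k`.
    have hbound : ∀ k, wnorm w (u - (δ + T u)) ≤ 2⁻¹ ^ k * (4 * wnorm w δ) := by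
      intro k
      have : u - (δ + T u) = (u - ∑ n ∈ Finset.range (k + 1), (T ^ n) δ)
          + -(T (u - ∑ n ∈ Finset.range k, (T ^ n) δ)) := by
        rw [Finset.sum_range_succ', map_sub, map_sum]
        simp only [pow_succ', Module.End.mul_apply, pow_zero, Module.End.one_apply]
        abel
      rw [this]
      calc _ ≤ _ := wnorm_add_le _ _ _
        _ ≤ 2⁻¹ ^ (k + 1) * (2 * wnorm w δ) + 2⁻¹ * (2⁻¹ ^ k * (2 * wnorm w δ)) := by
            rw [wnorm_neg]
            gcongr
            · exact hrem _
            · exact (hT _).trans (by gcongr; exact hrem _)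
        _ = 2⁻¹ ^ k * ((2⁻¹ * 2 + 2⁻¹ * 2) * wnorm w δ) := by ring
        _ ≤ _ := by
            rw [ENNReal.inv_mul_cancel (by simp) (by simp)]
            gcongr
            norm_num
    have hlim : Filter.Tendsto (fun k : ℕ => (2⁻¹ : ℝ≥0∞) ^ k * (4 * wnorm w δ)) Filter.atTop
        (nhds (0 * (4 * wnorm w δ))) := by
      refine ENNReal.Tendsto.mul_const (ENNReal.tendsto_pow_atTop_nhds_zero_of_lt_one ?_) ?_
      · simp
      · right; simp [ENNReal.mul_eq_top, hδ]
    rw [zero_mul] at hlim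
    exact le_antisymm (ge_of_tendsto' hlim hbound) zero_le
  · have := hrem 0
    simp only [Finset.range_zero, Finset.sum_empty, sub_zero, pow_zero, one_mul] at this
    refine ne_top_of_le_ne_top ?_ this
    simp [ENNReal.mul_eq_top, hδ]

/-! ### Formal integration -/

/-- Formal integration in the variable `i`, with zero constant of integration. -/
def integ (i : σ) : MvPowerSeries σ ℂ →ₗ[ℂ] MvPowerSeries σ ℂ where
  toFun u := fun α => if α i = 0 then 0 else coeff (α - Finsupp.single i 1) u / (α i : ℂ)
  map_add' u v := by
    funext α
    change (if α i = 0 then (0 : ℂ) else coeff _ (u + v) / _) =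
      (if α i = 0 then 0 else coeff _ u / _) + (if α i = 0 then 0 else coeff _ v / _)
    split_ifs <;> simp [add_div]
  map_smul' c u := by
    funext α
    change (if α i = 0 then (0 : ℂ) else coeff _ (c • u) / _) =
      c * (if α i = 0 then 0 else coeff _ u / _)
    split_ifs <;> simp [mul_div_assoc]

lemma coeff_integ (i : σ) (u : MvPowerSeries σ ℂ) (α : σ →₀ ℕ) :
    coeff α (integ i u) = if α i = 0 then 0 else coeff (α - Finsupp.single i 1) u / (α i : ℂ) := rfl

lemma coeff_integ_add_single (i : σ) (u : MvPowerSeries σ ℂ) (α : σ →₀ ℕ) :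
    coeff (α + Finsupp.single i 1) (integ i u) = coeff α u / ((α i : ℂ) + 1) := by
  rw [coeff_integ]
  simp

lemma pderiv_integ (i : σ) (u : MvPowerSeries σ ℂ) : pderiv ℂ i (integ i u) = u := by
  ext α
  rw [coeff_pderiv, coeff_integ_add_single]
  have : (α i : ℂ) + 1 ≠ 0 := by exact_mod_cast Nat.succ_ne_zero (α i)
  field_simp

/-- The coefficients with `α i = 0` vanish, so the sum runs over the shifted exponents only. -/
lemma wnorm_integ (w : (σ →₀ ℕ) → ℝ≥0∞) (i : σ) (u : MvPowerSeries σ ℂ) :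
    wnorm w (integ i u) =
      ∑' α, ‖coeff α u / ((α i : ℂ) + 1)‖ₑ * w (α + Finsupp.single i 1) := by
  unfold wnorm
  have hinj : Function.Injective fun α : σ →₀ ℕ => α + Finsupp.single i 1 :=
    add_left_injective _
  rw [← hinj.tsum_eq (f := fun α => ‖coeff α (integ i u)‖ₑ * w α)]
  · simp_rw [coeff_integ_add_single]
  · intro α hα
    by_cases h : α i = 0
    · simp [coeff_integ, h] at hα
    · refine ⟨α - Finsupp.single i 1, ?_⟩
      simp only
      rw [tsub_add_cancel_of_le]
      simpa [Nat.one_le_iff_ne_zero] using h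

end MvPowerSeries

end

noncomputable section

namespace MvPowerSeries

open scoped ENNReal NNReal

variable {σ : Type*}

/-! ### Weights adapted to a distinguished time variable -/

/-- The weight `s ^ αᵢ * r ^ (|α| - αᵢ) / (|α| choose αᵢ)`. -/
def ckWeight (i : σ) (s r : ℝ) (α : σ →₀ ℕ) : ℝ :=
  s ^ α i * r ^ (α.degree - α i) / (α.degree.choose (α i))

/-- One term of Vandermonde's sum is at most the whole. This makes the weight `ckWeight`
submultiplicative in spite of its binomial denominator. -/
lemma choose_mul_choose_le (m n m' n' : ℕ) :
    n.choose m * n'.choose m' ≤ (n + n').choose (m + m') := by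
  rw [Nat.add_choose_eq]
  exact Finset.single_le_sum (f := fun ij : ℕ × ℕ => n.choose ij.1 * n'.choose ij.2)
    (fun _ _ => Nat.zero_le _) (a := (m, m'))
    (by simp [Finset.HasAntidiagonal.mem_antidiagonal])

lemma choose_degree_pos (i : σ) (α : σ →₀ ℕ) : (0 : ℝ) < α.degree.choose (α i) := by
  exact_mod_cast Nat.choose_pos (Finsupp.le_degree i α)

lemma ckWeight_pos (i : σ) {s r : ℝ} (hs : 0 < s) (hr : 0 < r) (α : σ →₀ ℕ) :
    0 < ckWeight i s r α := by
  have := choose_degree_pos i α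
  unfold ckWeight
  positivity

lemma ckWeight_add_le (i : σ) {s r : ℝ} (hs : 0 < s) (hr : 0 < r) (α β : σ →₀ ℕ) :
    ckWeight i s r (α + β) ≤ ckWeight i s r α * ckWeight i s r β := by
  unfold ckWeight
  have h1 := Finsupp.le_degree i α
  have h2 := Finsupp.le_degree i β
  have h3 : (α + β).degree - (α + β) i = (α.degree - α i) + (β.degree - β i) := by
    rw [map_add, Finsupp.add_apply]; omega
  rw [h3, map_add, Finsupp.add_apply, pow_add, pow_add, div_mul_div_comm]
  have h4 := choose_degree_pos i α
  have h5 := choose_degree_pos i β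
  have h6 : ((α.degree.choose (α i) : ℝ) * β.degree.choose (β i)) ≤
      ((α.degree + β.degree).choose (α i + β i) : ℕ) := by
    exact_mod_cast choose_mul_choose_le _ _ _ _
  calc _ ≤ s ^ α i * s ^ β i * (r ^ (α.degree - α i) * r ^ (β.degree - β i)) /
        ((α.degree.choose (α i) : ℝ) * β.degree.choose (β i)) := by gcongr
    _ = _ := by ring

lemma ckWeight_le (i : σ) {s r : ℝ} (hs : 0 < s) (hsr : s ≤ r) (α : σ →₀ ℕ) :
    ckWeight i s r α ≤ r ^ α.degree := by
  have h1 := Finsupp.le_degree i α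
  have hr : 0 < r := hs.trans_le hsr
  have h2 : (1 : ℝ) ≤ α.degree.choose (α i) := by exact_mod_cast Nat.choose_pos h1
  calc ckWeight i s r α ≤ s ^ α i * r ^ (α.degree - α i) := div_le_self (by positivity) h2
    _ ≤ r ^ α i * r ^ (α.degree - α i) := by gcongr
    _ = r ^ α.degree := by rw [← pow_add]; congr 1; omega

/-- A binomial coefficient of `n` is at most `2ⁿ`, so dividing by it costs a factor 2 in the radius:
finite `ckWeight` norm gives convergence with radius `s / 2`. -/
lemma le_ckWeight (i : σ) {s r : ℝ} (hs : 0 < s) (hsr : s ≤ r) (α : σ →₀ ℕ) :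
    (s / 2) ^ α.degree ≤ ckWeight i s r α := by
  have h1 := Finsupp.le_degree i α
  have hr : 0 < r := hs.trans_le hsr
  have h2 : (α.degree.choose (α i) : ℝ) ≤ 2 ^ α.degree := by
    exact_mod_cast Nat.choose_le_two_pow _ _
  have h3 := choose_degree_pos i α
  unfold ckWeight
  rw [div_pow]
  calc s ^ α.degree / 2 ^ α.degree ≤ s ^ α.degree / α.degree.choose (α i) := by gcongr
    _ = s ^ α i * s ^ (α.degree - α i) / α.degree.choose (α i) := by
        rw [← pow_add]; congr 2; omega
    _ ≤ _ := by gcongr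

lemma ckWeight_add_single_self (i : σ) {s r : ℝ} (hs : 0 < s) (hr : 0 < r) (α : σ →₀ ℕ) :
    ckWeight i s r (α + Finsupp.single i 1) / (α i + 1) ≤ s * ckWeight i s r α := by
  have h1 := Finsupp.le_degree i α
  unfold ckWeight
  have h2 : (α + Finsupp.single i 1).degree = α.degree + 1 := by simp
  have h3 : (α + Finsupp.single i 1 : σ →₀ ℕ) i = α i + 1 := by simp
  rw [h2, h3, Nat.add_sub_add_right]
  have h4 := choose_degree_pos i α
  have h5 : ((α.degree.choose (α i) : ℝ)) ≤ (α.degree + 1).choose (α i + 1) * (α i + 1) := by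
    have := Nat.add_one_mul_choose_eq α.degree (α i)
    have h6 : ((α.degree : ℝ) + 1) * α.degree.choose (α i) =
        (α.degree + 1).choose (α i + 1) * (α i + 1) := by exact_mod_cast this
    rw [← h6]
    have : (0 : ℝ) ≤ α.degree := Nat.cast_nonneg _
    nlinarith
  rw [div_div]
  calc _ ≤ s ^ (α i + 1) * r ^ (α.degree - α i) / α.degree.choose (α i) := by gcongr
    _ = _ := by rw [pow_succ]; ring

/-- The reason for the binomial denominator. Applying ∂_k and then integrating in `i` multiplies a
coefficient by (α_k + 1)/(α_i + 1), which is at most (n - m + 1)/(m + 1) with n = |α|, m = α_i. This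
bound equals the ratio of the binomials (n+1 choose m+1) and (n+1 choose m), so the loss from the
derivative is absorbed by the weight and only s / r remains. -/
lemma ckWeight_add_single_ne {i k : σ} (hk : k ≠ i) {s r : ℝ} (hs : 0 < s) (hr : 0 < r)
    (α : σ →₀ ℕ) :
    (α k + 1) / (α i + 1) * ckWeight i s r (α + Finsupp.single i 1) ≤
      s / r * ckWeight i s r (α + Finsupp.single k 1) := by
  classical
  have h1 : α k + α i ≤ α.degree := by
    have h := Finsupp.le_degree k (α - Finsupp.single i (α i))
    have h' : α - Finsupp.single i (α i) + Finsupp.single i (α i) = α :=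
      tsub_add_cancel_of_le (by simp)
    have h'' := congrArg Finsupp.degree h'
    rw [map_add, Finsupp.degree_single] at h''
    simp only [Finsupp.coe_tsub, Pi.sub_apply, Finsupp.single_apply, hk.symm, if_false] at h
    omega
  unfold ckWeight
  have h2 : (α + Finsupp.single i 1).degree = α.degree + 1 := by simp
  have h2' : (α + Finsupp.single k 1).degree = α.degree + 1 := by simp
  have h3 : (α + Finsupp.single i 1 : σ →₀ ℕ) i = α i + 1 := by simp
  have h3' : (α + Finsupp.single k 1 : σ →₀ ℕ) i = α i := by simp [hk]
  rw [h2, h2', h3, h3', Nat.add_sub_add_right]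
  have e : α.degree + 1 - α i = (α.degree - α i) + 1 := by omega
  have hc := Nat.choose_succ_right_eq (α.degree + 1) (α i)
  rw [e] at hc ⊢
  have hc' : ((α.degree + 1).choose (α i + 1) : ℝ) * (α i + 1) =
      (α.degree + 1).choose (α i) * (((α.degree - α i : ℕ) : ℝ) + 1) := by exact_mod_cast hc
  have h4 : (0 : ℝ) < (α.degree + 1).choose (α i) := by
    exact_mod_cast Nat.choose_pos (by omega)
  have h5 : (0 : ℝ) < (α.degree + 1).choose (α i + 1) := by
    exact_mod_cast Nat.choose_pos (by omega)
  have h6 : (α k : ℝ) + 1 ≤ ((α.degree - α i : ℕ) : ℝ) + 1 := by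
    have : α k ≤ α.degree - α i := by omega
    gcongr
  calc (α k + 1 : ℝ) / (α i + 1) * (s ^ (α i + 1) * r ^ (α.degree - α i) /
          (α.degree + 1).choose (α i + 1))
      = s ^ (α i + 1) * r ^ (α.degree - α i) * (α k + 1) /
          ((α.degree + 1).choose (α i + 1) * (α i + 1)) := by field_simp
    _ ≤ s ^ (α i + 1) * r ^ (α.degree - α i) * (((α.degree - α i : ℕ) : ℝ) + 1) /
          ((α.degree + 1).choose (α i + 1) * (α i + 1)) := by gcongr
    _ = s / r * (s ^ α i * r ^ (α.degree - α i + 1) / (α.degree + 1).choose (α i)) := by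
        rw [hc', pow_succ, pow_succ]
        field_simp

/-! ### The formal Cauchy problem -/

/-- The norm with weight `ckWeight`. -/
def cknorm (i : σ) (s r : ℝ) : MvPowerSeries σ ℂ → ℝ≥0∞ :=
  wnorm fun α => ENNReal.ofReal (ckWeight i s r α)

lemma cknorm_mul_le (i : σ) {s r : ℝ} (hs : 0 < s) (hr : 0 < r) (u v : MvPowerSeries σ ℂ) :
    cknorm i s r (u * v) ≤ cknorm i s r u * cknorm i s r v := by
  refine wnorm_mul_le _ (fun α β => ?_) u v
  rw [← ENNReal.ofReal_mul (ckWeight_pos i hs hr α).le]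
  exact ENNReal.ofReal_le_ofReal (ckWeight_add_le i hs hr α β)

lemma cknorm_integ_le (i : σ) {s r : ℝ} (hs : 0 < s) (hr : 0 < r) (u : MvPowerSeries σ ℂ) :
    cknorm i s r (integ i u) ≤ ENNReal.ofReal s * cknorm i s r u := by
  unfold cknorm
  rw [wnorm_integ]
  unfold wnorm
  rw [← ENNReal.tsum_mul_left]
  refine ENNReal.tsum_le_tsum fun α => ?_
  rw [← ofReal_norm, ← ofReal_norm, ← ENNReal.ofReal_mul (norm_nonneg _),
    ← ENNReal.ofReal_mul (norm_nonneg _), ← ENNReal.ofReal_mul hs.le]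
  refine ENNReal.ofReal_le_ofReal ?_
  have : ‖((α i : ℂ) + 1)‖ = (α i : ℝ) + 1 := by
    rw [← Nat.cast_succ, Complex.norm_natCast]; push_cast; ring
  rw [norm_div, this]
  calc _ = ‖coeff α u‖ * (ckWeight i s r (α + Finsupp.single i 1) / (α i + 1)) := by ring
    _ ≤ ‖coeff α u‖ * (s * ckWeight i s r α) := by
        gcongr; exact ckWeight_add_single_self i hs hr α
    _ = _ := by ring

/-- The operator that would be unbounded as a derivative is bounded here, with a norm that becomes
small as `s` shrinks against `r`. -/
lemma cknorm_integ_pderiv_le {i k : σ} (hk : k ≠ i) {s r : ℝ} (hs : 0 < s) (hr : 0 < r)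
    (u : MvPowerSeries σ ℂ) :
    cknorm i s r (integ i (pderiv ℂ k u)) ≤ ENNReal.ofReal (s / r) * cknorm i s r u := by
  unfold cknorm
  rw [wnorm_integ]
  have hinj : Function.Injective fun α : σ →₀ ℕ => α + Finsupp.single k 1 := add_left_injective _
  calc _ ≤ ∑' α, ENNReal.ofReal (s / r) * (‖coeff (α + Finsupp.single k 1) u‖ₑ *
        ENNReal.ofReal (ckWeight i s r (α + Finsupp.single k 1))) := ?_
    _ = ENNReal.ofReal (s / r) * ∑' α, (‖coeff (α + Finsupp.single k 1) u‖ₑ *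
        ENNReal.ofReal (ckWeight i s r (α + Finsupp.single k 1))) := ENNReal.tsum_mul_left
    _ ≤ _ := by
        gcongr
        exact ENNReal.tsum_comp_le_tsum_of_injective hinj
          fun α => ‖coeff α u‖ₑ * ENNReal.ofReal (ckWeight i s r α)
  refine ENNReal.tsum_le_tsum fun α => ?_
  rw [← ofReal_norm, ← ofReal_norm, ← ENNReal.ofReal_mul (norm_nonneg _),
    ← ENNReal.ofReal_mul (norm_nonneg _), ← ENNReal.ofReal_mul (by positivity)]
  refine ENNReal.ofReal_le_ofReal ?_
  have h (j : σ) : ‖((α j : ℂ) + 1)‖ = (α j : ℝ) + 1 := by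
    rw [← Nat.cast_succ, Complex.norm_natCast]; push_cast; ring
  rw [coeff_pderiv, norm_div, norm_mul, h, h]
  calc _ = ‖coeff (α + Finsupp.single k 1) u‖ *
        ((α k + 1) / (α i + 1) * ckWeight i s r (α + Finsupp.single i 1)) := by ring
    _ ≤ ‖coeff (α + Finsupp.single k 1) u‖ *
        (s / r * ckWeight i s r (α + Finsupp.single k 1)) := by
        exact mul_le_mul_of_nonneg_left (ckWeight_add_single_ne hk hs hr α) (norm_nonneg _)
    _ = _ := by ring

/-- The weighted norm `∑ |u_α| r^|α|`. -/
def radnorm (r : ℝ) : MvPowerSeries σ ℂ → ℝ≥0∞ := wnorm fun α => ENNReal.ofReal (r ^ α.degree)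

lemma radnorm_mono {r r' : ℝ} (hr : 0 ≤ r) (h : r ≤ r') (u : MvPowerSeries σ ℂ) :
    radnorm r u ≤ radnorm r' u :=
  wnorm_mono (fun α => ENNReal.ofReal_le_ofReal (by gcongr)) u

/-- A power series is convergent if it has finite norm for some positive radius. -/
def IsConvergent (u : MvPowerSeries σ ℂ) : Prop := ∃ r : ℝ, 0 < r ∧ radnorm r u ≠ ⊤

lemma wnorm_congr_ne_top {w : (σ →₀ ℕ) → ℝ≥0∞} {u v : MvPowerSeries σ ℂ} (hu : wnorm w u ≠ ⊤)
    (hv : wnorm w v ≠ ⊤) : wnorm w (u + v) ≠ ⊤ :=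
  ne_top_of_le_ne_top (ENNReal.add_ne_top.2 ⟨hu, hv⟩) (wnorm_add_le _ _ _)

lemma radnorm_pow_add (r : ℝ) (hr : 0 ≤ r) (α β : σ →₀ ℕ) :
    ENNReal.ofReal (r ^ (α + β).degree) ≤
      ENNReal.ofReal (r ^ α.degree) * ENNReal.ofReal (r ^ β.degree) := by
  rw [← ENNReal.ofReal_mul (by positivity), map_add, pow_add]

/-- Halving the radius gains 2^{-|α|}, which beats the factor α_k + 1 ≤ 2 · 2^{|α|} produced by
differentiation. -/
lemma radnorm_pderiv_ne_top {u : MvPowerSeries σ ℂ} {r : ℝ} (hr : 0 < r) (h : radnorm r u ≠ ⊤)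
    (k : σ) : radnorm (r / 2) (pderiv ℂ k u) ≠ ⊤ := by
  have hinj : Function.Injective fun α : σ →₀ ℕ => α + Finsupp.single k 1 := add_left_injective _
  refine ne_top_of_le_ne_top (b := ENNReal.ofReal (2 / r) * radnorm r u)
    (ENNReal.mul_ne_top (by simp) h) ?_
  unfold radnorm
  calc _ ≤ ∑' α, ENNReal.ofReal (2 / r) * (‖coeff (α + Finsupp.single k 1) u‖ₑ *
        ENNReal.ofReal (r ^ (α + Finsupp.single k 1 : σ →₀ ℕ).degree)) := ?_
    _ = ENNReal.ofReal (2 / r) * ∑' α, (‖coeff (α + Finsupp.single k 1) u‖ₑ *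
        ENNReal.ofReal (r ^ (α + Finsupp.single k 1 : σ →₀ ℕ).degree)) := ENNReal.tsum_mul_left
    _ ≤ _ := by
        gcongr
        exact ENNReal.tsum_comp_le_tsum_of_injective hinj
          fun α => ‖coeff α u‖ₑ * ENNReal.ofReal (r ^ α.degree)
  refine ENNReal.tsum_le_tsum fun α => ?_
  rw [← ofReal_norm, ← ofReal_norm, ← ENNReal.ofReal_mul (norm_nonneg _),
    ← ENNReal.ofReal_mul (norm_nonneg _), ← ENNReal.ofReal_mul (by positivity)]
  refine ENNReal.ofReal_le_ofReal ?_
  have h (j : σ) : ‖((α j : ℂ) + 1)‖ = (α j : ℝ) + 1 := by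
    rw [← Nat.cast_succ, Complex.norm_natCast]; push_cast; ring
  rw [coeff_pderiv, norm_mul, h]
  have h2 : (α + Finsupp.single k 1).degree = α.degree + 1 := by simp
  rw [h2, div_pow]
  have h3 : (α k : ℝ) + 1 ≤ 2 * 2 ^ α.degree := by
    have h4 : α k + 1 ≤ 2 ^ (α.degree + 1) :=
      (Nat.lt_two_pow_self (n := α k + 1)).le.trans
        (Nat.pow_le_pow_right (by norm_num) (by have := Finsupp.le_degree k α; omega))
    rw [pow_succ'] at h4
    exact_mod_cast h4
  calc _ = ‖coeff (α + Finsupp.single k 1) u‖ * r ^ α.degree * ((α k + 1) / 2 ^ α.degree) := by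
        ring
    _ ≤ ‖coeff (α + Finsupp.single k 1) u‖ * r ^ α.degree * 2 := by
        gcongr
        rw [div_le_iff₀ (by positivity)]
        exact h3
    _ = _ := by rw [pow_succ]; field_simp

/-- The formal Cauchy–Kovalevskaya theorem for one linear equation with convergent coefficients. -/
theorem exists_formal_cauchy [Fintype σ] [DecidableEq σ] (i : σ) (A : σ → MvPowerSeries σ ℂ)
    (c g : MvPowerSeries σ ℂ) (hA : ∀ k, IsConvergent (A k)) (hc : IsConvergent c)
    (hg : IsConvergent g) :
    ∃ u : MvPowerSeries σ ℂ, IsConvergent u ∧ (∀ α, α i = 0 → coeff α u = 0) ∧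
      pderiv ℂ i u = ∑ k ∈ Finset.univ.erase i, A k * pderiv ℂ k u + c * u + g := by
  choose RA hRA hA using hA
  have hA' : ∀ k, ∃ r, 0 < r ∧ radnorm r (pderiv ℂ k (A k)) ≠ ⊤ := fun k =>
    ⟨RA k / 2, half_pos (hRA k), radnorm_pderiv_ne_top (hRA k) (hA k) k⟩
  choose RB hRB hB using hA'
  obtain ⟨rc, hrc, hc⟩ := hc
  obtain ⟨rg, hrg, hg⟩ := hg
  obtain ⟨r, hr, hrA, hrB, hrc', hrg'⟩ : ∃ r : ℝ, 0 < r ∧ (∀ k, r ≤ RA k) ∧ (∀ k, r ≤ RB k) ∧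
      r ≤ rc ∧ r ≤ rg := by
    have h1 : ∀ᶠ r : ℝ in nhdsWithin 0 (Set.Ioi 0), 0 < r ∧ (∀ k, r ≤ RA k) ∧ (∀ k, r ≤ RB k) ∧
        r ≤ rc ∧ r ≤ rg := by
      have key : ∀ a : ℝ, 0 < a → ∀ᶠ r : ℝ in nhdsWithin 0 (Set.Ioi 0), r ≤ a := fun a ha =>
        nhdsWithin_le_nhds (Iic_mem_nhds ha)
      exact (eventually_mem_nhdsWithin).and ((Filter.eventually_all.2 fun k => key _ (hRA k)).and
        ((Filter.eventually_all.2 fun k => key _ (hRB k)).and ((key _ hrc).and (key _ hrg))))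
    exact h1.exists
  -- From A_k ∂_k u = ∂_k (A_k u) - (∂_k A_k) u: the derivative is moved outside, so that the bound
  -- for ∂_k followed by integration applies to the product, and the correction goes into the zeroth
  -- order term.
  let c' : MvPowerSeries σ ℂ := c - ∑ k ∈ Finset.univ.erase i, pderiv ℂ k (A k)
  have hc' : radnorm r c' ≠ ⊤ := by
    unfold c'
    rw [sub_eq_add_neg]
    refine wnorm_congr_ne_top (ne_top_of_le_ne_top hc (radnorm_mono hr.le hrc' c)) ?_
    rw [wnorm_neg]
    refine ne_top_of_le_ne_top ?_ (wnorm_sum_le _ _ _)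
    rw [ENNReal.sum_ne_top]
    exact fun k _ => ne_top_of_le_ne_top (hB k) (radnorm_mono hr.le (hrB k) _)
  have hAr : ∀ k, radnorm r (A k) ≠ ⊤ := fun k =>
    ne_top_of_le_ne_top (hA k) (radnorm_mono hr.le (hrA k) _)
  -- The norm of the operator `T` below is at most `s * K`; `s` is then taken small enough to make
  -- this at most 1/2.
  let K : ℝ := ∑ k ∈ Finset.univ.erase i, r⁻¹ * (radnorm r (A k)).toReal + (radnorm r c').toReal
  have hK : 0 ≤ K := by positivity
  let s : ℝ := min r (1 / (2 * (K + 1)))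
  have hs : 0 < s := lt_min hr (by positivity)
  have hsr : s ≤ r := min_le_left _ _
  have hsK : s * K ≤ 2⁻¹ := by
    calc s * K ≤ 1 / (2 * (K + 1)) * K := by gcongr; exact min_le_right _ _
      _ ≤ 2⁻¹ := by
        rw [div_mul_eq_mul_div, div_le_iff₀ (by positivity)]
        linarith
  have hck : ∀ u : MvPowerSeries σ ℂ, cknorm i s r u ≤ radnorm r u := fun u =>
    wnorm_mono (fun α => ENNReal.ofReal_le_ofReal (ckWeight_le i hs hsr α)) u
  -- The equation integrated in the variable `i` with zero initial value reads `u = integ i g + T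
  -- u`.
  let T : MvPowerSeries σ ℂ →ₗ[ℂ] MvPowerSeries σ ℂ :=
    (∑ k ∈ Finset.univ.erase i,
      (integ i) ∘ₗ (pderiv ℂ k).toLinearMap ∘ₗ (LinearMap.mulLeft ℂ (A k))) +
      (integ i) ∘ₗ (LinearMap.mulLeft ℂ c')
  have hTu : ∀ u, T u = ∑ k ∈ Finset.univ.erase i, integ i (pderiv ℂ k (A k * u)) +
      integ i (c' * u) := by
    intro u
    simp [T, LinearMap.sum_apply]
  have hT : ∀ u, cknorm i s r (T u) ≤ 2⁻¹ * cknorm i s r u := by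
    intro u
    rw [hTu]
    have e1 : ∀ k ∈ Finset.univ.erase i, cknorm i s r (integ i (pderiv ℂ k (A k * u))) ≤
        ENNReal.ofReal (s * (r⁻¹ * (radnorm r (A k)).toReal)) * cknorm i s r u := by
      intro k hk
      refine (cknorm_integ_pderiv_le (Finset.ne_of_mem_erase hk) hs hr _).trans ?_
      calc _ ≤ ENNReal.ofReal (s / r) * (radnorm r (A k) * cknorm i s r u) := by
            gcongr
            exact (cknorm_mul_le i hs hr _ _).trans (by gcongr; exact hck _)
        _ = _ := by
            rw [← mul_assoc, ← mul_assoc s, ENNReal.ofReal_mul (by positivity),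
              ENNReal.ofReal_toReal (hAr k), div_eq_mul_inv]
    have e2 : cknorm i s r (integ i (c' * u)) ≤
        ENNReal.ofReal (s * (radnorm r c').toReal) * cknorm i s r u := by
      refine (cknorm_integ_le i hs hr _).trans ?_
      calc _ ≤ ENNReal.ofReal s * (radnorm r c' * cknorm i s r u) := by
            gcongr
            exact (cknorm_mul_le i hs hr _ _).trans (by gcongr; exact hck _)
        _ = _ := by
            rw [← mul_assoc, ENNReal.ofReal_mul hs.le, ENNReal.ofReal_toReal hc']
    calc _ ≤ (∑ k ∈ Finset.univ.erase i,
            ENNReal.ofReal (s * (r⁻¹ * (radnorm r (A k)).toReal)) * cknorm i s r u) +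
            ENNReal.ofReal (s * (radnorm r c').toReal) * cknorm i s r u := by
          refine (wnorm_add_le _ _ _).trans ?_
          exact add_le_add ((wnorm_sum_le _ _ _).trans (Finset.sum_le_sum e1)) e2
      _ = ENNReal.ofReal (s * K) * cknorm i s r u := by
          rw [← Finset.sum_mul, ← add_mul, ← ENNReal.ofReal_sum_of_nonneg,
            ← ENNReal.ofReal_add, ← Finset.mul_sum, ← mul_add]
          · exact Finset.sum_nonneg fun _ _ => by positivity
          · positivity
          · intro _ _; positivity
      _ ≤ _ := by
          gcongr
          calc _ ≤ ENNReal.ofReal 2⁻¹ := ENNReal.ofReal_le_ofReal hsK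
            _ = _ := by rw [ENNReal.ofReal_inv_of_pos (by norm_num)]; simp
  have hδ : cknorm i s r (integ i g) ≠ ⊤ := by
    refine ne_top_of_le_ne_top ?_ (cknorm_integ_le i hs hr g)
    exact ENNReal.mul_ne_top (by simp)
      (ne_top_of_le_ne_top hg ((hck g).trans (radnorm_mono hr.le hrg' g)))
  obtain ⟨u, hu, hfin⟩ := exists_fixedPoint
    (fun α => (ENNReal.ofReal_pos.2 (ckWeight_pos i hs hr α)).ne') T hT _ hδ
  rw [hTu, ← map_sum, ← map_add, ← map_add] at hu
  refine ⟨u, ⟨s / 2, by positivity, ?_⟩, ?_, ?_⟩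
  · exact ne_top_of_le_ne_top hfin
      (wnorm_mono (fun α => ENNReal.ofReal_le_ofReal (le_ckWeight i hs hsr α)) u)
  · intro α hα
    rw [hu, coeff_integ, if_pos hα]
  · conv_lhs => rw [hu]
    rw [pderiv_integ]
    simp only [Derivation.leibniz, smul_eq_mul, Finset.sum_add_distrib, c']
    rw [sub_mul, Finset.sum_mul]
    simp only [mul_comm u]
    ring

end MvPowerSeries

end

noncomputable section

open MvPowerSeries Filter Topology

variable {σ : Type*}

/-! ### Taylor expansions of analytic functions -/

lemma summable_of_radnorm {r : ℝ} (hr : 0 ≤ r) {u : MvPowerSeries σ ℂ} (h : radnorm r u ≠ ⊤) :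
    Summable fun α => ‖coeff α u‖ * r ^ α.degree := by
  have h1 : ∀ α, ‖coeff α u‖ₑ * ENNReal.ofReal (r ^ α.degree) =
      ENNReal.ofReal (‖coeff α u‖ * r ^ α.degree) := fun α => by
    rw [← ofReal_norm, ENNReal.ofReal_mul (norm_nonneg _)]
  unfold radnorm wnorm at h
  simp_rw [h1] at h
  refine Summable.of_enorm ?_
  convert h using 3 with α
  rw [Real.enorm_of_nonneg (by positivity)]

lemma radnorm_ne_top_of_summable {r : ℝ} {u : MvPowerSeries σ ℂ}
    (h : Summable fun α => ‖coeff α u‖ * r ^ α.degree) : radnorm r u ≠ ⊤ := by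
  have h1 : ∀ α, ‖coeff α u‖ₑ * ENNReal.ofReal (r ^ α.degree) =
      ENNReal.ofReal (‖coeff α u‖ * r ^ α.degree) := fun α => by
    rw [← ofReal_norm, ENNReal.ofReal_mul (norm_nonneg _)]
  unfold radnorm wnorm
  simp_rw [h1]
  exact h.tsum_ofReal_ne_top

lemma radnorm_ne_top_of_le {u : MvPowerSeries σ ℂ} {r r' : ℝ} (hr' : 0 < r') (hrr : r' ≤ r)
    (h : radnorm r u ≠ ⊤) : radnorm r' u ≠ ⊤ :=
  ne_top_of_le_ne_top h (radnorm_mono hr'.le hrr u)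

/-- The word of length `n` with content `α`, when `n` is the degree of `α`. -/
def HasTaylor.word [Nonempty σ] (α : σ →₀ ℕ) (n : ℕ) (i : Fin n) : σ :=
  (Finsupp.toMultiset α).toList.getD i (Classical.arbitrary σ)

variable [Fintype σ]

/-- The value of the monomial with exponent `α`. -/
def monoVal (y : EuclideanSpace ℝ σ) (α : σ →₀ ℕ) : ℂ := ∏ i, (y i : ℂ) ^ α i

lemma monoVal_zero (y : EuclideanSpace ℝ σ) : monoVal y 0 = 1 := by simp [monoVal]

lemma monoVal_add (y : EuclideanSpace ℝ σ) (α β : σ →₀ ℕ) :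
    monoVal y (α + β) = monoVal y α * monoVal y β := by
  simp [monoVal, pow_add, Finset.prod_mul_distrib]

lemma prod_map_toMultiset (y : EuclideanSpace ℝ σ) (α : σ →₀ ℕ) :
    ((Finsupp.toMultiset α).map fun j => (y j : ℂ)).prod = monoVal y α := by
  classical
  induction α using Finsupp.induction_linear with
  | zero => simp [monoVal_zero]
  | add a b ha hb => rw [map_add, Multiset.map_add, Multiset.prod_add, monoVal_add, ha, hb]
  | single j n =>
    simp [monoVal, Finsupp.single_apply, pow_ite, Multiset.map_nsmul, Multiset.prod_nsmul]

lemma hasSum_sum_antidiagonal {A : Type*} [AddCommMonoid A] [Finset.HasAntidiagonal A]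
    {a b : A → ℂ} {s t : ℂ} (ha : HasSum a s) (hb : HasSum b t) (ha' : Summable fun n => ‖a n‖)
    (hb' : Summable fun n => ‖b n‖) :
    HasSum (fun n => ∑ q ∈ Finset.HasAntidiagonal.antidiagonal n, a q.1 * b q.2) (s * t) := by
  have s3 : Summable fun q : A × A => a q.1 * b q.2 := summable_mul_of_summable_norm ha' hb'
  have s4 := summable_sum_mul_antidiagonal_of_summable_mul s3
  rw [← ha.tsum_eq, ← hb.tsum_eq,
    ha.summable.tsum_mul_tsum_eq_tsum_sum_antidiagonal hb.summable s3]
  exact s4.hasSum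

lemma norm_monoVal_le {y : EuclideanSpace ℝ σ} {r : ℝ} (hy : ∀ i, |y i| ≤ r) (α : σ →₀ ℕ) :
    ‖monoVal y α‖ ≤ r ^ α.degree := by
  rw [monoVal, norm_prod, Finsupp.degree_eq_sum, ← Finset.prod_pow_eq_pow_sum]
  refine Finset.prod_le_prod (fun _ _ => norm_nonneg _) fun i _ => ?_
  rw [norm_pow, Complex.norm_real, Real.norm_eq_abs]
  exact pow_le_pow_left₀ (abs_nonneg _) (hy i) _

lemma abs_coord_le (y : EuclideanSpace ℝ σ) (i : σ) : |y i| ≤ ‖y‖ := by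
  simpa using PiLp.norm_apply_le y i

/-- The power series `u` converges to `f` near `p`. -/
def HasTaylor (f : EuclideanSpace ℝ σ → ℂ) (p : EuclideanSpace ℝ σ) (u : MvPowerSeries σ ℂ) :
    Prop :=
  ∃ r : ℝ, 0 < r ∧ radnorm r u ≠ ⊤ ∧
    ∀ y, ‖y‖ < r → HasSum (fun α => coeff α u * monoVal y α) (f (p + y))

lemma norm_term_le {y : EuclideanSpace ℝ σ} {r : ℝ} (hy : ‖y‖ ≤ r) (u : MvPowerSeries σ ℂ)
    (α : σ →₀ ℕ) : ‖coeff α u * monoVal y α‖ ≤ ‖coeff α u‖ * r ^ α.degree := by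
  rw [norm_mul]
  gcongr
  exact norm_monoVal_le (fun i => (abs_coord_le y i).trans hy) α

lemma summable_term {y : EuclideanSpace ℝ σ} {r : ℝ} (hy : ‖y‖ ≤ r) {u : MvPowerSeries σ ℂ}
    (h : radnorm r u ≠ ⊤) : Summable fun α => ‖coeff α u * monoVal y α‖ :=
  Summable.of_nonneg_of_le (fun _ => norm_nonneg _) (norm_term_le hy u)
    (summable_of_radnorm ((norm_nonneg y).trans hy) h)

lemma MvPowerSeries.IsConvergent.exists_hasTaylor {u : MvPowerSeries σ ℂ} (hu : IsConvergent u)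
    (p : EuclideanSpace ℝ σ) : ∃ f, HasTaylor f p u := by
  obtain ⟨r, hr, h⟩ := hu
  refine ⟨fun x => ∑' α, coeff α u * monoVal (x - p) α, r, hr, h, fun y hy => ?_⟩
  simp only [add_sub_cancel_left]
  exact (Summable.of_norm (summable_term hy.le h)).hasSum

namespace HasTaylor

variable {f g : EuclideanSpace ℝ σ → ℂ} {p : EuclideanSpace ℝ σ} {u v : MvPowerSeries σ ℂ}

lemma isConvergent (hf : HasTaylor f p u) : IsConvergent u :=
  let ⟨r, hr, h, _⟩ := hf; ⟨r, hr, h⟩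

lemma eventually_nhds {p : EuclideanSpace ℝ σ} {r : ℝ} (hr : 0 < r) :
    ∀ᶠ x in 𝓝 p, ‖x - p‖ < r := by
  have := Metric.ball_mem_nhds p hr
  filter_upwards [this] with x hx
  rwa [mem_ball_iff_norm] at hx

lemma eventuallyEq (hf : HasTaylor f p u) (hg : HasTaylor g p u) : f =ᶠ[𝓝 p] g := by
  obtain ⟨r, hr, -, h⟩ := hf
  obtain ⟨r', hr', -, h'⟩ := hg
  filter_upwards [eventually_nhds hr, eventually_nhds hr'] with x hx hx'
  have := (h _ hx).unique (h' _ hx')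
  simpa using this

lemma add (hf : HasTaylor f p u) (hg : HasTaylor g p v) : HasTaylor (fun x => f x + g x) p (u + v) := by
  obtain ⟨r, hr, h0, h⟩ := hf
  obtain ⟨r', hr', h0', h'⟩ := hg
  refine ⟨min r r', lt_min hr hr', wnorm_congr_ne_top
    (radnorm_ne_top_of_le (lt_min hr hr') (min_le_left _ _) h0)
    (radnorm_ne_top_of_le (lt_min hr hr') (min_le_right _ _) h0'), fun y hy => ?_⟩
  convert! (h y (hy.trans_le (min_le_left _ _))).add (h' y (hy.trans_le (min_le_right _ _))) using 1
  ext α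
  simp [add_mul]

lemma mul (hf : HasTaylor f p u) (hg : HasTaylor g p v) : HasTaylor (fun x => f x * g x) p (u * v) := by
  classical
  obtain ⟨r, hr, h0, h⟩ := hf
  obtain ⟨r', hr', h0', h'⟩ := hg
  have hm := lt_min hr hr'
  have k0 := radnorm_ne_top_of_le hm (min_le_left _ _) h0
  have k0' := radnorm_ne_top_of_le hm (min_le_right _ _) h0'
  refine ⟨min r r', hm, ?_, fun y hy => ?_⟩
  · exact ne_top_of_le_ne_top (ENNReal.mul_ne_top k0 k0')
      (wnorm_mul_le _ (radnorm_pow_add _ hm.le) u v)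
  · have s1 := summable_term hy.le k0
    have s2 := summable_term hy.le k0'
    have e1 := (h y (hy.trans_le (min_le_left _ _)))
    have e2 := (h' y (hy.trans_le (min_le_right _ _)))
    have e3 : ∀ α, coeff α (u * v) * monoVal y α = ∑ q ∈ Finset.HasAntidiagonal.antidiagonal α,
        (coeff q.1 u * monoVal y q.1) * (coeff q.2 v * monoVal y q.2) := by
      intro α
      rw [coeff_mul, Finset.sum_mul]
      refine Finset.sum_congr rfl fun q hq => ?_
      rw [← Finset.HasAntidiagonal.mem_antidiagonal.1 hq, monoVal_add]
      ring
    simp_rw [e3]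
    exact hasSum_sum_antidiagonal (a := fun α => coeff α u * monoVal y α)
      (b := fun α => coeff α v * monoVal y α) e1 e2 s1 s2

lemma const (c : ℂ) (p : EuclideanSpace ℝ σ) : HasTaylor (fun _ => c) p (C c) := by
  classical
  have h : ∀ α : σ →₀ ℕ, α ≠ 0 → coeff α (C c) = 0 := fun α hα => by
    rw [coeff_C, if_neg hα]
  refine ⟨1, one_pos, ?_, fun y _ => ?_⟩
  · unfold radnorm wnorm
    rw [tsum_eq_single 0 fun α hα => by rw [h α hα]; simp]
    simp
  · convert! hasSum_single (f := fun α => coeff α (C c) * monoVal y α) 0 fun α hα => by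
      rw [h α hα]; simp
    simp [monoVal_zero]

lemma sum {ι : Type*} (s : Finset ι) {F : ι → EuclideanSpace ℝ σ → ℂ} {U : ι → MvPowerSeries σ ℂ}
    (h : ∀ k ∈ s, HasTaylor (F k) p (U k)) :
    HasTaylor (fun x => ∑ k ∈ s, F k x) p (∑ k ∈ s, U k) := by
  classical
  induction s using Finset.induction_on with
  | empty => simpa using const 0 p
  | insert a s ha ih =>
    simp_rw [Finset.sum_insert ha]
    exact (h a (Finset.mem_insert_self _ _)).add
      (ih fun k hk => h k (Finset.mem_insert_of_mem hk))

/-! #### Convergent power series are analytic -/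

lemma prod_word [Nonempty σ] (y : EuclideanSpace ℝ σ) (α : σ →₀ ℕ) :
    ∏ i, (y (word α α.degree i) : ℂ) = monoVal y α := by
  classical
  have hlen : (Finsupp.toMultiset α).toList.length = α.degree := by
    rw [Multiset.length_toList, Finsupp.card_toMultiset]; rfl
  have h1 : ∏ i, (y (word α α.degree i) : ℂ) =
      ((Finsupp.toMultiset α).toList.map fun j => (y j : ℂ)).prod := by
    rw [← hlen]
    unfold word
    rw [← List.prod_ofFn]
    congr 1
    apply List.ext_getElem
    · simp
    · intro n h1 h2
      simp at h1 h2 ⊢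
  rw [h1, ← Multiset.prod_coe, ← Multiset.map_coe, Multiset.coe_toList]
  exact prod_map_toMultiset y α

end HasTaylor

end

/-! ### Convergent power series and real-analytic germs. -/

noncomputable section

open MvPowerSeries Filter Topology

variable {σ : Type*}

/-- The monomial of exponent `α` as a multilinear map of `n` arguments. -/
def HasTaylor.monoMultilinear [Nonempty σ] (α : σ →₀ ℕ) (n : ℕ) :
    ContinuousMultilinearMap ℝ (fun _ : Fin n => EuclideanSpace ℝ σ) ℂ :=
  (ContinuousMultilinearMap.mkPiAlgebraFin ℝ n ℂ).compContinuousLinearMap fun i =>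
    Complex.ofRealCLM ∘L (EuclideanSpace.proj (HasTaylor.word α n i) : EuclideanSpace ℝ σ →L[ℝ] ℝ)

lemma HasTaylor.monoMultilinear_apply [Nonempty σ] (α : σ →₀ ℕ) (n : ℕ)
    (v : Fin n → EuclideanSpace ℝ σ) :
    HasTaylor.monoMultilinear α n v = ∏ i, (v i (HasTaylor.word α n i) : ℂ) := by
  simp [HasTaylor.monoMultilinear, List.prod_ofFn]

variable [Fintype σ]

lemma HasSum.sum_degree [DecidableEq σ] {F : (σ →₀ ℕ) → ℂ} {a : ℂ} (h : HasSum F a) :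
    HasSum (fun n => ∑ α ∈ Finset.finsuppAntidiag Finset.univ n, F α) a := by
  convert! h.tsum_fiberwise (fun α : σ →₀ ℕ => α.degree) using 1
  ext n
  rw [← Finset.tsum_subtype']
  have : ((Finset.finsuppAntidiag Finset.univ n : Finset (σ →₀ ℕ)) : Set (σ →₀ ℕ)) =
      (fun α : σ →₀ ℕ => α.degree) ⁻¹' {n} := by
    ext α
    simp [Finset.mem_finsuppAntidiag, Finsupp.degree_eq_sum]
  rw [this]

lemma Summable.sum_degree [DecidableEq σ] {F : (σ →₀ ℕ) → ℝ} (h : Summable F) :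
    Summable (fun n => ∑ α ∈ Finset.finsuppAntidiag Finset.univ n, F α) := by
  convert! (h.hasSum.tsum_fiberwise (fun α : σ →₀ ℕ => α.degree)).summable using 1
  ext n
  rw [← Finset.tsum_subtype']
  have : ((Finset.finsuppAntidiag Finset.univ n : Finset (σ →₀ ℕ)) : Set (σ →₀ ℕ)) =
      (fun α : σ →₀ ℕ => α.degree) ⁻¹' {n} := by
    ext α
    simp [Finset.mem_finsuppAntidiag, Finsupp.degree_eq_sum]
  rw [this]

namespace HasTaylor

variable {f g : EuclideanSpace ℝ σ → ℂ} {p : EuclideanSpace ℝ σ} {u v : MvPowerSeries σ ℂ}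

lemma norm_monoMultilinear_le [Nonempty σ] (α : σ →₀ ℕ) (n : ℕ) :
    ‖(monoMultilinear α n : ContinuousMultilinearMap ℝ (fun _ : Fin n => EuclideanSpace ℝ σ) ℂ)‖
      ≤ 1 := by
  refine ContinuousMultilinearMap.opNorm_le_bound zero_le_one fun v => ?_
  rw [monoMultilinear_apply, norm_prod, one_mul]
  refine Finset.prod_le_prod (fun _ _ => norm_nonneg _) fun i _ => ?_
  rw [Complex.norm_real]
  exact abs_coord_le _ _

lemma analyticAt [Nonempty σ] (hf : HasTaylor f p u) : AnalyticAt ℝ f p := by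
  classical
  obtain ⟨r, hr, h0, h⟩ := hf
  -- The terms of degree `n` are collected into one `n`-linear map. It need not be symmetric, since
  -- only its values on the diagonal enter.
  let P : FormalMultilinearSeries ℝ (EuclideanSpace ℝ σ) ℂ := fun n =>
    ∑ α ∈ Finset.finsuppAntidiag Finset.univ n, coeff α u • monoMultilinear α n
  have hP : ∀ n, ‖P n‖ ≤ ∑ α ∈ Finset.finsuppAntidiag Finset.univ n, ‖coeff α u‖ := fun n => by
    refine (norm_sum_le _ _).trans (Finset.sum_le_sum fun α _ => ?_)
    refine (norm_smul_le (coeff α u) (monoMultilinear α n)).trans ?_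
    exact mul_le_of_le_one_right (norm_nonneg _) (norm_monoMultilinear_le _ _)
  have hdeg : ∀ (n : ℕ) (α : σ →₀ ℕ), α ∈ Finset.finsuppAntidiag Finset.univ n → α.degree = n := by
    intro n α hα
    rw [Finset.mem_finsuppAntidiag] at hα
    rw [Finsupp.degree_eq_sum]; exact hα.1
  have hsum := (summable_of_radnorm hr.le h0).sum_degree
  refine ⟨P, ENNReal.ofReal r, ?_, by simpa using hr, ?_⟩
  · refine FormalMultilinearSeries.le_radius_of_summable P (r := r.toNNReal) ?_
    refine Summable.of_nonneg_of_le (fun _ => by positivity) (fun n => ?_) hsum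
    rw [Real.coe_toNNReal r hr.le]
    calc _ ≤ (∑ α ∈ Finset.finsuppAntidiag Finset.univ n, ‖coeff α u‖) * r ^ n := by
          gcongr; exact hP n
      _ = _ := by
          rw [Finset.sum_mul]
          exact Finset.sum_congr rfl fun α hα => by rw [hdeg n α hα]
  · intro y hy
    have hy' : ‖y‖ < r := by
      rw [Metric.mem_eball, edist_zero_right, ← ofReal_norm] at hy
      exact (ENNReal.ofReal_lt_ofReal_iff hr).1 hy
    convert! (h y hy').sum_degree using 1
    ext n
    simp only [P, sum_apply, smul_apply]
    refine Finset.sum_congr rfl fun α hα => ?_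
    rw [monoMultilinear_apply, smul_eq_mul, ← hdeg n α hα, prod_word]

/-! #### Analytic functions have a Taylor expansion -/

/-- Expanding each multilinear term on the standard basis gives a sum over words in the coordinates.
The coefficient of a monomial is the sum over all words with that content, which is legitimate once
the whole family of words is absolutely summable. -/
lemma _root_.AnalyticAt.exists_hasTaylor (hf : AnalyticAt ℝ f p) : ∃ u, HasTaylor f p u := by
  classical
  obtain ⟨P, R, hP⟩ := hf
  -- coefficients indexed by words
  let coef : (Σ n, Fin n → σ) → ℂ := fun w =>
    P w.1 fun i => EuclideanSpace.single (w.2 i) 1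
  let content : (Σ n, Fin n → σ) → (σ →₀ ℕ) := fun w => ∑ i, Finsupp.single (w.2 i) 1
  have hdeg : ∀ w, (content w).degree = w.1 := fun w => by simp [content]
  have hmono : ∀ (y : EuclideanSpace ℝ σ) w, ∏ i, (y (w.2 i) : ℂ) = monoVal y (content w) := by
    intro y w
    have h : ∀ s : Finset (Fin w.1), ∏ i ∈ s, (y (w.2 i) : ℂ) =
        monoVal y (∑ i ∈ s, Finsupp.single (w.2 i) 1) := by
      intro s
      induction s using Finset.induction_on with
      | empty => simp [monoVal_zero]
      | insert a s ha ih =>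
        rw [Finset.prod_insert ha, Finset.sum_insert ha, monoVal_add, ih]
        simp [monoVal, Finsupp.single_apply, pow_ite]
    exact h _
  have hcoef : ∀ w, ‖coef w‖ ≤ ‖P w.1‖ := fun w => by
    refine ((P w.1).le_opNorm _).trans ?_
    simp
  have hexp : ∀ (y : EuclideanSpace ℝ σ) n, P n (fun _ => y) =
      ∑ w : Fin n → σ, coef ⟨n, w⟩ * monoVal y (content ⟨n, w⟩) := by
    intro y n
    have hy : y = ∑ i, y i • EuclideanSpace.single i (1 : ℝ) := by
      ext j
      simp [Finset.sum_apply, Pi.single_apply]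
    conv_lhs => rw [hy]
    rw [ContinuousMultilinearMap.map_sum]
    refine Finset.sum_congr rfl fun w _ => ?_
    rw [ContinuousMultilinearMap.map_smul_univ, ← hmono]
    simp only [coef, Complex.real_smul, Complex.ofReal_prod]
    ring
  -- radius
  obtain ⟨r₀, hr₀, hr₀'⟩ := ENNReal.lt_iff_exists_nnreal_btwn.1 (hP.r_pos.trans_le le_rfl)
  have hr₀pos : 0 < r₀ := by exact_mod_cast hr₀
  -- There are (card σ)ⁿ words of length `n`, each with coefficient bounded by ‖P n‖. Dividing the
  -- radius by `N` compensates for their number; the summand 1 keeps `N` at least 1.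
  let N : ℝ := (Fintype.card σ : ℝ) + 1
  have hN : 1 ≤ N := by simp [N]
  let r : ℝ := r₀ / N
  have hr : 0 < r := by positivity
  have hrr : r ≤ r₀ := div_le_self (by positivity) hN
  have hPs : Summable fun n => ‖P n‖ * (r₀ : ℝ) ^ n :=
    P.summable_norm_mul_pow (hr₀'.trans_le hP.r_le)
  have hws : Summable fun w : (Σ n, Fin n → σ) => ‖coef w‖ * r ^ w.1 := by
    rw [summable_sigma_of_nonneg fun _ => by positivity]
    refine ⟨fun n => Summable.of_finite, ?_⟩
    refine Summable.of_nonneg_of_le (fun n => tsum_nonneg fun _ => by positivity) (fun n => ?_) hPs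
    rw [tsum_fintype]
    calc ∑ w : Fin n → σ, ‖coef ⟨n, w⟩‖ * r ^ n ≤ ∑ w : Fin n → σ, ‖P n‖ * r ^ n := by
          gcongr with w; exact hcoef ⟨n, w⟩
      _ = (Fintype.card σ : ℝ) ^ n * (‖P n‖ * r ^ n) := by simp
      _ ≤ N ^ n * (‖P n‖ * r ^ n) := by gcongr; simp [N]
      _ = _ := by
          simp only [r, div_pow]
          field_simp
  let u : MvPowerSeries σ ℂ := fun α => ∑' w : content ⁻¹' {α}, coef w
  have hu : ∀ α, coeff α u = ∑' w : content ⁻¹' {α}, coef w := fun _ => rfl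
  have hfib : ∀ α, Summable fun w : content ⁻¹' {α} => ‖coef w‖ := fun α => by
    have h1 : Summable fun w : content ⁻¹' {α} => ‖coef w‖ * r ^ (w : Σ n, Fin n → σ).1 :=
      hws.subtype _
    have h2 : ∀ w : content ⁻¹' {α}, ‖coef w‖ * r ^ (w : Σ n, Fin n → σ).1 =
        ‖coef w‖ * r ^ α.degree := fun w => by
      have := hdeg w
      rw [w.2] at this
      rw [this]
    simp_rw [h2] at h1
    exact (summable_mul_right_iff (by positivity)).1 h1
  refine ⟨u, r, hr, radnorm_ne_top_of_summable ?_, fun y hy => ?_⟩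
  · refine Summable.of_nonneg_of_le (fun _ => by positivity) (fun α => ?_)
      (hws.hasSum.tsum_fiberwise content).summable
    rw [hu]
    calc _ ≤ (∑' w : content ⁻¹' {α}, ‖coef w‖) * r ^ α.degree := by
          gcongr; exact norm_tsum_le_tsum_norm (hfib α)
      _ = _ := by
          rw [← tsum_mul_right]
          refine tsum_congr fun w => ?_
          have := hdeg w
          rw [w.2] at this
          rw [this]
  · have hyR : y ∈ Metric.eball (0 : EuclideanSpace ℝ σ) R := by
      rw [Metric.mem_eball, edist_zero_right, ← ofReal_norm]
      refine lt_trans ?_ hr₀'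
      rw [ENNReal.ofReal_lt_coe_iff (by positivity)]
      exact hy.trans_le hrr
    have h1 := hP.hasSum hyR
    have hs : Summable fun w : (Σ n, Fin n → σ) => coef w * monoVal y (content w) := by
      refine Summable.of_norm (Summable.of_nonneg_of_le (fun _ => norm_nonneg _) (fun w => ?_) hws)
      rw [norm_mul]
      gcongr
      rw [← hdeg w]
      exact norm_monoVal_le (fun i => (abs_coord_le y i).trans hy.le) _
    have h2 : HasSum (fun w : (Σ n, Fin n → σ) => coef w * monoVal y (content w)) (f (p + y)) := by
      have h3 := hs.hasSum.sigma fun n => hasSum_fintype _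
      simp_rw [← hexp] at h3
      rw [h1.unique h3]
      exact hs.hasSum
    have h4 := h2.tsum_fiberwise content
    convert! h4 using 1
    ext α
    rw [hu, ← tsum_mul_right]
    refine tsum_congr fun w => ?_
    have h5 : content w = α := w.2
    rw [h5]

end HasTaylor

end

/-! ### Differentiation and uniqueness of Taylor expansions. -/

noncomputable section

open MvPowerSeries Filter Topology

variable {σ : Type*} [DecidableEq σ]

/-- The partial derivative in the direction of the `k`-th coordinate. -/
def pd (k : σ) (f : EuclideanSpace ℝ σ → ℂ) (x : EuclideanSpace ℝ σ) : ℂ :=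
  fderiv ℝ f x (EuclideanSpace.single k 1)

variable [Fintype σ]

namespace HasTaylor

variable {f g : EuclideanSpace ℝ σ → ℂ} {p : EuclideanSpace ℝ σ} {u v : MvPowerSeries σ ℂ}

lemma hasDerivAt_monoVal (y : EuclideanSpace ℝ σ) (k : σ) (α : σ →₀ ℕ) (t : ℝ) :
    HasDerivAt (fun t : ℝ => monoVal (y + t • EuclideanSpace.single k (1 : ℝ)) α)
      (α k * monoVal (y + t • EuclideanSpace.single k (1 : ℝ)) (α - Finsupp.single k 1)) t := by
  have hsplit : ∀ (z : EuclideanSpace ℝ σ) (β : σ →₀ ℕ),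
      monoVal z β = (z k : ℂ) ^ β k * ∏ j ∈ Finset.univ.erase k, (z j : ℂ) ^ β j := fun z β =>
    (Finset.mul_prod_erase _ _ (Finset.mem_univ k)).symm
  have hother : ∀ t : ℝ, ∀ β : σ →₀ ℕ, (∀ j, j ≠ k → β j = α j) →
      ∏ j ∈ Finset.univ.erase k,
        ((y + t • EuclideanSpace.single k (1 : ℝ) : EuclideanSpace ℝ σ) j : ℂ) ^ β j =
      ∏ j ∈ Finset.univ.erase k, (y j : ℂ) ^ α j := fun t β hβ =>
    Finset.prod_congr rfl fun j hj => by
      have := Finset.ne_of_mem_erase hj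
      simp [this, hβ j this]
  have hk : ∀ t : ℝ, ((y + t • EuclideanSpace.single k (1 : ℝ) : EuclideanSpace ℝ σ) k : ℂ) =
      (y k : ℂ) + t := fun t => by simp
  simp_rw [hsplit, hk]
  simp_rw [hother _ α fun _ _ => rfl]
  rw [hother t _ fun j hj => by simp [hj.symm]]
  have h1 : HasDerivAt (fun t : ℝ => (y k : ℂ) + t) 1 t := by
    simpa using (Complex.ofRealCLM.hasDerivAt (x := t)).const_add (y k : ℂ)
  convert! (h1.pow (α k)).mul_const (∏ j ∈ Finset.univ.erase k, (y j : ℂ) ^ α j) using 1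
  simp
  ring

/-- The series is differentiated term by term along the line through `y` in the direction `k`.
Analyticity already gives differentiability of `f`, so the derivative along the line is the partial
derivative. -/
lemma fderiv [Nonempty σ] (hf : HasTaylor f p u) (k : σ) : HasTaylor (pd k f) p (pderiv ℂ k u) := by
  have hdiff : ∀ᶠ x in 𝓝 p, DifferentiableAt ℝ f x :=
    hf.analyticAt.eventually_analyticAt.mono fun x hx => hx.differentiableAt
  obtain ⟨r, hr, h0, h⟩ := hf
  obtain ⟨r', hr', hd⟩ := Metric.eventually_nhds_iff.1 hdiff
  have h1 := radnorm_pderiv_ne_top hr h0 k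
  have hs := summable_of_radnorm (by positivity) h1
  have hm : 0 < min (r / 2) r' := lt_min (by positivity) hr'
  have hinj : Function.Injective fun α : σ →₀ ℕ => α + Finsupp.single k 1 := add_left_injective _
  refine ⟨min (r / 2) r', hm, radnorm_ne_top_of_le hm (min_le_left _ _) h1, fun y hy => ?_⟩
  have hy1 : ‖y‖ < r / 2 := hy.trans_le (min_le_left _ _)
  have hdy : DifferentiableAt ℝ f (p + y) := hd (by simpa using hy.trans_le (min_le_right _ _))
  -- The dominating series for termwise differentiation. It is summable because the formal
  -- derivative has finite norm at radius `r / 2`.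
  let B : (σ →₀ ℕ) → ℝ := fun α => ‖coeff α u‖ * (α k * (r / 2) ^ (α - Finsupp.single k 1).degree)
  have hzero : ∀ α : σ →₀ ℕ, α ∉ Set.range (fun α : σ →₀ ℕ => α + Finsupp.single k 1) →
      α k = 0 := by
    intro α hα
    by_contra h
    refine hα ⟨α - Finsupp.single k 1, ?_⟩
    simp only
    rw [tsub_add_cancel_of_le]
    simpa [Nat.one_le_iff_ne_zero] using h
  have hB : Summable B := by
    rw [← hinj.summable_iff fun α hα => by simp [B, hzero α hα]]
    refine hs.congr fun α => ?_
    have h (j : σ) : ‖((α j : ℂ) + 1)‖ = (α j : ℝ) + 1 := by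
      rw [← Nat.cast_succ, Complex.norm_natCast]; push_cast; ring
    simp only [Function.comp, B, coeff_pderiv, norm_mul, h]
    simp
    ring
  let e : EuclideanSpace ℝ σ := EuclideanSpace.single k 1
  let δ : ℝ := r / 2 - ‖y‖
  have hδ : 0 < δ := sub_pos.2 hy1
  have hsmall : ∀ t ∈ Metric.ball (0 : ℝ) δ, ‖y + t • e‖ < r / 2 := by
    intro t ht
    rw [mem_ball_zero_iff] at ht
    calc ‖y + t • e‖ ≤ ‖y‖ + ‖t • e‖ := norm_add_le _ _
      _ = ‖y‖ + ‖t‖ := by rw [norm_smul]; simp [e]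
      _ < r / 2 := by simp only [δ] at ht; linarith
  have key := hasDerivAt_tsum_of_isPreconnected (𝕜 := ℝ) (t := Metric.ball (0 : ℝ) δ)
    (g := fun α t => coeff α u * monoVal (y + t • e) α)
    (g' := fun α t => coeff α u * (α k * monoVal (y + t • e) (α - Finsupp.single k 1)))
    (y₀ := 0) (y := 0)
    hB Metric.isOpen_ball (convex_ball _ _).isPreconnected
    (fun α t _ => (hasDerivAt_monoVal y k α t).const_mul _)
    (fun α t ht => by
      rw [norm_mul, norm_mul, Complex.norm_natCast]
      simp only [B]
      gcongr
      exact norm_monoVal_le (fun i => (abs_coord_le _ i).trans (hsmall t ht).le) _)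
    (Metric.mem_ball_self hδ)
    (by
      simp only [zero_smul, add_zero]
      exact (h y (by linarith)).summable)
    (Metric.mem_ball_self hδ)
  have hf1 : HasDerivAt (fun t : ℝ => f (p + y + t • e)) (pd k f (p + y)) 0 := by
    have h2 : HasDerivAt (fun t : ℝ => p + y + t • e) e 0 := by
      simpa using ((hasDerivAt_id (0 : ℝ)).smul_const e).const_add (p + y)
    have h3 : HasFDerivAt f (_root_.fderiv ℝ f (p + y)) (p + y + (0 : ℝ) • e) := by
      simpa using hdy.hasFDerivAt
    exact h3.comp_hasDerivAt 0 h2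
  have hf2 : (fun t : ℝ => f (p + y + t • e)) =ᶠ[𝓝 0]
      fun t => ∑' α, coeff α u * monoVal (y + t • e) α := by
    filter_upwards [Metric.ball_mem_nhds (0 : ℝ) hδ] with t ht
    rw [add_assoc]
    exact (h _ ((hsmall t ht).trans (by linarith))).tsum_eq.symm
  have hval := (hf1.congr_of_eventuallyEq hf2.symm).unique key
  rw [hval]
  simp only [zero_smul, add_zero]
  have hsupp : Function.support
      (fun α => coeff α u * (α k * monoVal y (α - Finsupp.single k 1))) ⊆
      Set.range fun α : σ →₀ ℕ => α + Finsupp.single k 1 := by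
    intro α hα
    by_contra hc
    exact hα (by simp [hzero α hc])
  rw [← hinj.tsum_eq hsupp]
  have hc : ∀ α : σ →₀ ℕ, coeff (α + Finsupp.single k 1) u *
      ((α + Finsupp.single k 1 : σ →₀ ℕ) k *
        monoVal y (α + Finsupp.single k 1 - Finsupp.single k 1)) =
      coeff α (pderiv ℂ k u) * monoVal y α := by
    intro α
    rw [coeff_pderiv]
    simp
    ring
  simp_rw [hc]
  exact (Summable.of_norm (summable_term (hy.le.trans (min_le_left _ _)) h1)).hasSum

/-- Induction on the degree: the constant coefficient is the value at `p`, and any other coefficient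
is, up to a positive integer factor, a coefficient of lower degree of a partial derivative, which
also vanishes near `p`. -/
lemma eq_zero [Nonempty σ] (hf : HasTaylor f p u) (h : f =ᶠ[𝓝 p] 0) : u = 0 := by
  ext α
  rw [coeff_zero]
  induction hn : α.degree generalizing α f u with
  | zero =>
    have hα : α = 0 := (Finsupp.degree_eq_zero_iff α).1 hn
    obtain ⟨r, hr, -, hs⟩ := hf
    have h1 := hs 0 (by simpa using hr)
    have h2 : HasSum (fun β : σ →₀ ℕ => coeff β u * monoVal (0 : EuclideanSpace ℝ σ) β)
        (coeff 0 u * monoVal (0 : EuclideanSpace ℝ σ) 0) := by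
      refine hasSum_single 0 fun β hβ => ?_
      have : ∃ i, β i ≠ 0 := by
        by_contra hc
        push Not at hc
        exact hβ (Finsupp.ext hc)
      obtain ⟨i, hi⟩ := this
      have : monoVal (0 : EuclideanSpace ℝ σ) β = 0 :=
        Finset.prod_eq_zero (Finset.mem_univ i) (by simp [hi])
      rw [this, mul_zero]
    have h3 := h1.unique h2
    rw [add_zero, h.eq_of_nhds, monoVal_zero, mul_one] at h3
    rw [hα]
    exact h3.symm
  | succ n ih =>
    have : ∃ i, α i ≠ 0 := by
      by_contra hc
      push Not at hc
      have : α = 0 := Finsupp.ext hc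
      simp [this] at hn
    obtain ⟨i, hi⟩ := this
    have hα : α - Finsupp.single i 1 + Finsupp.single i 1 = α :=
      tsub_add_cancel_of_le (by simpa [Nat.one_le_iff_ne_zero] using hi)
    have h1 : pd i f =ᶠ[𝓝 p] 0 := by
      have := h.fderiv (𝕜 := ℝ)
      filter_upwards [this] with x hx
      simp [pd, hx]
    have h2 := ih (hf.fderiv i) h1 (α - Finsupp.single i 1) (by
      have := congrArg Finsupp.degree hα
      rw [map_add, Finsupp.degree_single, hn] at this
      omega)
    rw [coeff_pderiv, hα] at h2
    refine (mul_eq_zero.1 h2).resolve_right ?_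
    exact Nat.cast_add_one_ne_zero _

lemma unique [Nonempty σ] (hf : HasTaylor f p u) (hg : HasTaylor g p v) (h : f =ᶠ[𝓝 p] g) :
    u = v := by
  have h1 := hf.add ((const (-1) p).mul hg)
  have h2 := h1.eq_zero (by filter_upwards [h] with x hx; simp [hx])
  rw [map_neg, map_one, neg_one_mul] at h2
  exact eq_of_sub_eq_zero (by rwa [sub_eq_add_neg])

/-- Vanishing on a coordinate hyperplane in terms of the coefficients. -/
lemma vanish_iff [Nonempty σ] (hf : HasTaylor f p u) (i : σ) :
    (∀ᶠ x in 𝓝 p, x i = p i → f x = 0) ↔ ∀ α, α i = 0 → coeff α u = 0 := by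
  constructor
  · intro hv
    obtain ⟨r', hr', hv⟩ := Metric.eventually_nhds_iff.1 hv
    obtain ⟨r, hr, h0, h⟩ := hf
    -- The part of `u` free of the variable `i` is the expansion of `f` composed with the projection
    -- `P` onto the hyperplane, a function that vanishes near `p`.
    let u' : MvPowerSeries σ ℂ := fun α => if α i = 0 then coeff α u else 0
    have hu' : ∀ α, coeff α u' = if α i = 0 then coeff α u else 0 := fun _ => rfl
    let P : EuclideanSpace ℝ σ → EuclideanSpace ℝ σ := fun y => y - y i • EuclideanSpace.single i 1
    have hPi : ∀ y, P y i = 0 := fun y => by simp [P]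
    have hPj : ∀ y j, j ≠ i → P y j = y j := fun y j hj => by simp [P, hj]
    have hmono : ∀ y α, monoVal (P y) α = if α i = 0 then monoVal y α else 0 := by
      intro y α
      split_ifs with hα
      · refine Finset.prod_congr rfl fun j _ => ?_
        by_cases hj : j = i
        · subst hj; simp [hα]
        · rw [hPj y j hj]
      · exact Finset.prod_eq_zero (Finset.mem_univ i) (by simp [hPi, hα])
    have hPn : ∀ y, ‖P y‖ ≤ ‖y‖ := by
      intro y
      rw [EuclideanSpace.norm_eq, EuclideanSpace.norm_eq]
      refine Real.sqrt_le_sqrt (Finset.sum_le_sum fun j _ => ?_)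
      by_cases hj : j = i
      · subst hj; rw [hPi]; simp; positivity
      · rw [hPj y j hj]
    have hf' : HasTaylor (fun x => f (p + P (x - p))) p u' := by
      refine ⟨r, hr, ?_, fun y hy => ?_⟩
      · refine ne_top_of_le_ne_top h0 (ENNReal.tsum_le_tsum fun α => ?_)
        rw [hu']
        split_ifs <;> simp
      · have := h (P y) ((hPn y).trans_lt hy)
        simp only [add_sub_cancel_left]
        convert! this using 1
        ext α
        rw [hu', hmono]
        split_ifs <;> simp
    have hz := hf'.eq_zero (by
      filter_upwards [Metric.ball_mem_nhds p hr'] with x hx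
      refine hv ?_ ?_
      · rw [dist_eq_norm, add_sub_cancel_left]
        rw [mem_ball_iff_norm] at hx
        exact (hPn _).trans_lt hx
      · simp [hPi])
    intro α hα
    have := congrArg (coeff α) hz
    rwa [hu', if_pos hα, coeff_zero] at this
  · intro hα
    obtain ⟨r, hr, h0, h⟩ := hf
    filter_upwards [eventually_nhds hr] with x hx hxi
    have h1 := h _ hx
    rw [add_sub_cancel] at h1
    refine h1.unique ?_
    convert hasSum_zero with α
    by_cases h2 : α i = 0
    · rw [hα α h2, zero_mul]
    · have : monoVal (x - p) α = 0 :=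
        Finset.prod_eq_zero (Finset.mem_univ i) (by simp [hxi, h2])
      rw [this, mul_zero]

end HasTaylor

end

noncomputable section

open MvPowerSeries Filter Topology

variable {σ : Type*} [DecidableEq σ] {f g : EuclideanSpace ℝ σ → ℂ} {p x : EuclideanSpace ℝ σ}

lemma pd_def (k : σ) (f : EuclideanSpace ℝ σ → ℂ) :
    pd k f = fun x => fderiv ℝ f x (EuclideanSpace.single k 1) := rfl

lemma pd_congr (k : σ) (h : f =ᶠ[𝓝 x] g) : pd k f x = pd k g x := by
  simp [pd, h.fderiv_eq]

variable [Fintype σ]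

/-! ### Linear first order equations with analytic coefficients -/

/-- Induction on the exponent of the variable `i`. The derivatives on the right are in other
variables and leave this exponent alone, so the coefficients with α_i = n + 1 are determined by
those with α_i ≤ n. -/
lemma MvPowerSeries.formal_cauchy_unique (i : σ) (A : σ → MvPowerSeries σ ℂ) (c v : MvPowerSeries σ ℂ)
    (h0 : ∀ α, α i = 0 → coeff α v = 0)
    (h : pderiv ℂ i v = ∑ k ∈ Finset.univ.erase i, A k * pderiv ℂ k v + c * v) : v = 0 := by
  have key : ∀ n : ℕ, ∀ α : σ →₀ ℕ, α i ≤ n → coeff α v = 0 := by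
    intro n
    induction n with
    | zero => exact fun α hα => h0 α (Nat.le_zero.1 hα)
    | succ n ih =>
      intro α hα
      rcases Nat.lt_or_ge (α i) (n + 1) with h1 | h1
      · exact ih α (by omega)
      have hα' : α - Finsupp.single i 1 + Finsupp.single i 1 = α :=
        tsub_add_cancel_of_le (by simp; omega)
      have hβ : (α - Finsupp.single i (1 : ℕ)) i = n := by simp; omega
      have h2 := congrArg (coeff (α - Finsupp.single i 1)) h
      have hz : ∀ (B w : MvPowerSeries σ ℂ), (∀ δ : σ →₀ ℕ, δ i ≤ n → coeff δ w = 0) →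
          coeff (α - Finsupp.single i 1) (B * w) = 0 := by
        intro B w hw
        rw [coeff_mul]
        refine Finset.sum_eq_zero fun q hq => ?_
        have h3 := congrArg (fun β : σ →₀ ℕ => β i) (Finset.HasAntidiagonal.mem_antidiagonal.1 hq)
        simp only [Finsupp.add_apply] at h3
        rw [hw q.2 (by omega), mul_zero]
      rw [coeff_pderiv, hα', map_add, map_sum, hz c v ih, add_zero, Finset.sum_eq_zero] at h2
      · refine (mul_eq_zero.1 h2).resolve_right ?_
        exact Nat.cast_add_one_ne_zero _
      · intro k hk
        refine hz _ _ fun δ hδ => ?_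
        rw [coeff_pderiv, ih, zero_mul]
        simpa [Finsupp.single_apply, Finset.ne_of_mem_erase hk] using hδ
  ext α
  exact key _ α le_rfl

/-- The action of the vector field with components `X` on functions. -/
def vf (X : σ → EuclideanSpace ℝ σ → ℂ) (f : EuclideanSpace ℝ σ → ℂ) (x : EuclideanSpace ℝ σ) : ℂ :=
  ∑ k, X k x * pd k f x

lemma pd_add (k : σ) (hf : DifferentiableAt ℝ f x) (hg : DifferentiableAt ℝ g x) :
    pd k (fun y => f y + g y) x = pd k f x + pd k g x := by
  simp [pd, fderiv_fun_add hf hg]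

lemma pd_sub (k : σ) (hf : DifferentiableAt ℝ f x) (hg : DifferentiableAt ℝ g x) :
    pd k (fun y => f y - g y) x = pd k f x - pd k g x := by
  simp [pd, fderiv_fun_sub hf hg]

lemma pd_mul (k : σ) (hf : DifferentiableAt ℝ f x) (hg : DifferentiableAt ℝ g x) :
    pd k (fun y => f y * g y) x = f x * pd k g x + g x * pd k f x := by
  simp [pd, fderiv_fun_mul hf hg]

lemma AnalyticAt.pd (hf : AnalyticAt ℝ f p) (k : σ) : AnalyticAt ℝ (pd k f) p := by
  rw [pd_def]
  exact (ContinuousLinearMap.analyticAt (ContinuousLinearMap.apply ℝ ℂ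
    (EuclideanSpace.single k (1 : ℝ) : EuclideanSpace ℝ σ)) _).comp hf.fderiv

lemma pd_sum {ι : Type*} (s : Finset ι) (k : σ) {F : ι → EuclideanSpace ℝ σ → ℂ}
    (hF : ∀ l ∈ s, DifferentiableAt ℝ (F l) x) :
    pd k (fun y => ∑ l ∈ s, F l y) x = ∑ l ∈ s, pd k (F l) x := by
  simp [_root_.pd, fderiv_fun_sum hF]

lemma pd_comm (hf : AnalyticAt ℝ f x) (k l : σ) : pd k (pd l f) x = pd l (pd k f) x := by
  have h2 : IsSymmSndFDerivAt ℝ f x :=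
    hf.contDiffAt.isSymmSndFDerivAt (n := 2) (by simp)
  have hd : DifferentiableAt ℝ (fderiv ℝ f) x := hf.fderiv.differentiableAt
  have e : ∀ a b : EuclideanSpace ℝ σ, fderiv ℝ (fun y => fderiv ℝ f y a) x b =
      fderiv ℝ (fderiv ℝ f) x b a := by
    intro a b
    rw [fderiv_clm_apply hd (differentiableAt_const _)]
    simp
  simp only [pd_def]
  rw [e, e, h2.eq]

lemma vf_add (X : σ → EuclideanSpace ℝ σ → ℂ) (hf : DifferentiableAt ℝ f x)
    (hg : DifferentiableAt ℝ g x) :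
    vf X (fun y => f y + g y) x = vf X f x + vf X g x := by
  simp [vf, pd_add _ hf hg, mul_add, Finset.sum_add_distrib]

lemma vf_sub (X : σ → EuclideanSpace ℝ σ → ℂ) (hf : DifferentiableAt ℝ f x)
    (hg : DifferentiableAt ℝ g x) :
    vf X (fun y => f y - g y) x = vf X f x - vf X g x := by
  simp [vf, pd_sub _ hf hg, mul_sub, Finset.sum_sub_distrib]

lemma vf_mul (X : σ → EuclideanSpace ℝ σ → ℂ) (hf : DifferentiableAt ℝ f x)
    (hg : DifferentiableAt ℝ g x) :
    vf X (fun y => f y * g y) x = f x * vf X g x + g x * vf X f x := by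
  simp only [vf, pd_mul _ hf hg, mul_add, Finset.sum_add_distrib, Finset.mul_sum]
  congr 1 <;> exact Finset.sum_congr rfl fun _ _ => by ring

lemma vf_congr (X : σ → EuclideanSpace ℝ σ → ℂ) (h : f =ᶠ[𝓝 x] g) : vf X f x = vf X g x := by
  simp [vf, pd_congr _ h]

lemma AnalyticAt.vf {X : σ → EuclideanSpace ℝ σ → ℂ} (hX : ∀ k, AnalyticAt ℝ (X k) p)
    (hf : AnalyticAt ℝ f p) : AnalyticAt ℝ (vf X f) p :=
  Finset.analyticAt_fun_sum _ fun k _ => (hX k).mul (hf.pd k)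

/-- Solvability of a noncharacteristic linear Cauchy problem with analytic coefficients and zero
initial values. -/
theorem exists_cauchy {X : σ → EuclideanSpace ℝ σ → ℂ} {c : EuclideanSpace ℝ σ → ℂ} (i : σ)
    (hX : ∀ k, AnalyticAt ℝ (X k) p) (hi : X i p ≠ 0) (hc : AnalyticAt ℝ c p)
    (hg : AnalyticAt ℝ g p) :
    ∃ u, AnalyticAt ℝ u p ∧ (∀ᶠ x in 𝓝 p, vf X u x + c x * u x = g x) ∧
      ∀ᶠ x in 𝓝 p, x i = p i → u x = 0 := by
  have : Nonempty σ := ⟨i⟩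
  -- Division by `X i`, which is nonzero near `p`, solves the equation for the derivative in the
  -- variable `i`.
  have hinv := (hX i).inv hi
  have hA : ∀ k, AnalyticAt ℝ (fun x => -((X i x)⁻¹ * X k x)) p := fun k => (hinv.mul (hX k)).neg
  choose A hA using fun k => (hA k).exists_hasTaylor
  obtain ⟨C', hC⟩ := ((hinv.mul hc).neg).exists_hasTaylor
  obtain ⟨G, hG⟩ := (hinv.mul hg).exists_hasTaylor
  obtain ⟨w, hw, hw0, hw'⟩ := exists_formal_cauchy i A C' G (fun k => (hA k).isConvergent)
    hC.isConvergent hG.isConvergent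
  obtain ⟨u, hu⟩ := hw.exists_hasTaylor p
  refine ⟨u, hu.analyticAt, ?_, (hu.vanish_iff i).2 hw0⟩
  have h1 := ((HasTaylor.sum (Finset.univ.erase i) fun k _ => (hA k).mul (hu.fderiv k)).add
    (hC.mul hu)).add hG
  have h2 := hu.fderiv i
  rw [hw'] at h2
  filter_upwards [h2.eventuallyEq h1, (hX i).continuousAt.eventually_ne hi] with x hx hne
  simp only [Pi.neg_apply, Pi.mul_apply, Pi.inv_apply] at hx
  have e : vf X u x = X i x * pd i u x + ∑ k ∈ Finset.univ.erase i, X k x * pd k u x :=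
    (Finset.add_sum_erase _ _ (Finset.mem_univ i)).symm
  have e2 : ∑ k ∈ Finset.univ.erase i, -((X i x)⁻¹ * X k x) * pd k u x =
      -(X i x)⁻¹ * ∑ k ∈ Finset.univ.erase i, X k x * pd k u x := by
    rw [Finset.mul_sum]
    exact Finset.sum_congr rfl fun _ _ => by ring
  rw [e2] at hx
  rw [e, hx]
  field_simp
  ring

/-- Uniqueness in the linear Cauchy problem. -/
theorem cauchy_unique {X : σ → EuclideanSpace ℝ σ → ℂ} {c v : EuclideanSpace ℝ σ → ℂ} (i : σ)
    (hX : ∀ k, AnalyticAt ℝ (X k) p) (hi : X i p ≠ 0) (hc : AnalyticAt ℝ c p)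
    (hv : AnalyticAt ℝ v p) (h : ∀ᶠ x in 𝓝 p, vf X v x + c x * v x = 0)
    (h0 : ∀ᶠ x in 𝓝 p, x i = p i → v x = 0) : ∀ᶠ x in 𝓝 p, v x = 0 := by
  have : Nonempty σ := ⟨i⟩
  have hinv := (hX i).inv hi
  have hA : ∀ k, AnalyticAt ℝ (fun x => -((X i x)⁻¹ * X k x)) p := fun k => (hinv.mul (hX k)).neg
  choose A hA using fun k => (hA k).exists_hasTaylor
  obtain ⟨C', hC⟩ := ((hinv.mul hc).neg).exists_hasTaylor
  obtain ⟨V, hV⟩ := hv.exists_hasTaylor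
  have h1 := ((HasTaylor.sum (Finset.univ.erase i) fun k _ => (hA k).mul (hV.fderiv k)).add
    (hC.mul hV))
  have h2 : V = 0 := by
    refine formal_cauchy_unique i A C' V ((hV.vanish_iff i).1 h0) ((hV.fderiv i).unique h1 ?_)
    filter_upwards [h, (hX i).continuousAt.eventually_ne hi] with x hx hne
    simp only [Pi.neg_apply, Pi.mul_apply, Pi.inv_apply]
    have e : vf X v x = X i x * pd i v x + ∑ k ∈ Finset.univ.erase i, X k x * pd k v x :=
      (Finset.add_sum_erase _ _ (Finset.mem_univ i)).symm
    have e2 : ∑ k ∈ Finset.univ.erase i, -((X i x)⁻¹ * X k x) * pd k v x =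
        -(X i x)⁻¹ * ∑ k ∈ Finset.univ.erase i, X k x * pd k v x := by
      rw [Finset.mul_sum]
      exact Finset.sum_congr rfl fun _ _ => by ring
    rw [e2]
    rw [e] at hx
    field_simp
    linear_combination hx
  rw [h2] at hV
  have h3 : HasTaylor (fun _ => (0 : ℂ)) p (0 : MvPowerSeries σ ℂ) := by
    simpa using HasTaylor.const 0 p
  exact hV.eventuallyEq h3

/-- A local analytic Frobenius theorem for two complex vector fields spanning an involutive
distribution: the system `X u + c u = g`, `Y u + d u = h` is solvable under the integrability
conditions. -/
theorem exists_frobenius {X Y : σ → EuclideanSpace ℝ σ → ℂ} {a b c d g h : EuclideanSpace ℝ σ → ℂ}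
    {i j : σ} (hX : ∀ k, AnalyticAt ℝ (X k) p) (hY : ∀ k, AnalyticAt ℝ (Y k) p)
    (hb : AnalyticAt ℝ b p) (hc : AnalyticAt ℝ c p) (hd : AnalyticAt ℝ d p)
    (hg : AnalyticAt ℝ g p) (hh : AnalyticAt ℝ h p)
    (hi : X i p ≠ 0) (hij : X i p * Y j p - Y i p * X j p ≠ 0)
    (hXY : ∀ᶠ x in 𝓝 p, ∀ k, vf X (Y k) x - vf Y (X k) x = a x * X k x + b x * Y k x)
    (hflat : ∀ᶠ x in 𝓝 p, vf X d x - vf Y c x = a x * c x + b x * d x)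
    (hcomp : ∀ᶠ x in 𝓝 p, vf X h x - vf Y g x - d x * g x + c x * h x = a x * g x + b x * h x) :
    ∃ u, AnalyticAt ℝ u p ∧ (∀ᶠ x in 𝓝 p, vf X u x + c x * u x = g x) ∧
      ∀ᶠ x in 𝓝 p, vf Y u x + d x * u x = h x := by
  have : Nonempty σ := ⟨i⟩
  have hXi := (hX i).continuousAt.eventually_ne hi
  -- `Y' = Y - q X` has no component in the direction `i`: it is tangent to the hyperplanes where
  -- the coordinate `i` is constant.
  let q : EuclideanSpace ℝ σ → ℂ := fun x => (X i x)⁻¹ * Y i x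
  have hq : AnalyticAt ℝ q p := ((hX i).inv hi).mul (hY i)
  let Y' : σ → EuclideanSpace ℝ σ → ℂ := fun k x => Y k x - q x * X k x
  have hY' : ∀ k, AnalyticAt ℝ (Y' k) p := fun k => (hY k).sub (hq.mul (hX k))
  have hvf : ∀ u x, vf Y' u x = vf Y u x - q x * vf X u x := by
    intro u x
    simp only [vf, Y', sub_mul, Finset.sum_sub_distrib, Finset.mul_sum, mul_assoc]
  have hj : Y' j p ≠ 0 := by
    simp only [Y', q]
    intro hz
    apply hij
    field_simp at hz
    linear_combination hz
  -- `u₀` solves the tangential combination of the two equations. The correction `u₁` then restores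
  -- the equation along `X`; as it vanishes on the initial hyperplane, it leaves the tangential
  -- equation valid there.
  obtain ⟨u₀, hu₀, hu₀e, -⟩ := exists_cauchy (g := fun x => h x - q x * g x)
    (c := fun x => d x - q x * c x) j hY' hj (hd.sub (hq.mul hc)) (hh.sub (hq.mul hg))
  obtain ⟨u₁, hu₁, hu₁e, hu₁0⟩ := exists_cauchy (g := fun x => g x - (vf X u₀ x + c x * u₀ x)) i hX
    hi hc (hg.sub ((hu₀.vf hX).add (hc.mul hu₀)))
  let u : EuclideanSpace ℝ σ → ℂ := fun x => u₀ x + u₁ x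
  have hu : AnalyticAt ℝ u p := hu₀.add hu₁
  have hQ1 : ∀ᶠ x in 𝓝 p, vf X u x + c x * u x = g x := by
    filter_upwards [hu₁e, hu₀.eventually_analyticAt, hu₁.eventually_analyticAt] with x hx h0 h1
    rw [vf_add X h0.differentiableAt h1.differentiableAt]
    simp only [u]
    linear_combination hx
  -- The defect of the second equation. By the integrability conditions it satisfies the homogeneous
  -- equation X Q + (c - b) Q = 0, and it vanishes on the initial hyperplane, so uniqueness gives Q
  -- = 0.
  let Q : EuclideanSpace ℝ σ → ℂ := fun x => vf Y u x + d x * u x - h x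
  have hQ : AnalyticAt ℝ Q p := ((hu.vf hY).add (hd.mul hu)).sub hh
  refine ⟨u, hu, hQ1, ?_⟩
  have hfin : ∀ᶠ x in 𝓝 p, Q x = 0 := by
    refine cauchy_unique (c := fun x => c x - b x) i hX hi (hc.sub hb) hQ ?_ ?_
    · filter_upwards [hXY, hflat, hcomp, hQ1.eventually_nhds, hu.eventually_analyticAt,
        hd.eventually_analyticAt, hc.eventually_analyticAt, hh.eventually_analyticAt,
        hg.eventually_analyticAt, eventually_all.2 fun k => (hX k).eventually_analyticAt,
        eventually_all.2 fun k => (hY k).eventually_analyticAt] with x e1 e2 e3 e4 au ad ac ah ag aX aY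
      have dvY : DifferentiableAt ℝ (vf Y u) x := (au.vf aY).differentiableAt
      have dvX : DifferentiableAt ℝ (vf X u) x := (au.vf aX).differentiableAt
      have r1 : vf X Q x = vf X (vf Y u) x + (d x * vf X u x + u x * vf X d x) - vf X h x := by
        have ddu : DifferentiableAt ℝ (fun x => d x * u x) x :=
          ad.differentiableAt.mul au.differentiableAt
        have dsum : DifferentiableAt ℝ (fun x => vf Y u x + d x * u x) x := dvY.add ddu
        simp only [Q]
        rw [vf_sub X dsum ah.differentiableAt, vf_add X dvY ddu, vf_mul X ad.differentiableAt au.differentiableAt]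
      have r2 : vf Y (vf X u) x + (c x * vf Y u x + u x * vf Y c x) = vf Y g x := by
        have dcu : DifferentiableAt ℝ (fun x => c x * u x) x :=
          ac.differentiableAt.mul au.differentiableAt
        rw [← vf_mul Y ac.differentiableAt au.differentiableAt, ← vf_add Y dvX dcu]
        exact vf_congr Y e4
      have r3 : ∀ Z W : σ → EuclideanSpace ℝ σ → ℂ, (∀ k, AnalyticAt ℝ (Z k) x) →
          (∀ k, AnalyticAt ℝ (W k) x) → vf Z (vf W u) x =
          ∑ k, vf Z (W k) x * pd k u x + ∑ l, ∑ k, Z l x * W k x * pd l (pd k u) x := by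
        intro Z W aZ aW
        have : ∀ l, pd l (vf W u) x = ∑ k, (W k x * pd l (pd k u) x + pd k u x * pd l (W k) x) := by
          intro l
          have hW : ∀ k ∈ Finset.univ, DifferentiableAt ℝ (fun x => W k x * pd k u x) x :=
            fun k _ => ((aW k).mul (au.pd k)).differentiableAt
          unfold vf
          rw [pd_sum _ _ hW]
          exact Finset.sum_congr rfl fun k _ =>
            pd_mul _ (aW k).differentiableAt (au.pd k).differentiableAt
        rw [vf]
        simp_rw [this, vf, Finset.sum_mul, Finset.mul_sum, mul_add, Finset.sum_add_distrib]
        rw [add_comm, Finset.sum_comm]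
        congr 1
        · exact Finset.sum_congr rfl fun _ _ => Finset.sum_congr rfl fun _ _ => by ring
        · exact Finset.sum_congr rfl fun _ _ => Finset.sum_congr rfl fun _ _ => by ring
      -- The second derivatives of `u` cancel by symmetry, leaving the bracket of the two fields
      -- acting on `u`.
      have r4 : vf X (vf Y u) x - vf Y (vf X u) x = a x * vf X u x + b x * vf Y u x := by
        rw [r3 X Y aX aY, r3 Y X aY aX]
        have s1 : ∑ l, ∑ k, Y l x * X k x * pd l (pd k u) x =
            ∑ l, ∑ k, X l x * Y k x * pd l (pd k u) x := by
          rw [Finset.sum_comm]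
          refine Finset.sum_congr rfl fun l _ => Finset.sum_congr rfl fun k _ => ?_
          rw [pd_comm au]; ring
        rw [s1, add_sub_add_right_eq_sub, ← Finset.sum_sub_distrib]
        simp_rw [← sub_mul, e1, vf, Finset.mul_sum, ← Finset.sum_add_distrib]
        exact Finset.sum_congr rfl fun _ _ => by ring
      have e4' := e4.self_of_nhds
      rw [r1]
      simp only [Q]
      linear_combination r4 + r2 + u x * e2 - e3 + (a x + d x) * e4'
    -- The tangential derivatives of `u₁` vanish on the hyperplane, read off from the Taylor
    -- coefficients with zero exponent in the variable `i`.
    · have hdu : ∀ k, k ≠ i → ∀ᶠ x in 𝓝 p, x i = p i → pd k u₁ x = 0 := by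
        intro k hk
        obtain ⟨U, hU⟩ := hu₁.exists_hasTaylor
        rw [(hU.fderiv k).vanish_iff i]
        intro α hα
        rw [coeff_pderiv, (hU.vanish_iff i).1 hu₁0 _ (by simp [hα, hk]),
          zero_mul]
      have hdu' : ∀ᶠ x in 𝓝 p, ∀ k, k ≠ i → x i = p i → pd k u₁ x = 0 := by
        rw [eventually_all]
        intro k
        by_cases hk : k = i
        · simp [hk]
        · filter_upwards [hdu k hk] with x hx _ using hx
      filter_upwards [hdu', hu₁0, hu₀e, hQ1, hu₀.eventually_analyticAt, hu₁.eventually_analyticAt,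
        hXi] with x e1 e2 e3 e4 a0 a1 hne hxi
      have r1 : vf Y' u₁ x = 0 := by
        refine Finset.sum_eq_zero fun k _ => ?_
        by_cases hk : k = i
        · subst hk
          simp only [Y', q]
          field_simp
          simp
        · rw [e1 k hk hxi, mul_zero]
      have r2 : vf Y' u x = vf Y' u₀ x + vf Y' u₁ x :=
        vf_add Y' a0.differentiableAt a1.differentiableAt
      rw [r1, hvf, add_zero] at r2
      have e2' := e2 hxi
      simp only [Q]
      simp only [u, e2', add_zero] at e4 r2 ⊢
      linear_combination r2 + e3 + q x * e4
  filter_upwards [hfin] with x hx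
  simp only [Q] at hx
  linear_combination hx

end

noncomputable section

open Filter Topology VectorField

namespace SpinSpacetime

variable {M : Type*} [TopologicalSpace M] [ChartedSpace (EuclideanSpace ℝ (Fin 4)) M]

lemma finrank_tangentSpace (x : M) : Module.finrank ℝ (TangentSpace (𝓡 4) x) = 4 := by
  change Module.finrank ℝ (EuclideanSpace ℝ (Fin 4)) = 4
  simp

lemma contMDiffAt_det {n : WithTop ℕ∞} {p : M} {A : M → Matrix (Fin 4) (Fin 4) ℝ}
    (hA : ∀ i j, ContMDiffAt (𝓡 4) 𝓘(ℝ, ℝ) n (fun x => A x i j) p) :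
    ContMDiffAt (𝓡 4) 𝓘(ℝ, ℝ) n (fun x => (A x).det) p := by
  simp_rw [Matrix.det_apply']
  refine contMDiffAt_finsetSum fun σ _ => ?_
  exact contMDiffAt_const.mul (contMDiffAt_finsetProd fun i _ => hA _ _)

variable [IsManifold (𝓡 4) ∞ M] (S : SpinSpacetime M)

/-! ### The orthonormal frame -/

lemma minkowskiSign_mul_self (i : Fin 4) : minkowskiSign i * minkowskiSign i = 1 := by
  unfold minkowskiSign; split_ifs <;> norm_num

lemma linearIndependent_E (x : M) : LinearIndependent ℝ fun i => S.E i x := by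
  rw [Fintype.linearIndependent_iff]
  intro a ha i
  have h := congrArg (fun V => S.g x V (S.E i x)) ha
  simp only [map_sum, map_smul, LinearMap.sum_apply, LinearMap.smul_apply, S.orthonormal,
    smul_eq_mul, map_zero, LinearMap.zero_apply] at h
  simp only [mul_ite, mul_zero, Finset.sum_ite_eq', Finset.mem_univ, if_true] at h
  refine (mul_eq_zero.1 h).resolve_right ?_
  unfold minkowskiSign; split_ifs <;> norm_num

/-- The frame at `x` as a basis. -/
def basisE (x : M) : Module.Basis (Fin 4) ℝ (TangentSpace (𝓡 4) x) :=
  basisOfLinearIndependentOfCardEqFinrank (S.linearIndependent_E x)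
    (by rw [finrank_tangentSpace]; simp)

lemma basisE_apply (x : M) (i : Fin 4) : S.basisE x i = S.E i x := by
  simp [basisE]

/-- The components of a vector in the frame. -/
def comp (x : M) (V : TangentSpace (𝓡 4) x) (k : Fin 4) : ℝ :=
  minkowskiSign k * S.g x V (S.E k x)

lemma comp_sum (x : M) (a : Fin 4 → ℝ) (k : Fin 4) : S.comp x (∑ i, a i • S.E i x) k = a k := by
  simp only [comp, map_sum, map_smul, LinearMap.sum_apply, LinearMap.smul_apply, S.orthonormal,
    smul_eq_mul]
  simp only [mul_ite, mul_zero, Finset.sum_ite_eq', Finset.mem_univ, if_true]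
  linear_combination a k * minkowskiSign_mul_self k

lemma sum_comp (x : M) (V : TangentSpace (𝓡 4) x) : ∑ k, S.comp x V k • S.E k x = V := by
  obtain ⟨a, rfl⟩ : ∃ a : Fin 4 → ℝ, V = ∑ i, a i • S.E i x := by
    refine ⟨fun i => (S.basisE x).repr V i, ?_⟩
    simp_rw [← S.basisE_apply]
    exact ((S.basisE x).sum_repr V).symm
  simp_rw [comp_sum]

lemma g_apply_E (x : M) (V : TangentSpace (𝓡 4) x) (k : Fin 4) :
    S.g x V (S.E k x) = minkowskiSign k * S.comp x V k := by
  unfold comp; linear_combination (-(S.g x V (S.E k x))) * minkowskiSign_mul_self k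

/-- The frame components of a `C^n` vector field are `C^n` if the frame is. -/
lemma contMDiffAt_comp {n : WithTop ℕ∞} [IsManifold (𝓡 4) (n + 1) M] {p : M}
    {V : ∀ x : M, TangentSpace (𝓡 4) x}
    (hE : ∀ i, ContMDiffAt (𝓡 4) (𝓡 4).tangent n
      (fun x => (⟨x, S.E i x⟩ : TangentBundle (𝓡 4) M)) p)
    (hV : ContMDiffAt (𝓡 4) (𝓡 4).tangent n
      (fun x => (⟨x, V x⟩ : TangentBundle (𝓡 4) M)) p) (k : Fin 4) :
    ContMDiffAt (𝓡 4) 𝓘(ℝ, ℝ) n (fun x => S.comp x (V x) k) p := by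
  let e := trivializationAt (EuclideanSpace ℝ (Fin 4)) (TangentSpace (𝓡 4) : M → Type _) p
  let b := (EuclideanSpace.basisFun (Fin 4) ℝ).toBasis
  have hp : p ∈ e.baseSet := FiberBundle.mem_baseSet_trivializationAt' p
  have : ContMDiffVectorBundle n (EuclideanSpace ℝ (Fin 4))
    (TangentSpace (𝓡 4) : M → Type _) (𝓡 4) := TangentBundle.contMDiffVectorBundle
  have hVc : ∀ j, ContMDiffAt (𝓡 4) 𝓘(ℝ, ℝ) n
      (fun x => e.localFrameCoeff (𝓡 4) b j x (V x)) p := fun j =>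
    contMDiffAt_localFrameCoeff (e := e) b hp hV j
  have hEc : ∀ i j, ContMDiffAt (𝓡 4) 𝓘(ℝ, ℝ) n
      (fun x => e.localFrameCoeff (𝓡 4) b j x (S.E i x)) p := fun i j =>
    contMDiffAt_localFrameCoeff (e := e) b hp (hE i) j
  let A : M → Matrix (Fin 4) (Fin 4) ℝ := fun x j i => e.localFrameCoeff (𝓡 4) b j x (S.E i x)
  let v : M → Fin 4 → ℝ := fun x j => e.localFrameCoeff (𝓡 4) b j x (V x)
  have hmul : ∀ x, (A x).mulVec (fun k => S.comp x (V x) k) = v x := by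
    intro x
    ext j
    simp only [Matrix.mulVec, dotProduct, A, v]
    conv_rhs => rw [← S.sum_comp x (V x), map_sum]
    exact Finset.sum_congr rfl fun i _ => by rw [map_smul, smul_eq_mul, mul_comm]
  have hdet : ∀ x ∈ e.baseSet, (A x).det ≠ 0 := by
    intro x hx
    have : A x = (e.basisAt b hx).toMatrix (S.basisE x) := by
      ext j i
      simp only [A, Module.Basis.toMatrix_apply, basisE_apply]
      exact e.localFrameCoeff_apply_of_mem_baseSet b hx (S.E i) j
    rw [this]
    have := (e.basisAt b hx).invertibleToMatrix (S.basisE x)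
    exact ((Matrix.isUnit_iff_isUnit_det _).1 (isUnit_of_invertible _)).ne_zero
  -- Cramer's rule in a local trivialization expresses the components through the frame and the
  -- vector field alone, so they inherit the regularity of these two; no differentiability of the
  -- pointwise metric enters.
  have hcr : ∀ x ∈ e.baseSet, S.comp x (V x) k = ((A x).det)⁻¹ * ((A x).updateCol k (v x)).det := by
    intro x hx
    have h1 : ((A x).updateCol k (v x)).det = (A x).det * S.comp x (V x) k := by
      rw [← Matrix.cramer_apply, ← hmul, Matrix.cramer_eq_adjugate_mulVec, Matrix.mulVec_mulVec,
        Matrix.adjugate_mul, Matrix.smul_mulVec, Matrix.one_mulVec]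
      rfl
    rw [h1, inv_mul_cancel_left₀ (hdet x hx)]
  have hsm : ContMDiffAt (𝓡 4) 𝓘(ℝ, ℝ) n
      (fun x => ((A x).det)⁻¹ * ((A x).updateCol k (v x)).det) p := by
    refine ContMDiffAt.mul ?_ (contMDiffAt_det fun i j => ?_)
    · exact (contMDiffAt_det fun i j => hEc j i).inv₀ (hdet p hp)
    · simp only [Matrix.updateCol_apply]
      split_ifs
      · exact hVc i
      · exact hEc j i
  refine hsm.congr_of_eventuallyEq ?_
  filter_upwards [e.open_baseSet.mem_nhds hp] with x hx using hcr x hx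

end SpinSpacetime

end

/-! ### Differentiation along the frame and commutators. -/

noncomputable section

open Filter Topology VectorField

section

variable {M : Type*} [TopologicalSpace M] [ChartedSpace (EuclideanSpace ℝ (Fin 4)) M]

/-- Only ∞ and ω lie above ∞, and neither changes when 1 is added. Smooth and analytic regularity
can therefore be treated together, with no loss under differentiation. -/
lemma add_one_eq_self_of_infty_le {n : WithTop ℕ∞} (hn : ∞ ≤ n) : n + 1 = n := by
  induction n using WithTop.recTopCoe with
  | top => rfl
  | coe n =>
    have h : n = ⊤ := by
      have := WithTop.coe_le_coe.1 hn
      exact top_le_iff.1 this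
    subst h; rfl

lemma mvfderiv_clm_comp {F G : Type*} [NormedAddCommGroup F] [NormedSpace ℝ F]
    [NormedAddCommGroup G] [NormedSpace ℝ G] (L : F →L[ℝ] G) {f : M → F} {x : M}
    (hf : MDifferentiableAt (𝓡 4) 𝓘(ℝ, F) f x) (v : TangentSpace (𝓡 4) x) :
    mvfderiv (𝓡 4) (fun y => L (f y)) x v = L (mvfderiv (𝓡 4) f x v) := by
  have h1 : mfderiv (𝓡 4) 𝓘(ℝ, G) (L ∘ f) x = (mfderiv 𝓘(ℝ, F) 𝓘(ℝ, G) L (f x)).comp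
      (mfderiv (𝓡 4) 𝓘(ℝ, F) f x) :=
    mfderiv_comp x L.mdifferentiableAt hf
  have h2 : mvfderiv (𝓡 4) (fun y => L (f y)) x v = mfderiv (𝓡 4) 𝓘(ℝ, G) (L ∘ f) x v := rfl
  rw [h2, h1, ContinuousLinearMap.mfderiv_eq]
  rfl

lemma mvfderiv_const_mul_real {f : M → ℝ} {x : M} (hf : MDifferentiableAt (𝓡 4) 𝓘(ℝ, ℝ) f x) (c : ℝ)
    (v : TangentSpace (𝓡 4) x) :
    mvfderiv (𝓡 4) (fun y => c * f y) x v = c * mvfderiv (𝓡 4) f x v :=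
  mvfderiv_clm_comp (c • ContinuousLinearMap.id ℝ ℝ) hf v

lemma mvfderiv_complex {f : M → ℂ} {x : M} (hf : MDifferentiableAt (𝓡 4) 𝓘(ℝ, ℂ) f x)
    (v : TangentSpace (𝓡 4) x) :
    mvfderiv (𝓡 4) f x v = (mvfderiv (𝓡 4) (fun y => (f y).re) x v : ℂ) +
      (mvfderiv (𝓡 4) (fun y => (f y).im) x v : ℂ) * Complex.I := by
  have h1 := mvfderiv_clm_comp Complex.reCLM hf v
  have h2 := mvfderiv_clm_comp Complex.imCLM hf v
  simp only [Complex.reCLM_apply, Complex.imCLM_apply] at h1 h2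
  rw [h1, h2, Complex.re_add_im]

lemma mvfderiv_ofReal {f : M → ℝ} {x : M} (hf : MDifferentiableAt (𝓡 4) 𝓘(ℝ, ℝ) f x)
    (v : TangentSpace (𝓡 4) x) :
    mvfderiv (𝓡 4) (fun y => (f y : ℂ)) x v = (mvfderiv (𝓡 4) f x v : ℂ) :=
  mvfderiv_clm_comp Complex.ofRealCLM hf v

lemma ContMDiffAt.complex_re {n : WithTop ℕ∞} {f : M → ℂ} {x : M}
    (hf : ContMDiffAt (𝓡 4) 𝓘(ℝ, ℂ) n f x) :
    ContMDiffAt (𝓡 4) 𝓘(ℝ, ℝ) n (fun y => (f y).re) x :=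
  Complex.reCLM.contMDiff.contMDiffAt.comp x hf

lemma ContMDiffAt.complex_im {n : WithTop ℕ∞} {f : M → ℂ} {x : M}
    (hf : ContMDiffAt (𝓡 4) 𝓘(ℝ, ℂ) n f x) :
    ContMDiffAt (𝓡 4) 𝓘(ℝ, ℝ) n (fun y => (f y).im) x :=
  Complex.imCLM.contMDiff.contMDiffAt.comp x hf

lemma ContMDiffAt.complex_ofReal {n : WithTop ℕ∞} {f : M → ℝ} {x : M}
    (hf : ContMDiffAt (𝓡 4) 𝓘(ℝ, ℝ) n f x) :
    ContMDiffAt (𝓡 4) 𝓘(ℝ, ℂ) n (fun y => (f y : ℂ)) x :=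
  Complex.ofRealCLM.contMDiff.contMDiffAt.comp x hf

lemma mvfderiv_mul_complex {f g : M → ℂ} {x : M} (hf : MDifferentiableAt (𝓡 4) 𝓘(ℝ, ℂ) f x)
    (hg : MDifferentiableAt (𝓡 4) 𝓘(ℝ, ℂ) g x) (v : TangentSpace (𝓡 4) x) :
    mvfderiv (𝓡 4) (fun y => f y * g y) x v =
      f x * mvfderiv (𝓡 4) g x v + g x * mvfderiv (𝓡 4) f x v := by
  have h := hf.hasMFDerivAt.mul hg.hasMFDerivAt
  have h2 := h.mfderiv
  have h3 : mvfderiv (𝓡 4) (fun y => f y * g y) x v = mfderiv (𝓡 4) 𝓘(ℝ, ℂ) (f * g) x v := rfl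
  rw [h3, h2]
  rfl

lemma ContMDiffAt.mul_complex {n : WithTop ℕ∞} {f g : M → ℂ} {x : M}
    (hf : ContMDiffAt (𝓡 4) 𝓘(ℝ, ℂ) n f x) (hg : ContMDiffAt (𝓡 4) 𝓘(ℝ, ℂ) n g x) :
    ContMDiffAt (𝓡 4) 𝓘(ℝ, ℂ) n (fun y => f y * g y) x := by
  have h : ContMDiffAt 𝓘(ℝ, ℂ × ℂ) 𝓘(ℝ, ℂ) n (fun q : ℂ × ℂ => q.1 * q.2) (f x, g x) :=
    (contDiff_fst.mul contDiff_snd).contMDiff.contMDiffAt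
  exact h.comp x (hf.prodMk_space hg)

variable [IsManifold (𝓡 4) ∞ M]

lemma ContMDiffAt.eventually_mdifferentiableAt {F : Type*} [NormedAddCommGroup F]
    [NormedSpace ℝ F] {n : WithTop ℕ∞} (hn : ∞ ≤ n) {f : M → F} {x : M}
    (hf : ContMDiffAt (𝓡 4) 𝓘(ℝ, F) n f x) :
    ∀ᶠ y in 𝓝 x, MDifferentiableAt (𝓡 4) 𝓘(ℝ, F) f y := by
  have : IsManifold (𝓡 4) 1 M := IsManifold.of_le (n := ∞) (by norm_cast)
  have h1 : ContMDiffAt (𝓡 4) 𝓘(ℝ, F) 1 f x :=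
    hf.of_le (le_trans (by norm_cast) hn)
  filter_upwards [(contMDiffAt_iff_contMDiffAt_nhds (by simp)).1 h1] with y hy
  exact hy.mdifferentiableAt (by simp)

lemma contMDiffAt_mlieBracket {n : WithTop ℕ∞} (hn : ∞ ≤ n) [IsManifold (𝓡 4) n M] {p : M}
    {U V : ∀ x : M, TangentSpace (𝓡 4) x}
    (hU : ContMDiffAt (𝓡 4) (𝓡 4).tangent n (fun x => (⟨x, U x⟩ : TangentBundle (𝓡 4) M)) p)
    (hV : ContMDiffAt (𝓡 4) (𝓡 4).tangent n (fun x => (⟨x, V x⟩ : TangentBundle (𝓡 4) M)) p) :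
    ContMDiffAt (𝓡 4) (𝓡 4).tangent n
      (fun x => (⟨x, mlieBracket (𝓡 4) U V x⟩ : TangentBundle (𝓡 4) M)) p := by
  have hn1 := add_one_eq_self_of_infty_le hn
  have : IsManifold (𝓡 4) (n + 1) M := by rw [hn1]; infer_instance
  have : IsManifold (𝓡 4) (minSmoothness ℝ 2) M := by
    simp only [minSmoothness_of_isRCLikeNormedField]
    exact IsManifold.of_le (n := ∞) (by norm_cast)
  rw [← contMDiffWithinAt_univ] at hU hV ⊢
  simp_rw [← mlieBracketWithin_univ]
  refine ContMDiffWithinAt.mlieBracketWithin_vectorField hU hV uniqueMDiffOn_univ (Set.mem_univ _) ?_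
  rw [hn1]
  simp

end

namespace SpinSpacetime

variable {M : Type*} [TopologicalSpace M] [ChartedSpace (EuclideanSpace ℝ (Fin 4)) M]
  [IsManifold (𝓡 4) ∞ M] (S : SpinSpacetime M)

/-- The derivative of a function in the direction `E i`. -/
def d {F : Type*} [NormedAddCommGroup F] [NormedSpace ℝ F] (i : Fin 4) (f : M → F) (x : M) : F :=
  mvfderiv (𝓡 4) f x (S.E i x)

lemma mdiffAt_E (i : Fin 4) (x : M) : MDifferentiableAt (𝓡 4) (𝓡 4).tangent
    (fun x => (⟨x, S.E i x⟩ : TangentBundle (𝓡 4) M)) x :=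
  ((S.contMDiff_E i) x).mdifferentiableAt (by simp)

lemma bracket_smul {f : M → ℝ} {x : M} (V : ∀ x : M, TangentSpace (𝓡 4) x)
    (hf : MDifferentiableAt (𝓡 4) 𝓘(ℝ, ℝ) f x) (j : Fin 4) :
    mlieBracket (𝓡 4) V (f • S.E j) x =
      mvfderiv (𝓡 4) f x (V x) • S.E j x + f x • mlieBracket (𝓡 4) V (S.E j) x :=
  mlieBracket_smul_right hf (S.mdiffAt_E j x)

lemma contMDiffAt_smul_E {n : WithTop ℕ∞} {f : M → ℝ} {p : M} {j : Fin 4}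
    [IsManifold (𝓡 4) (n + 1) M]
    (hE : ContMDiffAt (𝓡 4) (𝓡 4).tangent n
      (fun x => (⟨x, S.E j x⟩ : TangentBundle (𝓡 4) M)) p)
    (hf : ContMDiffAt (𝓡 4) 𝓘(ℝ, ℝ) n f p) :
    ContMDiffAt (𝓡 4) (𝓡 4).tangent n
      (fun x => (⟨x, (f • S.E j) x⟩ : TangentBundle (𝓡 4) M)) p := by
  have : ContMDiffVectorBundle n (EuclideanSpace ℝ (Fin 4))
    (TangentSpace (𝓡 4) : M → Type _) (𝓡 4) := TangentBundle.contMDiffVectorBundle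
  exact hf.smul_section hE

/-- The derivative is extracted from a Lie bracket: [E_i, f E_0] = (E_i f) E_0 + f [E_i, E_0].
Regularity of brackets and of frame components then gives regularity of E_i f. -/
lemma contMDiffAt_d_real {n : WithTop ℕ∞} (hn : ∞ ≤ n) [IsManifold (𝓡 4) n M] {p : M}
    (hE : ∀ i, ContMDiffAt (𝓡 4) (𝓡 4).tangent n
      (fun x => (⟨x, S.E i x⟩ : TangentBundle (𝓡 4) M)) p)
    {f : M → ℝ} (hf : ContMDiffAt (𝓡 4) 𝓘(ℝ, ℝ) n f p) (i : Fin 4) :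
    ContMDiffAt (𝓡 4) 𝓘(ℝ, ℝ) n (S.d i f) p := by
  have hn1 := add_one_eq_self_of_infty_le hn
  have : IsManifold (𝓡 4) (n + 1) M := by rw [hn1]; infer_instance
  have h1 : ContMDiffAt (𝓡 4) 𝓘(ℝ, ℝ) n (fun x => S.comp x (mlieBracket (𝓡 4) (S.E i) (f • S.E 0) x) 0
      - f x * S.comp x (mlieBracket (𝓡 4) (S.E i) (S.E 0) x) 0) p := by
    refine ContMDiffAt.sub ?_ (hf.mul ?_)
    · exact S.contMDiffAt_comp hE
        (contMDiffAt_mlieBracket hn (hE i) (S.contMDiffAt_smul_E (hE 0) hf)) 0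
    · exact S.contMDiffAt_comp hE (contMDiffAt_mlieBracket hn (hE i) (hE 0)) 0
  refine h1.congr_of_eventuallyEq ?_
  filter_upwards [hf.eventually_mdifferentiableAt hn] with x hx
  rw [S.bracket_smul _ hx]
  simp only [comp, map_add, map_smul, LinearMap.add_apply, LinearMap.smul_apply, smul_eq_mul,
    S.orthonormal, d]
  simp [minkowskiSign]

lemma contMDiffAt_d {n : WithTop ℕ∞} (hn : ∞ ≤ n) [IsManifold (𝓡 4) n M] {p : M}
    (hE : ∀ i, ContMDiffAt (𝓡 4) (𝓡 4).tangent n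
      (fun x => (⟨x, S.E i x⟩ : TangentBundle (𝓡 4) M)) p)
    {f : M → ℂ} (hf : ContMDiffAt (𝓡 4) 𝓘(ℝ, ℂ) n f p) (i : Fin 4) :
    ContMDiffAt (𝓡 4) 𝓘(ℝ, ℂ) n (S.d i f) p := by
  have h1 := (S.contMDiffAt_d_real hn hE hf.complex_re i).complex_ofReal
  have h2 := (S.contMDiffAt_d_real hn hE hf.complex_im i).complex_ofReal
  have h3 : ContMDiffAt (𝓡 4) 𝓘(ℝ, ℂ) n (fun x => ((S.d i (fun y => (f y).re) x : ℝ) : ℂ) +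
      ((S.d i (fun y => (f y).im) x : ℝ) : ℂ) * Complex.I) p := h1.add (h2.mul_complex contMDiffAt_const)
  refine h3.congr_of_eventuallyEq ?_
  filter_upwards [hf.eventually_mdifferentiableAt hn] with x hx
  exact mvfderiv_complex hx _

/-- The structure functions of the frame, `[E_i, E_j] = ∑ C_{ij}^k E_k`. -/
def struct (i j k : Fin 4) (x : M) : ℝ := S.comp x (mlieBracket (𝓡 4) (S.E i) (S.E j) x) k

lemma contMDiffAt_struct {n : WithTop ℕ∞} (hn : ∞ ≤ n) [IsManifold (𝓡 4) n M] {p : M}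
    (hE : ∀ i, ContMDiffAt (𝓡 4) (𝓡 4).tangent n
      (fun x => (⟨x, S.E i x⟩ : TangentBundle (𝓡 4) M)) p) (i j k : Fin 4) :
    ContMDiffAt (𝓡 4) 𝓘(ℝ, ℝ) n (S.struct i j k) p := by
  have : IsManifold (𝓡 4) (n + 1) M := by rw [add_one_eq_self_of_infty_le hn]; infer_instance
  exact S.contMDiffAt_comp hE (contMDiffAt_mlieBracket hn (hE i) (hE j)) k

lemma mlieBracket_E (i j : Fin 4) :
    mlieBracket (𝓡 4) (S.E i) (S.E j) = fun x => ∑ k, S.struct i j k x • S.E k x := by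
  ext1 x
  exact (S.sum_comp x _).symm

lemma contMDiffAt_E (i : Fin 4) (x : M) : ContMDiffAt (𝓡 4) (𝓡 4).tangent ∞
    (fun x => (⟨x, S.E i x⟩ : TangentBundle (𝓡 4) M)) x := S.contMDiff_E i x

/-- The Jacobi identity for E_i, E_j and f E_0, expanded by the Leibniz rule: what remains beyond f
times the identity for E_0 is a multiple of E_0, whose coefficient is the claim. -/
lemma commutator_real {f : M → ℝ} {x : M} (hf : ContMDiffAt (𝓡 4) 𝓘(ℝ, ℝ) ∞ f x) (i j : Fin 4) :
    S.d i (S.d j f) x - S.d j (S.d i f) x = ∑ k, S.struct i j k x * S.d k f x := by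
  have hE := S.contMDiffAt_E
  have hd : ∀ i, MDifferentiableAt (𝓡 4) 𝓘(ℝ, ℝ) (S.d i f) x := fun i =>
    (S.contMDiffAt_d_real le_rfl (fun i => hE i x) hf i).mdifferentiableAt (by simp)
  have hfd := hf.mdifferentiableAt (by simp)
  have : IsManifold (𝓡 4) (∞ + 1) M := ‹IsManifold (𝓡 4) ∞ M›
  have : IsManifold (𝓡 4) (minSmoothness ℝ 3) M := by
    simp only [minSmoothness_of_isRCLikeNormedField]
    exact IsManifold.of_le (n := ∞) (by norm_cast)
  have h2 : (minSmoothness ℝ 2) ≤ (∞ : WithTop ℕ∞) := by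
    simp only [minSmoothness_of_isRCLikeNormedField]; norm_cast
  have hJ := leibniz_identity_mlieBracket_apply ((hE i x).of_le h2) ((hE j x).of_le h2)
    ((S.contMDiffAt_smul_E (hE 0 x) hf).of_le h2)
  have hJ0 := leibniz_identity_mlieBracket_apply ((hE i x).of_le h2) ((hE j x).of_le h2)
    ((hE 0 x).of_le h2)
  have hev := hf.eventually_mdifferentiableAt le_rfl
  have hexp : ∀ a b, mlieBracket (𝓡 4) (S.E a) (mlieBracket (𝓡 4) (S.E b) (f • S.E 0)) x =
      S.d a (S.d b f) x • S.E 0 x + S.d b f x • mlieBracket (𝓡 4) (S.E a) (S.E 0) x +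
      (S.d a f x • mlieBracket (𝓡 4) (S.E b) (S.E 0) x +
        f x • mlieBracket (𝓡 4) (S.E a) (mlieBracket (𝓡 4) (S.E b) (S.E 0)) x) := by
    intro a b
    have e1 : mlieBracket (𝓡 4) (S.E b) (f • S.E 0) =ᶠ[𝓝 x]
        S.d b f • S.E 0 + f • mlieBracket (𝓡 4) (S.E b) (S.E 0) := by
      filter_upwards [hev] with y hy
      exact S.bracket_smul _ (hy) 0
    have hb : MDifferentiableAt (𝓡 4) (𝓡 4).tangent
        (fun x => (⟨x, mlieBracket (𝓡 4) (S.E b) (S.E 0) x⟩ : TangentBundle (𝓡 4) M)) x :=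
      (contMDiffAt_mlieBracket le_rfl (hE b x) (hE 0 x)).mdifferentiableAt (by simp)
    rw [EventuallyEq.rfl.mlieBracket_vectorField_eq e1, mlieBracket_add_right,
      S.bracket_smul _ (hd b), mlieBracket_smul_right hfd hb]
    · rfl
    · exact (S.contMDiffAt_smul_E (hE 0 x)
        (S.contMDiffAt_d_real le_rfl (fun i => hE i x) hf b)).mdifferentiableAt (by simp)
    · have : ContMDiffVectorBundle ∞ (EuclideanSpace ℝ (Fin 4))
        (TangentSpace (𝓡 4) : M → Type _) (𝓡 4) := TangentBundle.contMDiffVectorBundle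
      exact (hf.smul_section
        (contMDiffAt_mlieBracket le_rfl (hE b x) (hE 0 x))).mdifferentiableAt (by simp)
  rw [hexp, hexp, S.bracket_smul _ hfd, hJ0] at hJ
  have h5 : (S.d i (S.d j f) x - S.d j (S.d i f) x) • S.E 0 x =
      mvfderiv (𝓡 4) f x (mlieBracket (𝓡 4) (S.E i) (S.E j) x) • S.E 0 x := by
    rw [sub_smul, sub_eq_iff_eq_add]
    have := hJ
    simp only [smul_add] at this
    rw [← sub_eq_zero] at this ⊢
    rw [← this]
    abel
  have h0 : S.E 0 x ≠ 0 := (S.linearIndependent_E x).ne_zero 0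
  rw [smul_left_injective ℝ h0 h5, mlieBracket_E, map_sum]
  simp [d]

lemma commutator {f : M → ℂ} {x : M} (hf : ContMDiffAt (𝓡 4) 𝓘(ℝ, ℂ) ∞ f x) (i j : Fin 4) :
    S.d i (S.d j f) x - S.d j (S.d i f) x = ∑ k, (S.struct i j k x : ℂ) * S.d k f x := by
  have hE := S.contMDiffAt_E
  have hre := S.commutator_real hf.complex_re i j
  have him := S.commutator_real hf.complex_im i j
  have key : ∀ y, MDifferentiableAt (𝓡 4) 𝓘(ℝ, ℂ) f y → ∀ k, S.d k f y =
      ((S.d k (fun y => (f y).re) y : ℝ) : ℂ) + ((S.d k (fun y => (f y).im) y : ℝ) : ℂ) * Complex.I :=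
    fun y hy k => mvfderiv_complex hy _
  have hev := hf.eventually_mdifferentiableAt le_rfl
  have key2 : ∀ a b, S.d a (S.d b f) x = ((S.d a (S.d b (fun y => (f y).re)) x : ℝ) : ℂ) +
      ((S.d a (S.d b (fun y => (f y).im)) x : ℝ) : ℂ) * Complex.I := by
    intro a b
    have hdb : MDifferentiableAt (𝓡 4) 𝓘(ℝ, ℂ) (S.d b f) x :=
      (S.contMDiffAt_d le_rfl (fun i => hE i x) hf b).mdifferentiableAt (by simp)
    have h1 := mvfderiv_complex hdb (S.E a x)
    have hr : (fun y => (S.d b f y).re) =ᶠ[𝓝 x] S.d b (fun y => (f y).re) := by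
      filter_upwards [hev] with y hy
      rw [key y (hy)]; simp
    have hi : (fun y => (S.d b f y).im) =ᶠ[𝓝 x] S.d b (fun y => (f y).im) := by
      filter_upwards [hev] with y hy
      rw [key y (hy)]; simp
    unfold mvfderiv at h1
    rw [hr.mfderiv_eq, hi.mfderiv_eq] at h1
    exact h1
  rw [key2, key2]
  simp_rw [key x (hf.mdifferentiableAt (by simp))]
  have hre' := congrArg (fun t : ℝ => (t : ℂ)) hre
  have him' := congrArg (fun t : ℝ => (t : ℂ)) him
  push_cast at hre' him'
  simp_rw [mul_add, Finset.sum_add_distrib, ← mul_assoc, ← Finset.sum_mul]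
  linear_combination hre' + Complex.I * him'

end SpinSpacetime

end

/-! ### Connection coefficients, Riemann tensor and Jacobi identity in the frame. -/

noncomputable section

open Filter Topology VectorField

namespace SpinSpacetime

variable {M : Type*} [TopologicalSpace M] [ChartedSpace (EuclideanSpace ℝ (Fin 4)) M]
  [IsManifold (𝓡 4) ∞ M] (S : SpinSpacetime M)

/-- The connection coefficients `γ_{ijk} = g(∇_{E_i} E_j, E_k)` of the frame. -/
def gam (i j k : Fin 4) (x : M) : ℝ :=
  (minkowskiSign k * S.struct i j k x - minkowskiSign j * S.struct i k j x
    - minkowskiSign i * S.struct j k i x) / 2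

lemma struct_swap (i j k : Fin 4) (x : M) : S.struct i j k x = -S.struct j i k x := by
  unfold struct
  rw [mlieBracket_swap_apply]
  simp [comp]

lemma gam_antisymm (i j k : Fin 4) (x : M) : S.gam i j k x = -S.gam i k j x := by
  unfold gam
  rw [S.struct_swap k j i]
  ring

lemma struct_eq_gam (i j k : Fin 4) (x : M) :
    S.struct i j k x = minkowskiSign k * (S.gam i j k x - S.gam j i k x) := by
  unfold gam
  rw [S.struct_swap j i k]
  linear_combination (-S.struct i j k x) * minkowskiSign_mul_self k

lemma contMDiffAt_gam {n : WithTop ℕ∞} (hn : ∞ ≤ n) [IsManifold (𝓡 4) n M] {p : M}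
    (hE : ∀ i, ContMDiffAt (𝓡 4) (𝓡 4).tangent n
      (fun x => (⟨x, S.E i x⟩ : TangentBundle (𝓡 4) M)) p) (i j k : Fin 4) :
    ContMDiffAt (𝓡 4) 𝓘(ℝ, ℝ) n (S.gam i j k) p := by
  have h : ContMDiffAt (𝓡 4) 𝓘(ℝ, ℝ) n (fun x => (minkowskiSign k * S.struct i j k x
      - minkowskiSign j * S.struct i k j x - minkowskiSign i * S.struct j k i x) * (1 / 2)) p :=
    (((contMDiffAt_const.mul (S.contMDiffAt_struct hn hE i j k)).sub
      (contMDiffAt_const.mul (S.contMDiffAt_struct hn hE i k j))).sub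
      (contMDiffAt_const.mul (S.contMDiffAt_struct hn hE j k i))).mul contMDiffAt_const
  refine h.congr_of_eventuallyEq (Eventually.of_forall fun x => ?_)
  simp only [gam]; ring

lemma g_E_E (i j : Fin 4) : (fun y => S.g y (S.E i y) (S.E j y)) =
    fun _ => if i = j then minkowskiSign i else 0 := by
  ext y; exact S.orthonormal y i j

lemma g_sum_E (x : M) (f : Fin 4 → ℝ) (l : Fin 4) :
    S.g x (∑ m, f m • S.E m x) (S.E l x) = minkowskiSign l * f l := by
  rw [g_apply_E, comp_sum]

lemma g_E_sum (x : M) (f : Fin 4 → ℝ) (l : Fin 4) :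
    S.g x (S.E l x) (∑ m, f m • S.E m x) = minkowskiSign l * f l := by
  simp only [map_sum, map_smul, S.orthonormal, smul_eq_mul, mul_ite, mul_zero, Finset.sum_ite_eq,
    Finset.mem_univ, if_true]
  ring

lemma mdiffAt_smul_E {f : M → ℝ} {x : M} (hf : MDifferentiableAt (𝓡 4) 𝓘(ℝ, ℝ) f x) (m : Fin 4) :
    MDifferentiableAt (𝓡 4) (𝓡 4).tangent
      (fun y => (⟨y, (f • S.E m) y⟩ : TangentBundle (𝓡 4) M)) x :=
  hf.smul_section (S.mdiffAt_E m x)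

lemma bracket_sum {f : Fin 4 → M → ℝ} {x : M}
    (hf : ∀ m, MDifferentiableAt (𝓡 4) 𝓘(ℝ, ℝ) (f m) x) (i : Fin 4) :
    mlieBracket (𝓡 4) (S.E i) (fun y => ∑ m, f m y • S.E m y) x =
      ∑ l, (S.d i (f l) x + ∑ m, f m x * S.struct i m l x) • S.E l x := by
  have h0 : (fun y => ∑ m, f m y • S.E m y) = f 0 • S.E 0 + (f 1 • S.E 1 + (f 2 • S.E 2 +
      f 3 • S.E 3)) := by
    ext1 y
    simp only [Fin.sum_univ_four, Pi.add_apply, Pi.smul_apply', add_assoc]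
  have h1 := fun m => S.mdiffAt_smul_E (hf m) m
  have h23 : MDifferentiableAt (𝓡 4) (𝓡 4).tangent
      (fun y => (⟨y, (f 2 • S.E 2 + f 3 • S.E 3) y⟩ : TangentBundle (𝓡 4) M)) x :=
    mdifferentiableAt_add_section (h1 2) (h1 3)
  have h123 : MDifferentiableAt (𝓡 4) (𝓡 4).tangent
      (fun y => (⟨y, (f 1 • S.E 1 + (f 2 • S.E 2 + f 3 • S.E 3)) y⟩ : TangentBundle (𝓡 4) M)) x :=
    mdifferentiableAt_add_section (h1 1) h23
  rw [h0, mlieBracket_add_right (h1 0) h123, mlieBracket_add_right (h1 1) h23,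
    mlieBracket_add_right (h1 2) (h1 3), S.bracket_smul _ (hf 0), S.bracket_smul _ (hf 1),
    S.bracket_smul _ (hf 2), S.bracket_smul _ (hf 3)]
  simp only [S.mlieBracket_E i]
  simp only [Finset.smul_sum, smul_smul, add_smul, Finset.sum_add_distrib, Finset.sum_smul]
  rw [Finset.sum_comm]
  simp only [Fin.sum_univ_four, d]
  abel

lemma g_leviCivita (X Y : ∀ x : M, TangentSpace (𝓡 4) x) (x : M) (l : Fin 4) :
    S.g x (S.leviCivita X Y x) (S.E l x) = S.koszul X Y (S.E l) x / 2 := by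
  unfold leviCivita
  rw [g_sum_E]
  linear_combination (S.koszul X Y (S.E l) x / 2) * minkowskiSign_mul_self l

lemma g_leviCivita_E_E (i j k : Fin 4) (x : M) :
    S.g x (S.leviCivita (S.E i) (S.E j) x) (S.E k x) = S.gam i j k x := by
  rw [g_leviCivita]
  unfold koszul gam
  simp only [g_E_E, mvfderiv_const]
  simp only [g_apply_E, struct]
  simp

lemma leviCivita_E_E (i j : Fin 4) (x : M) :
    S.leviCivita (S.E i) (S.E j) x = ∑ k, (minkowskiSign k * S.gam i j k x) • S.E k x := by
  conv_lhs => rw [← S.sum_comp x (S.leviCivita (S.E i) (S.E j) x)]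
  simp only [comp, g_leviCivita_E_E]

lemma g_sum_sum (x : M) (a b : Fin 4 → ℝ) :
    S.g x (∑ m, a m • S.E m x) (∑ m, b m • S.E m x) = ∑ m, minkowskiSign m * a m * b m := by
  simp only [map_sum (S.g x (∑ m, a m • S.E m x)), map_smul, g_sum_E, smul_eq_mul]
  exact Finset.sum_congr rfl fun m _ => by ring

lemma bracket_sum_left {f : Fin 4 → M → ℝ} {x : M}
    (hf : ∀ m, MDifferentiableAt (𝓡 4) 𝓘(ℝ, ℝ) (f m) x) (i : Fin 4) :
    mlieBracket (𝓡 4) (fun y => ∑ m, f m y • S.E m y) (S.E i) x =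
      ∑ l, (-(S.d i (f l) x + ∑ m, f m x * S.struct i m l x)) • S.E l x := by
  rw [mlieBracket_swap_apply, S.bracket_sum hf]
  simp only [neg_smul, Finset.sum_neg_distrib]

/-- The Leibniz rule in the second argument. In the Koszul expression the derivatives of `f i`
cancel, while the derivative of `f l` along E_i occurs twice. -/
lemma g_leviCivita_sum {f : Fin 4 → M → ℝ} {x : M}
    (hf : ∀ m, MDifferentiableAt (𝓡 4) 𝓘(ℝ, ℝ) (f m) x) (i l : Fin 4) :
    S.g x (S.leviCivita (S.E i) (fun y => ∑ m, f m y • S.E m y) x) (S.E l x) =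
      minkowskiSign l * S.d i (f l) x + ∑ m, f m x * S.gam i m l x := by
  rw [g_leviCivita]
  unfold koszul
  simp only [g_sum_E, g_E_sum, g_E_E, mvfderiv_const, S.bracket_sum hf, S.bracket_sum_left hf]
  rw [mvfderiv_const_mul_real (hf l), mvfderiv_const_mul_real (hf i), S.mlieBracket_E i l, g_sum_sum]
  have h : ∀ m, S.gam i m l x = (minkowskiSign l * S.struct i m l x
      - minkowskiSign m * S.struct i l m x + minkowskiSign i * S.struct l m i x) / 2 := fun m => by
    rw [gam, S.struct_swap l m]; ring
  simp only [h, d, zero_apply, Fin.sum_univ_four]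
  ring

/-- Tensoriality in the first argument: the derivatives of the coefficients coming from the metric
terms cancel those coming from the brackets. -/
lemma g_leviCivita_sum_left {f : Fin 4 → M → ℝ} {x : M}
    (hf : ∀ m, MDifferentiableAt (𝓡 4) 𝓘(ℝ, ℝ) (f m) x) (k l : Fin 4) :
    S.g x (S.leviCivita (fun y => ∑ m, f m y • S.E m y) (S.E k) x) (S.E l x) =
      ∑ m, f m x * S.gam m k l x := by
  rw [g_leviCivita]
  unfold koszul
  simp only [g_sum_E, g_E_E, mvfderiv_const, S.bracket_sum_left hf]
  rw [mvfderiv_const_mul_real (hf l), mvfderiv_const_mul_real (hf k), S.mlieBracket_E k l, g_sum_sum]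
  have h : ∀ m, S.gam m k l x = (-minkowskiSign l * S.struct k m l x
      + minkowskiSign k * S.struct l m k x - minkowskiSign m * S.struct k l m x) / 2 := fun m => by
    rw [gam, S.struct_swap k m, S.struct_swap l m]; ring
  simp only [h, d, zero_apply, Fin.sum_univ_four]
  ring

lemma mdiffAt_gam (i j k : Fin 4) (x : M) : MDifferentiableAt (𝓡 4) 𝓘(ℝ, ℝ) (S.gam i j k) x :=
  (S.contMDiffAt_gam le_rfl (fun i => S.contMDiffAt_E i x) i j k).mdifferentiableAt (by simp)

lemma mdiffAt_struct (i j k : Fin 4) (x : M) :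
    MDifferentiableAt (𝓡 4) 𝓘(ℝ, ℝ) (S.struct i j k) x :=
  (S.contMDiffAt_struct le_rfl (fun i => S.contMDiffAt_E i x) i j k).mdifferentiableAt (by simp)

/-- Cartan's second structure equation. From here on the curvature is a polynomial in the connection
coefficients, the structure functions and first derivatives, ready for the algebraic treatment. -/
lemma riemann_eq (x : M) (i j k l : Fin 4) :
    S.riemann x i j k l = S.d i (S.gam j k l) x - S.d j (S.gam i k l) x
      + ∑ m, minkowskiSign m * (S.gam j k m x * S.gam i m l x - S.gam i k m x * S.gam j m l x)
      - ∑ m, S.struct i j m x * S.gam m k l x := by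
  have hLC : ∀ a b, S.leviCivita (S.E a) (S.E b) =
      fun y => ∑ m, (minkowskiSign m * S.gam a b m y) • S.E m y := fun a b => by
    ext1 y; exact S.leviCivita_E_E a b y
  have hm : ∀ a b m, MDifferentiableAt (𝓡 4) 𝓘(ℝ, ℝ)
      (fun y => minkowskiSign m * S.gam a b m y) x := fun a b m =>
    (mdifferentiableAt_const).mul (S.mdiffAt_gam a b m x)
  unfold riemann curvature
  rw [hLC, hLC, S.mlieBracket_E]
  simp only [map_sub, LinearMap.sub_apply]
  rw [S.g_leviCivita_sum (hm j k), S.g_leviCivita_sum (hm i k),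
    S.g_leviCivita_sum_left (fun m => S.mdiffAt_struct i j m x)]
  simp only [d]
  rw [mvfderiv_const_mul_real (S.mdiffAt_gam j k l x), mvfderiv_const_mul_real (S.mdiffAt_gam i k l x)]
  simp only [mul_sub, Finset.sum_sub_distrib, mul_assoc]
  linear_combination (mvfderiv (𝓡 4) (S.gam j k l) x (S.E i x) -
    mvfderiv (𝓡 4) (S.gam i k l) x (S.E j x)) * minkowskiSign_mul_self l

/-- The Jacobi identity in terms of the structure functions. -/
lemma jacobi (x : M) (i j k l : Fin 4) :
    S.d i (S.struct j k l) x + S.d j (S.struct k i l) x + S.d k (S.struct i j l) x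
      + ∑ m, (S.struct j k m x * S.struct i m l x + S.struct k i m x * S.struct j m l x
        + S.struct i j m x * S.struct k m l x) = 0 := by
  have h2 : (minSmoothness ℝ 2) ≤ (∞ : WithTop ℕ∞) := by
    simp only [minSmoothness_of_isRCLikeNormedField]; norm_cast
  have : IsManifold (𝓡 4) (minSmoothness ℝ 3) M := by
    simp only [minSmoothness_of_isRCLikeNormedField]
    exact IsManifold.of_le (n := ∞) (by norm_cast)
  have hJ := leibniz_identity_mlieBracket_apply ((S.contMDiffAt_E i x).of_le h2)
    ((S.contMDiffAt_E j x).of_le h2) ((S.contMDiffAt_E k x).of_le h2)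
  rw [mlieBracket_swap_apply (V := mlieBracket (𝓡 4) (S.E i) (S.E j))] at hJ
  have hs : ∀ a b c, S.d c (S.struct a b l) x = - S.d c (S.struct b a l) x := fun a b c => by
    have : S.struct a b l = fun y => (-1) * S.struct b a l y := by
      ext y; rw [S.struct_swap]; ring
    rw [this]; simp only [d]; rw [mvfderiv_const_mul_real (S.mdiffAt_struct b a l x)]; simp
  have hJl := congrArg (fun V => S.comp x V l) hJ
  simp only [S.mlieBracket_E i j, S.mlieBracket_E j k, S.mlieBracket_E i k] at hJl
  rw [S.bracket_sum (fun m => S.mdiffAt_struct j k m x),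
    S.bracket_sum (fun m => S.mdiffAt_struct i j m x),
    S.bracket_sum (fun m => S.mdiffAt_struct i k m x), ← Finset.sum_neg_distrib,
    ← Finset.sum_add_distrib] at hJl
  simp only [← neg_smul, ← add_smul] at hJl
  rw [S.comp_sum, S.comp_sum] at hJl
  rw [hs k i]
  have hs2 : ∀ m, S.struct k i m x = -S.struct i k m x := fun m => S.struct_swap k i m x
  simp only [hs2, Finset.sum_add_distrib, neg_mul, Finset.sum_neg_distrib]
  linear_combination hJl

end SpinSpacetime

end

noncomputable section

/-! ### Moving frames over a commutative ring with derivations -/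

namespace DerivationFrame

variable {R : Type*} [CommRing R] [Algebra ℂ R] (δ : Fin 4 → Derivation ℂ R R)

/-- The derivative along the vector with components `v`. -/
def along (v : Fin 4 → R) (f : R) : R := ∑ i, v i * δ i f

/-- The components of the bracket of two vectors, with structure functions `c`. -/
def bracket (c : Fin 4 → Fin 4 → Fin 4 → R) (v w : Fin 4 → R) (k : Fin 4) : R :=
  along δ v (w k) - along δ w (v k) + ∑ i, ∑ j, v i * w j * c i j k

/-- The linear extension of a family of matrices to vectors. -/
def lin (Γ : Fin 4 → Matrix (Fin 2) (Fin 2) R) (v : Fin 4 → R) : Matrix (Fin 2) (Fin 2) R :=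
  ∑ i, v i • Γ i

/-- The curvature of a matrix-valued connection form. -/
def curv (c : Fin 4 → Fin 4 → Fin 4 → R) (Γ : Fin 4 → Matrix (Fin 2) (Fin 2) R) (i j : Fin 4) :
    Matrix (Fin 2) (Fin 2) R :=
  (Γ j).map (δ i) - (Γ i).map (δ j) + Γ i * Γ j - Γ j * Γ i - ∑ k, c i j k • Γ k

lemma along_add (v : Fin 4 → R) (f g : R) : along δ v (f + g) = along δ v f + along δ v g := by
  simp [along, mul_add, Finset.sum_add_distrib]

lemma along_sub (v : Fin 4 → R) (f g : R) : along δ v (f - g) = along δ v f - along δ v g := by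
  simp [along, mul_sub, Finset.sum_sub_distrib]

lemma along_neg (v : Fin 4 → R) (f : R) : along δ v (-f) = -along δ v f := by
  simp [along, Finset.sum_neg_distrib]

lemma along_mul (v : Fin 4 → R) (f g : R) :
    along δ v (f * g) = f * along δ v g + g * along δ v f := by
  simp only [along, Derivation.leibniz, smul_eq_mul, Finset.mul_sum, ← Finset.sum_add_distrib]
  exact Finset.sum_congr rfl fun _ _ => by ring

lemma along_algebraMap (v : Fin 4 → R) (z : ℂ) : along δ v (algebraMap ℂ R z) = 0 := by
  simp [along]

lemma along_sum {ι : Type*} (s : Finset ι) (v : Fin 4 → R) (f : ι → R) :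
    along δ v (∑ i ∈ s, f i) = ∑ i ∈ s, along δ v (f i) := by
  simp only [along, map_sum, Finset.mul_sum]
  exact Finset.sum_comm

lemma along_map_mul (v : Fin 4 → R) (A B : Matrix (Fin 2) (Fin 2) R) :
    (A * B).map (along δ v) = A * B.map (along δ v) + A.map (along δ v) * B := by
  ext a b
  simp only [Matrix.map_apply, Matrix.mul_apply, Matrix.add_apply, along_sum, along_mul,
    Finset.sum_add_distrib]
  congr 1
  exact Finset.sum_congr rfl fun _ _ => mul_comm _ _

lemma along_map_sub (v : Fin 4 → R) (A B : Matrix (Fin 2) (Fin 2) R) :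
    (A - B).map (along δ v) = A.map (along δ v) - B.map (along δ v) := by
  ext a b; simp [along_sub]

variable {δ} {c : Fin 4 → Fin 4 → Fin 4 → R}

/-- The second order terms reduce, by `hc`, to the structure functions; the first order terms are
the derivatives of the components of the two vectors. -/
lemma along_comm (hc : ∀ i j f, δ i (δ j f) - δ j (δ i f) = ∑ k, c i j k * δ k f)
    (v w : Fin 4 → R) (f : R) :
    along δ v (along δ w f) - along δ w (along δ v f) = along δ (bracket δ c v w) f := by
  have h1 : ∀ v w : Fin 4 → R, along δ v (along δ w f) =
      ∑ k, along δ v (w k) * δ k f + ∑ i, ∑ j, v i * w j * δ i (δ j f) := by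
    intro v w
    simp only [along, map_sum, Derivation.leibniz, smul_eq_mul, Finset.mul_sum, Finset.sum_mul]
    rw [Finset.sum_comm, ← Finset.sum_add_distrib]
    simp_rw [mul_add, Finset.sum_add_distrib]
    rw [add_comm]
    congr 1
    · exact Finset.sum_congr rfl fun _ _ => Finset.sum_congr rfl fun _ _ => by ring
    · rw [Finset.sum_comm]
      exact Finset.sum_congr rfl fun _ _ => Finset.sum_congr rfl fun _ _ => by ring
  rw [h1, h1]
  have h2 : ∑ i, ∑ j, w i * v j * δ i (δ j f) = ∑ i, ∑ j, v i * w j * δ j (δ i f) := by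
    rw [Finset.sum_comm]
    exact Finset.sum_congr rfl fun _ _ => Finset.sum_congr rfl fun _ _ => by ring
  have h3 : ∑ i, ∑ j, v i * w j * δ i (δ j f) - ∑ i, ∑ j, v i * w j * δ j (δ i f) =
      ∑ k, (∑ i, ∑ j, v i * w j * c i j k) * δ k f := by
    simp only [← Finset.sum_sub_distrib, ← mul_sub, hc, Finset.mul_sum, Finset.sum_mul]
    symm
    rw [Finset.sum_comm]
    refine Finset.sum_congr rfl fun _ _ => ?_
    rw [Finset.sum_comm]
    exact Finset.sum_congr rfl fun _ _ => Finset.sum_congr rfl fun _ _ => by ring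
  rw [h2]
  have h4 : along δ (bracket δ c v w) f = ∑ k, along δ v (w k) * δ k f -
      ∑ k, along δ w (v k) * δ k f + ∑ k, (∑ i, ∑ j, v i * w j * c i j k) * δ k f := by
    simp only [along, bracket, add_mul, sub_mul, Finset.sum_add_distrib, Finset.sum_sub_distrib]
  rw [h4, ← h3]
  ring

/-- The curvature is tensorial: the derivatives of the components of `v` and `w` on the left are
absorbed by the bracket term. -/
lemma curv_along (Γ : Fin 4 → Matrix (Fin 2) (Fin 2) R) (v w : Fin 4 → R) :
    (lin Γ w).map (along δ v) - (lin Γ v).map (along δ w) + lin Γ v * lin Γ w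
      - lin Γ w * lin Γ v - lin Γ (bracket δ c v w) = ∑ i, ∑ j, (v i * w j) • curv δ c Γ i j := by
  have h1 : ∀ v w : Fin 4 → R, (lin Γ w).map (along δ v) =
      ∑ k, along δ v (w k) • Γ k + ∑ i, ∑ j, (v i * w j) • (Γ j).map (δ i) := by
    intro v w
    ext a b
    simp only [lin, Matrix.map_apply, Matrix.sum_apply, Matrix.smul_apply, smul_eq_mul, along_sum,
      along_mul, Matrix.add_apply, Finset.sum_add_distrib]
    rw [add_comm]
    congr 1
    · exact Finset.sum_congr rfl fun _ _ => mul_comm _ _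
    · rw [Finset.sum_comm]
      refine Finset.sum_congr rfl fun _ _ => ?_
      simp only [along, Finset.mul_sum]
      exact Finset.sum_congr rfl fun _ _ => by ring
  have h2 : ∑ i, ∑ j, (w i * v j) • (Γ j).map (δ i) = ∑ i, ∑ j, (v i * w j) • (Γ i).map (δ j) := by
    rw [Finset.sum_comm]
    exact Finset.sum_congr rfl fun _ _ => Finset.sum_congr rfl fun _ _ => by rw [mul_comm]
  have h3 : ∀ v w : Fin 4 → R, lin Γ v * lin Γ w = ∑ i, ∑ j, (v i * w j) • (Γ i * Γ j) := by
    intro v w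
    simp only [lin, Matrix.sum_mul, Matrix.mul_sum, Matrix.smul_mul, Matrix.mul_smul,
      Finset.smul_sum]
    rw [Finset.sum_comm]
    exact Finset.sum_congr rfl fun _ _ => Finset.sum_congr rfl fun _ _ => by
      rw [smul_smul, mul_comm]
  have h4 : ∑ i, ∑ j, (w i * v j) • (Γ i * Γ j) = ∑ i, ∑ j, (v i * w j) • (Γ j * Γ i) := by
    rw [Finset.sum_comm]
    exact Finset.sum_congr rfl fun _ _ => Finset.sum_congr rfl fun _ _ => by rw [mul_comm]
  have h5 : lin Γ (bracket δ c v w) = ∑ k, along δ v (w k) • Γ k - ∑ k, along δ w (v k) • Γ k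
      + ∑ i, ∑ j, (v i * w j) • ∑ k, c i j k • Γ k := by
    simp only [lin, bracket, add_smul, sub_smul, Finset.sum_add_distrib, Finset.sum_sub_distrib,
      Finset.smul_sum, Finset.sum_smul, smul_smul]
    congr 1
    rw [Finset.sum_comm]
    exact Finset.sum_congr rfl fun _ _ => Finset.sum_comm
  rw [h1 v w, h1 w v, h2, h3, h3, h4, h5]
  simp only [curv, smul_add, smul_sub, Finset.sum_add_distrib, Finset.sum_sub_distrib]
  abel

/-- Gauge covariance of the curvature. -/
lemma curv_gauge (hc : ∀ i j f, δ i (δ j f) - δ j (δ i f) = ∑ k, c i j k * δ k f)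
    (Γ : Fin 4 → Matrix (Fin 2) (Fin 2) R) {g : Matrix (Fin 2) (Fin 2) R}
    {G : (Fin 4 → R) → Matrix (Fin 2) (Fin 2) R}
    (hG : ∀ v, g.map (along δ v) = g * G v - lin Γ v * g) (v w : Fin 4 → R) :
    (∑ i, ∑ j, (v i * w j) • curv δ c Γ i j) * g = g * ((G w).map (along δ v)
      - (G v).map (along δ w) + G v * G w - G w * G v - G (bracket δ c v w)) := by
  have h : ∀ v w, (g.map (along δ w)).map (along δ v) = g * (G w).map (along δ v)
      + (g * G v - lin Γ v * g) * G w - (lin Γ w * (g * G v - lin Γ v * g)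
      + (lin Γ w).map (along δ v) * g) := by
    intro v w
    rw [hG w, along_map_sub, along_map_mul, along_map_mul, hG v]
  -- The commutator of derivatives on the entries of `g`. Substituting the first order equation for
  -- `g` twice turns it into the gauge law for the curvature.
  have h1 : (g.map (along δ w)).map (along δ v) - (g.map (along δ v)).map (along δ w) =
      g.map (along δ (bracket δ c v w)) := by
    ext a b
    exact along_comm hc v w (g a b)
  rw [h, h, hG] at h1
  rw [← curv_along]
  rw [← sub_eq_zero] at h1 ⊢
  rw [← neg_eq_zero, ← h1]
  noncomm_ring

end DerivationFrame

end

/-! ### Torsion-free spin connections in a rotated spin frame. -/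

noncomputable section

namespace DerivationFrame

variable {R : Type*} [CommRing R] [Algebra ℂ R] (δ : Fin 4 → Derivation ℂ R R)

/-- The frame rotated by `g` in the unprimed index: `e_{aA'} = ε_a^A s_{AA'}`, `ε_a^A = g A a`. -/
def rot (s : Fin 4 → Fin 2 → Fin 2 → R) (g : Matrix (Fin 2) (Fin 2) R) (a A' : Fin 2)
    (i : Fin 4) : R :=
  ∑ A, g A a * s i A A'

/-- The connection form in the frame `g` of the spin bundle. -/
def connForm (Γ : Fin 4 → Matrix (Fin 2) (Fin 2) R) (g : Matrix (Fin 2) (Fin 2) R)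
    (v : Fin 4 → R) : Matrix (Fin 2) (Fin 2) R :=
  g.adjugate * (g.map (along δ v) + lin Γ v * g)

variable {δ} {c : Fin 4 → Fin 4 → Fin 4 → R} {s : Fin 4 → Fin 2 → Fin 2 → R}
  {Γ Γb : Fin 4 → Matrix (Fin 2) (Fin 2) R} {g : Matrix (Fin 2) (Fin 2) R}

lemma gauge_spec (hg : g.det = 1) (v : Fin 4 → R) :
    g.map (along δ v) = g * connForm δ Γ g v - lin Γ v * g := by
  rw [connForm, ← Matrix.mul_assoc, Matrix.mul_adjugate, hg, one_smul, Matrix.one_mul,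
    add_sub_cancel_right]

lemma along_one (v : Fin 4 → R) : along δ v 1 = 0 := by
  simpa using along_algebraMap δ v 1

/-- Differentiating det g = 1 shows that the change of frame contributes nothing to the trace. -/
lemma gauge_trace (hg : g.det = 1) (hΓ : ∀ i, Γ i 1 1 = -Γ i 0 0) (v : Fin 4 → R) :
    connForm δ Γ g v 1 1 = -connForm δ Γ g v 0 0 := by
  have hl : lin Γ v 1 1 = -lin Γ v 0 0 := by
    simp [lin, Matrix.sum_apply, hΓ, Finset.sum_neg_distrib]
  rw [Matrix.det_fin_two] at hg
  have h : along δ v (g 0 0 * g 1 1 - g 0 1 * g 1 0) = 0 := by rw [hg, along_one]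
  rw [along_sub, along_mul, along_mul] at h
  simp only [connForm, Matrix.adjugate_fin_two, Matrix.mul_apply, Fin.sum_univ_two, Matrix.add_apply,
    Matrix.map_apply, Matrix.of_apply, Matrix.cons_val_zero, Matrix.cons_val_one,
    Matrix.cons_val', Matrix.empty_val', Matrix.cons_val_fin_one, hl]
  linear_combination h

lemma gauge_linear (a b : R) (v w : Fin 4 → R) :
    connForm δ Γ g (fun i => a * v i + b * w i) = a • connForm δ Γ g v + b • connForm δ Γ g w := by
  have h1 : g.map (along δ fun i => a * v i + b * w i) =
      a • g.map (along δ v) + b • g.map (along δ w) := by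
    ext k l
    simp only [Matrix.map_apply, along, Matrix.add_apply, Matrix.smul_apply, smul_eq_mul, add_mul,
      Finset.sum_add_distrib, Finset.mul_sum, mul_assoc]
  have h2 : lin Γ (fun i => a * v i + b * w i) = a • lin Γ v + b • lin Γ w := by
    simp only [lin, add_smul, Finset.sum_add_distrib, Finset.smul_sum, mul_smul]
  rw [connForm, h1, h2, connForm, connForm]
  simp only [Matrix.add_mul, Matrix.mul_add, Matrix.smul_mul, Matrix.mul_smul, smul_add]
  abel

/-- The commutators of a rotated frame of a torsion-free connection. -/
lemma bracket_rot (hg : g.det = 1) (hs : ∀ v i A A', along δ v (s i A A') = 0)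
    {γ : Fin 4 → Fin 4 → Fin 4 → R} (hcγ : ∀ i j k, c i j k = γ i j k - γ j i k)
    (hγ : ∀ i k B B', ∑ j, s j B B' * γ i j k =
      ∑ C, Γ i C B * s k C B' + ∑ C', Γb i C' B' * s k B C') (a A' b B' : Fin 2) (k : Fin 4) :
    bracket δ c (rot s g a A') (rot s g b B') k =
      ∑ e, connForm δ Γ g (rot s g a A') e b * rot s g e B' k
      + ∑ C', lin Γb (rot s g a A') C' B' * rot s g b C' k
      - ∑ e, connForm δ Γ g (rot s g b B') e a * rot s g e A' k
      - ∑ C', lin Γb (rot s g b B') C' A' * rot s g a C' k := by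
  -- The derivative of the rotated frame splits into the new connection form and a remainder
  -- containing Γ in the old frame; that remainder cancels the matching term of `hcc`.
  have hd : ∀ v b B', along δ v (rot s g b B' k) = ∑ e, connForm δ Γ g v e b * rot s g e B' k
      - ∑ C, (lin Γ v * g) C b * s k C B' := by
    intro v b B'
    have h := gauge_spec (δ := δ) (Γ := Γ) hg v
    have h' := fun C => congrFun (congrFun h C) b
    simp only [Matrix.map_apply, Matrix.sub_apply, Matrix.mul_apply (M := g)] at h'
    simp only [rot, along_sum, along_mul, hs, mul_zero, zero_add, h']
    simp only [Fin.sum_univ_two]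
    ring
  have hcc : ∀ v b B', ∑ i, ∑ j, v i * rot s g b B' j * γ i j k =
      ∑ C, (lin Γ v * g) C b * s k C B' + ∑ C', lin Γb v C' B' * rot s g b C' k := by
    intro v b B'
    have : ∀ i, ∑ j, v i * rot s g b B' j * γ i j k =
        v i * ∑ B, g B b * (∑ C, Γ i C B * s k C B' + ∑ C', Γb i C' B' * s k B C') := by
      intro i
      simp only [← hγ, rot, Finset.mul_sum, Finset.sum_mul]
      rw [Finset.sum_comm]
      exact Finset.sum_congr rfl fun _ _ => Finset.sum_congr rfl fun _ _ => by ring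
    simp only [this]
    simp only [lin, Matrix.mul_apply, Matrix.sum_apply, Matrix.smul_apply, smul_eq_mul, rot]
    simp only [Fin.sum_univ_two, Fin.sum_univ_four]
    ring
  have hsum : ∑ i, ∑ j, rot s g a A' i * rot s g b B' j * c i j k =
      ∑ i, ∑ j, rot s g a A' i * rot s g b B' j * γ i j k
      - ∑ i, ∑ j, rot s g b B' i * rot s g a A' j * γ i j k := by
    rw [Finset.sum_comm (f := fun i j => rot s g b B' i * rot s g a A' j * γ i j k),
      ← Finset.sum_sub_distrib]
    refine Finset.sum_congr rfl fun _ _ => ?_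
    rw [← Finset.sum_sub_distrib]
    exact Finset.sum_congr rfl fun _ _ => by rw [hcγ]; ring
  rw [bracket, hd, hd, hsum, hcc, hcc]
  ring

end DerivationFrame

end

noncomputable section

namespace DerivationFrame

variable {R : Type*} [CommRing R] [Algebra ℂ R] {δ : Fin 4 → Derivation ℂ R R}
  {c : Fin 4 → Fin 4 → Fin 4 → R} {s : Fin 4 → Fin 2 → Fin 2 → R}
  {Γ Γb : Fin 4 → Matrix (Fin 2) (Fin 2) R} {g : Matrix (Fin 2) (Fin 2) R}

/-- The data of a torsion-free spin connection in a rotated frame. -/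
structure IsTorsionFree (δ : Fin 4 → Derivation ℂ R R) (c : Fin 4 → Fin 4 → Fin 4 → R)
    (s : Fin 4 → Fin 2 → Fin 2 → R) (Γ Γb : Fin 4 → Matrix (Fin 2) (Fin 2) R) : Prop where
  comm : ∀ i j f, δ i (δ j f) - δ j (δ i f) = ∑ k, c i j k * δ k f
  along_s : ∀ v i A A', along δ v (s i A A') = 0
  trace : ∀ i, Γ i 1 1 = -Γ i 0 0
  torsion : ∃ γ : Fin 4 → Fin 4 → Fin 4 → R, (∀ i j k, c i j k = γ i j k - γ j i k) ∧
    ∀ i k B B', ∑ j, s j B B' * γ i j k =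
      ∑ C, Γ i C B * s k C B' + ∑ C', Γb i C' B' * s k B C'

/-- An entry of the connection form as a linear map. -/
def gaugeLin (δ : Fin 4 → Derivation ℂ R R) (Γ : Fin 4 → Matrix (Fin 2) (Fin 2) R)
    (g : Matrix (Fin 2) (Fin 2) R) (i j : Fin 2) : (Fin 4 → R) →ₗ[R] R where
  toFun v := connForm δ Γ g v i j
  map_add' v w := by
    have := congrFun (congrFun (gauge_linear (δ := δ) (Γ := Γ) (g := g) 1 1 v w) i) j
    simp only [one_mul, one_smul] at this
    exact this
  map_smul' r v := by
    have := congrFun (congrFun (gauge_linear (δ := δ) (Γ := Γ) (g := g) r 0 v v) i) j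
    simp only [zero_mul, add_zero, zero_smul] at this
    exact this

/-- The derivative of a function as a linear map. -/
def alongLin (δ : Fin 4 → Derivation ℂ R R) (f : R) : (Fin 4 → R) →ₗ[R] R where
  toFun v := along δ v f
  map_add' v w := by simp [along, add_mul, Finset.sum_add_distrib]
  map_smul' r v := by simp [along, Finset.mul_sum, mul_assoc]

lemma gaugeLin_apply (i j : Fin 2) (v : Fin 4 → R) :
    gaugeLin δ Γ g i j v = connForm δ Γ g v i j := rfl

lemma alongLin_apply (f : R) (v : Fin 4 → R) : alongLin δ f v = along δ v f := rfl

/-- The bracket is tested against an arbitrary linear form, since it is needed both for entries of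
the connection form and for derivatives of a function. -/
lemma IsTorsionFree.map_bracket (h : IsTorsionFree δ c s Γ Γb) (hg : g.det = 1)
    (L : (Fin 4 → R) →ₗ[R] R) (a A' b B' : Fin 2) :
    L (bracket δ c (rot s g a A') (rot s g b B')) =
      ∑ e, connForm δ Γ g (rot s g a A') e b * L (rot s g e B')
      + ∑ C', lin Γb (rot s g a A') C' B' * L (rot s g b C')
      - ∑ e, connForm δ Γ g (rot s g b B') e a * L (rot s g e A')
      - ∑ C', lin Γb (rot s g b B') C' A' * L (rot s g a C') := by
  obtain ⟨γ, h1, h2⟩ := h.torsion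
  have : bracket δ c (rot s g a A') (rot s g b B') =
      ∑ e, connForm δ Γ g (rot s g a A') e b • rot s g e B'
      + ∑ C', lin Γb (rot s g a A') C' B' • rot s g b C'
      - ∑ e, connForm δ Γ g (rot s g b B') e a • rot s g e A'
      - ∑ C', lin Γb (rot s g b B') C' A' • rot s g a C' := by
    ext k
    rw [bracket_rot hg h.along_s h1 h2]
    simp
  rw [this]
  simp only [map_sub, map_add, map_sum, map_smul, smul_eq_mul]

/-- The curvature in a rotated frame. -/
def rotCurv (δ : Fin 4 → Derivation ℂ R R) (c : Fin 4 → Fin 4 → Fin 4 → R)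
    (Γ : Fin 4 → Matrix (Fin 2) (Fin 2) R) (g : Matrix (Fin 2) (Fin 2) R) (v w : Fin 4 → R) :
    Matrix (Fin 2) (Fin 2) R :=
  g.adjugate * ((∑ i, ∑ j, (v i * w j) • curv δ c Γ i j) * g)

lemma IsTorsionFree.rotCurv_eq (h : IsTorsionFree δ c s Γ Γb) (hg : g.det = 1)
    (v w : Fin 4 → R) :
    rotCurv δ c Γ g v w = (connForm δ Γ g w).map (along δ v) - (connForm δ Γ g v).map (along δ w)
      + connForm δ Γ g v * connForm δ Γ g w - connForm δ Γ g w * connForm δ Γ g v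
      - connForm δ Γ g (bracket δ c v w) := by
  rw [rotCurv, curv_gauge h.comm Γ (gauge_spec hg), ← Matrix.mul_assoc, Matrix.adjugate_mul, hg,
    one_smul, Matrix.one_mul]

lemma IsTorsionFree.rotCurv_rot (h : IsTorsionFree δ c s Γ Γb) (hg : g.det = 1)
    (a A' b B' i j : Fin 2) :
    rotCurv δ c Γ g (rot s g a A') (rot s g b B') i j =
      along δ (rot s g a A') (connForm δ Γ g (rot s g b B') i j)
      - along δ (rot s g b B') (connForm δ Γ g (rot s g a A') i j)
      + ∑ k, connForm δ Γ g (rot s g a A') i k * connForm δ Γ g (rot s g b B') k j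
      - ∑ k, connForm δ Γ g (rot s g b B') i k * connForm δ Γ g (rot s g a A') k j
      - (∑ e, connForm δ Γ g (rot s g a A') e b * connForm δ Γ g (rot s g e B') i j
      + ∑ C', lin Γb (rot s g a A') C' B' * connForm δ Γ g (rot s g b C') i j
      - ∑ e, connForm δ Γ g (rot s g b B') e a * connForm δ Γ g (rot s g e A') i j
      - ∑ C', lin Γb (rot s g b B') C' A' * connForm δ Γ g (rot s g a C') i j) := by
  have := h.map_bracket hg (gaugeLin δ Γ g i j) a A' b B'
  simp only [gaugeLin_apply] at this
  rw [← this, h.rotCurv_eq hg]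
  simp only [Matrix.sub_apply, Matrix.add_apply, Matrix.map_apply, Matrix.mul_apply]

/-- The bracket `[X_{0'}, X_{1'}]` for a shear-free ray, where `X_{A'} = o^A ∇_{AA'}`. -/
lemma IsTorsionFree.bracket_ray (h : IsTorsionFree δ c s Γ Γb) (hg : g.det = 1)
    (hS : ∀ A', connForm δ Γ g (rot s g 0 A') 1 0 = 0)
    (L : (Fin 4 → R) →ₗ[R] R) :
    L (bracket δ c (rot s g 0 0) (rot s g 0 1)) =
      (-connForm δ Γ g (rot s g 0 1) 0 0 + lin Γb (rot s g 0 0) 0 1 - lin Γb (rot s g 0 1) 0 0) *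
        L (rot s g 0 0) +
      (connForm δ Γ g (rot s g 0 0) 0 0 + lin Γb (rot s g 0 0) 1 1 - lin Γb (rot s g 0 1) 1 0) *
        L (rot s g 0 1) := by
  rw [h.map_bracket hg]
  simp only [Fin.sum_univ_two, hS]
  ring

/-- In the component F(X_{0'}, X_{1'})^0_0 the quadratic terms contain Γ_{0A'}^1_0 = 0. What remains
says that Γ_{0A'}^0_0 is closed along the ray distribution. -/
lemma IsTorsionFree.flat_of_curv (h : IsTorsionFree δ c s Γ Γb) (hg : g.det = 1)
    (hS : ∀ A', connForm δ Γ g (rot s g 0 A') 1 0 = 0)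
    (hF : rotCurv δ c Γ g (rot s g 0 0) (rot s g 0 1) 0 0 = 0) :
    along δ (rot s g 0 0) (connForm δ Γ g (rot s g 0 1) 0 0)
      - along δ (rot s g 0 1) (connForm δ Γ g (rot s g 0 0) 0 0) =
    (-connForm δ Γ g (rot s g 0 1) 0 0 + lin Γb (rot s g 0 0) 0 1 - lin Γb (rot s g 0 1) 0 0) *
        connForm δ Γ g (rot s g 0 0) 0 0 +
      (connForm δ Γ g (rot s g 0 0) 0 0 + lin Γb (rot s g 0 0) 1 1 - lin Γb (rot s g 0 1) 1 0) *
        connForm δ Γ g (rot s g 0 1) 0 0 := by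
  rw [h.rotCurv_rot hg] at hF
  simp only [Fin.sum_univ_two, hS] at hF
  linear_combination hF

/-- In F(X_{0'}, Y_{1'})^1_0 + F(Y_{0'}, X_{1'})^1_0 all derivatives along Y fall on the vanishing
Γ_{0A'}^1_0, so Γ_{1A'}^1_0 is closed along the ray distribution. This is the integrability
condition for log φ. -/
lemma IsTorsionFree.closed_of_curv (h : IsTorsionFree δ c s Γ Γb) (hg : g.det = 1)
    (hS : ∀ A', connForm δ Γ g (rot s g 0 A') 1 0 = 0)
    (hF : rotCurv δ c Γ g (rot s g 0 0) (rot s g 1 1) 1 0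
      + rotCurv δ c Γ g (rot s g 1 0) (rot s g 0 1) 1 0 = 0) :
    along δ (rot s g 0 0) (connForm δ Γ g (rot s g 1 1) 1 0)
      - along δ (rot s g 0 1) (connForm δ Γ g (rot s g 1 0) 1 0) =
    (-connForm δ Γ g (rot s g 0 1) 0 0 + lin Γb (rot s g 0 0) 0 1 - lin Γb (rot s g 0 1) 0 0) *
        connForm δ Γ g (rot s g 1 0) 1 0 +
      (connForm δ Γ g (rot s g 0 0) 0 0 + lin Γb (rot s g 0 0) 1 1 - lin Γb (rot s g 0 1) 1 0) *
        connForm δ Γ g (rot s g 1 1) 1 0 := by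
  have ht := gauge_trace (δ := δ) hg h.trace
  rw [h.rotCurv_rot hg, h.rotCurv_rot hg] at hF
  have h0 : ∀ v, along δ v 0 = 0 := fun v => by simp [along]
  simp only [Fin.sum_univ_two, hS, h0, ht] at hF
  linear_combination hF

/-- The integrability condition for η, with `u` standing for log φ. Commuting X past Y on `u`
produces derivatives of Γ_{1A'}^1_0 along Y, and these are the derivatives that occur in F(Y_{0'},
Y_{1'})^1_0. -/
lemma IsTorsionFree.compat_of_curv (h : IsTorsionFree δ c s Γ Γb) (hg : g.det = 1)
    (hS : ∀ A', connForm δ Γ g (rot s g 0 A') 1 0 = 0)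
    (hF : rotCurv δ c Γ g (rot s g 0 0) (rot s g 0 1) 0 1
      + rotCurv δ c Γ g (rot s g 1 0) (rot s g 1 1) 1 0 = 0) {u : R}
    (hu : ∀ A', along δ (rot s g 0 A') u = -connForm δ Γ g (rot s g 1 A') 1 0) :
    along δ (rot s g 0 0) (along δ (rot s g 1 1) u + connForm δ Γ g (rot s g 0 1) 0 1)
      - along δ (rot s g 0 1) (along δ (rot s g 1 0) u + connForm δ Γ g (rot s g 0 0) 0 1)
      - (-connForm δ Γ g (rot s g 1 1) 1 0 + 2 * connForm δ Γ g (rot s g 0 1) 0 0) *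
        (along δ (rot s g 1 0) u + connForm δ Γ g (rot s g 0 0) 0 1)
      + (-connForm δ Γ g (rot s g 1 0) 1 0 + 2 * connForm δ Γ g (rot s g 0 0) 0 0) *
        (along δ (rot s g 1 1) u + connForm δ Γ g (rot s g 0 1) 0 1) =
    (-connForm δ Γ g (rot s g 0 1) 0 0 + lin Γb (rot s g 0 0) 0 1 - lin Γb (rot s g 0 1) 0 0) *
        (along δ (rot s g 1 0) u + connForm δ Γ g (rot s g 0 0) 0 1) +
      (connForm δ Γ g (rot s g 0 0) 0 0 + lin Γb (rot s g 0 0) 1 1 - lin Γb (rot s g 0 1) 1 0) *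
        (along δ (rot s g 1 1) u + connForm δ Γ g (rot s g 0 1) 0 1) := by
  have ht := gauge_trace (δ := δ) hg h.trace
  rw [h.rotCurv_rot hg, h.rotCurv_rot hg] at hF
  -- The commutators of X_{0'} with Y_{1'} and of X_{1'} with Y_{0'} replace each X Y u by Y X u,
  -- which `hu` expresses through the connection.
  have h01 := along_comm h.comm (rot s g 0 0) (rot s g 1 1) u
  have h10 := along_comm h.comm (rot s g 0 1) (rot s g 1 0) u
  have e01 := h.map_bracket hg (alongLin δ u) 0 0 1 1
  have e10 := h.map_bracket hg (alongLin δ u) 0 1 1 0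
  simp only [alongLin_apply] at e01 e10
  rw [e01] at h01
  rw [e10] at h10
  simp only [Fin.sum_univ_two, hS, hu, along_neg, ht] at hF h01 h10
  simp only [along_add]
  linear_combination h01 - h10 + hF

end DerivationFrame

end

/-! ### The spinor representation of antisymmetric tensors. -/

noncomputable section

lemma sqrt_two_inv_mul_self : ((Real.sqrt 2 : ℝ) : ℂ)⁻¹ * ((Real.sqrt 2 : ℝ) : ℂ)⁻¹ = 1 / 2 := by
  rw [← mul_inv, ← Complex.ofReal_mul, Real.mul_self_sqrt (by norm_num)]
  norm_num

lemma ivdwInv_eq (i : Fin 4) (A A' : Fin 2) : ivdwInv i A A' = ((Real.sqrt 2 : ℝ) : ℂ)⁻¹ *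
    ![!![1, 0; 0, 1], !![0, 1; 1, 0], !![0, -Complex.I; Complex.I, 0], !![1, 0; 0, -1]] i A A' := by
  fin_cases i <;> fin_cases A <;> fin_cases A' <;>
    simp [ivdwInv, ivdw, spinEps, minkowskiSign]

namespace DerivationFrame

variable {R : Type*} [CommRing R] [Algebra ℂ R]

variable (R) in
/-- The symbols `s^i_{AA'}` in a complex algebra. -/
def sInv (i : Fin 4) (A A' : Fin 2) : R := algebraMap ℂ R (ivdwInv i A A')

variable (R) in
/-- The entries of the Minkowski metric in a complex algebra. -/
def eta (i : Fin 4) : R := algebraMap ℂ R (minkowskiSign i)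

/-- The spinor representation of `m_{jk}`. -/
def rep (m : Fin 4 → Fin 4 → R) : Matrix (Fin 2) (Fin 2) R := fun A B =>
  algebraMap ℂ R (1 / 2) *
    ∑ A', ∑ j, ∑ k, eta R k * m j k * algebraMap ℂ R (ivdw k A A') * sInv R j B A'

/-- The conjugate spinor representation of `m_{jk}`. -/
def repBar (m : Fin 4 → Fin 4 → R) : Matrix (Fin 2) (Fin 2) R := fun A' B' =>
  algebraMap ℂ R (1 / 2) *
    ∑ A, ∑ j, ∑ k, eta R k * m j k * algebraMap ℂ R (ivdw k A A') * sInv R j A B'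

lemma two_mul_algebraMap_half : 2 * algebraMap ℂ R (1 / 2) = 1 := by
  rw [← map_ofNat (algebraMap ℂ R) 2, ← map_mul]; norm_num

lemma algebraMap_I_mul_self : algebraMap ℂ R Complex.I * algebraMap ℂ R Complex.I = -1 := by
  rw [← map_mul, Complex.I_mul_I, map_neg, map_one]

lemma algebraMap_sqrt_mul_self : 2 * (algebraMap ℂ R ((Real.sqrt 2 : ℝ) : ℂ)⁻¹ *
    algebraMap ℂ R ((Real.sqrt 2 : ℝ) : ℂ)⁻¹) = 1 := by
  rw [← map_mul, sqrt_two_inv_mul_self, two_mul_algebraMap_half]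

/-- 2 is invertible in a ℂ-algebra. The explicit entries below are stated doubled, which keeps
halves out of the polynomial identities. -/
lemma eq_of_two_mul_eq {x y : R} (h : 2 * x = 2 * y) : x = y := by
  have h2 := two_mul_algebraMap_half (R := R)
  linear_combination (algebraMap ℂ R (1 / 2)) * h - (x - y) * h2

lemma eta_eq (i : Fin 4) : eta R i = ![1, -1, -1, -1] i := by
  fin_cases i <;> simp [eta, minkowskiSign]

lemma eta_mul_self (i : Fin 4) : eta R i * eta R i = 1 := by
  fin_cases i <;> simp [eta_eq]

lemma sInv_eq (i : Fin 4) (A A' : Fin 2) : sInv R i A A' =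
    algebraMap ℂ R ((Real.sqrt 2 : ℝ) : ℂ)⁻¹ *
    ![!![1, 0; 0, 1], !![0, 1; 1, 0],
      !![0, -algebraMap ℂ R Complex.I; algebraMap ℂ R Complex.I, 0], !![1, 0; 0, -1]] i A A' := by
  rw [sInv, ivdwInv_eq, map_mul]
  fin_cases i <;> fin_cases A <;> fin_cases A' <;> simp

lemma algebraMap_ivdw (i : Fin 4) (A A' : Fin 2) : algebraMap ℂ R (ivdw i A A') =
    algebraMap ℂ R ((Real.sqrt 2 : ℝ) : ℂ)⁻¹ *
    ![!![1, 0; 0, 1], !![0, 1; 1, 0],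
      !![0, algebraMap ℂ R Complex.I; -algebraMap ℂ R Complex.I, 0], !![1, 0; 0, -1]] i A A' := by
  rw [ivdw, Matrix.smul_apply, smul_eq_mul, map_mul]
  fin_cases i <;> fin_cases A <;> fin_cases A' <;> simp

/-- Only three complex combinations of the six components survive, one of the two duality halves of
`m`; this exhibits `rep m` as a trace-free matrix. -/
lemma two_mul_rep {m : Fin 4 → Fin 4 → R} (hm : ∀ j k, m j k = -m k j) (A B : Fin 2) :
    2 * rep m A B = !![m 3 0 - algebraMap ℂ R Complex.I * m 1 2,
      m 1 0 - algebraMap ℂ R Complex.I * m 2 3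
        + algebraMap ℂ R Complex.I * (m 2 0 - algebraMap ℂ R Complex.I * m 3 1);
      m 1 0 - algebraMap ℂ R Complex.I * m 2 3
        - algebraMap ℂ R Complex.I * (m 2 0 - algebraMap ℂ R Complex.I * m 3 1),
      -(m 3 0 - algebraMap ℂ R Complex.I * m 1 2)] A B := by
  have hr := algebraMap_sqrt_mul_self (R := R)
  have hh := two_mul_algebraMap_half (R := R)
  have hI := algebraMap_I_mul_self (R := R)
  rw [rep, ← mul_assoc, hh, one_mul]
  simp only [eta_eq, sInv_eq, algebraMap_ivdw]
  generalize algebraMap ℂ R ((Real.sqrt 2 : ℝ) : ℂ)⁻¹ = r at *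
  generalize algebraMap ℂ R Complex.I = I at *
  have h01 := hm 0 1
  have h02 := hm 0 2
  have h03 := hm 0 3
  have h12 := hm 2 1
  have h23 := hm 3 2
  have h31 := hm 1 3
  have d0 : m 0 0 = 0 := eq_of_two_mul_eq (by linear_combination hm 0 0)
  have d1 : m 1 1 = 0 := eq_of_two_mul_eq (by linear_combination hm 1 1)
  have d2 : m 2 2 = 0 := eq_of_two_mul_eq (by linear_combination hm 2 2)
  have d3 : m 3 3 = 0 := eq_of_two_mul_eq (by linear_combination hm 3 3)
  fin_cases A <;> fin_cases B <;>
    simp [Fin.sum_univ_four, Fin.sum_univ_two, h01, h02, h03, h12, h23, h31, d0, d1, d2, d3] <;>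
    grind

/-- The opposite duality half, obtained formally by replacing I with -I in the combinations. -/
lemma two_mul_repBar {m : Fin 4 → Fin 4 → R} (hm : ∀ j k, m j k = -m k j) (A B : Fin 2) :
    2 * repBar m A B = !![m 3 0 + algebraMap ℂ R Complex.I * m 1 2,
      m 1 0 + algebraMap ℂ R Complex.I * m 2 3
        - algebraMap ℂ R Complex.I * (m 2 0 + algebraMap ℂ R Complex.I * m 3 1);
      m 1 0 + algebraMap ℂ R Complex.I * m 2 3
        + algebraMap ℂ R Complex.I * (m 2 0 + algebraMap ℂ R Complex.I * m 3 1),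
      -(m 3 0 + algebraMap ℂ R Complex.I * m 1 2)] A B := by
  have hr := algebraMap_sqrt_mul_self (R := R)
  have hh := two_mul_algebraMap_half (R := R)
  have hI := algebraMap_I_mul_self (R := R)
  rw [repBar, ← mul_assoc, hh, one_mul]
  simp only [eta_eq, sInv_eq, algebraMap_ivdw]
  generalize algebraMap ℂ R ((Real.sqrt 2 : ℝ) : ℂ)⁻¹ = r at *
  generalize algebraMap ℂ R Complex.I = I at *
  have h01 := hm 0 1
  have h02 := hm 0 2
  have h03 := hm 0 3
  have h12 := hm 2 1
  have h23 := hm 3 2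
  have h31 := hm 1 3
  have d0 : m 0 0 = 0 := eq_of_two_mul_eq (by linear_combination hm 0 0)
  have d1 : m 1 1 = 0 := eq_of_two_mul_eq (by linear_combination hm 1 1)
  have d2 : m 2 2 = 0 := eq_of_two_mul_eq (by linear_combination hm 2 2)
  have d3 : m 3 3 = 0 := eq_of_two_mul_eq (by linear_combination hm 3 3)
  fin_cases A <;> fin_cases B <;>
    simp [Fin.sum_univ_four, Fin.sum_univ_two, h01, h02, h03, h12, h23, h31, d0, d1, d2, d3] <;>
    grind

lemma rep_trace {m : Fin 4 → Fin 4 → R} (hm : ∀ j k, m j k = -m k j) :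
    rep m 1 1 = -rep m 0 0 := by
  apply eq_of_two_mul_eq
  have h1 := two_mul_rep hm 1 1
  have h0 := two_mul_rep hm 0 0
  simp at h1 h0
  linear_combination h1 + h0

/-- The symbols `s_j` are parallel. -/
lemma sInv_parallel {m : Fin 4 → Fin 4 → R} (hm : ∀ j k, m j k = -m k j) (k : Fin 4)
    (B B' : Fin 2) : ∑ j, sInv R j B B' * (eta R k * m j k) =
      ∑ C, rep m C B * sInv R k C B' + ∑ C', repBar m C' B' * sInv R k B C' := by
  apply eq_of_two_mul_eq
  have h1 : 2 * (∑ C, rep m C B * sInv R k C B' + ∑ C', repBar m C' B' * sInv R k B C') =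
    ∑ C, (2 * rep m C B) * sInv R k C B' + ∑ C', (2 * repBar m C' B') * sInv R k B C' := by
    simp only [Fin.sum_univ_two]; ring
  have hI := algebraMap_I_mul_self (R := R)
  rw [h1]
  simp only [two_mul_rep hm, two_mul_repBar hm, sInv_eq, eta_eq]
  generalize algebraMap ℂ R ((Real.sqrt 2 : ℝ) : ℂ)⁻¹ = r at *
  generalize algebraMap ℂ R Complex.I = I at *
  have h01 := hm 0 1
  have h02 := hm 0 2
  have h03 := hm 0 3
  have h12 := hm 2 1
  have h23 := hm 3 2
  have h31 := hm 1 3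
  have d0 : m 0 0 = 0 := eq_of_two_mul_eq (by linear_combination hm 0 0)
  have d1 : m 1 1 = 0 := eq_of_two_mul_eq (by linear_combination hm 1 1)
  have d2 : m 2 2 = 0 := eq_of_two_mul_eq (by linear_combination hm 2 2)
  have d3 : m 3 3 = 0 := eq_of_two_mul_eq (by linear_combination hm 3 3)
  fin_cases k <;> fin_cases B <;> fin_cases B' <;>
    simp [Fin.sum_univ_four, Fin.sum_univ_two, h01, h02, h03, h12, h23, h31, d0, d1, d2, d3] <;>
    grind

/-- The commutator of two matrices in the spinor representation. -/
lemma rep_commutator {m n : Fin 4 → Fin 4 → R} (hm : ∀ j k, m j k = -m k j)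
    (hn : ∀ j k, n j k = -n k j) : rep m * rep n - rep n * rep m =
      rep fun j k => ∑ l, eta R l * (n j l * m l k - m j l * n l k) := by
  have hq : ∀ j k, ∑ l, eta R l * (n j l * m l k - m j l * n l k) =
      -∑ l, eta R l * (n k l * m l j - m k l * n l j) := by
    intro j k
    rw [← Finset.sum_neg_distrib]
    refine Finset.sum_congr rfl fun l _ => ?_
    rw [hn j l, hm l k, hm j l, hn l k]
    ring
  ext A B
  apply eq_of_two_mul_eq
  apply eq_of_two_mul_eq
  rw [two_mul_rep hq]
  have h1 : 2 * (2 * (rep m * rep n - rep n * rep m) A B) =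
      ∑ C, (2 * rep m A C) * (2 * rep n C B) - ∑ C, (2 * rep n A C) * (2 * rep m C B) := by
    simp only [Matrix.sub_apply, Matrix.mul_apply, Fin.sum_univ_two]; ring
  rw [h1]
  have hI := algebraMap_I_mul_self (R := R)
  simp only [two_mul_rep hm, two_mul_rep hn, eta_eq]
  generalize algebraMap ℂ R Complex.I = I at *
  have h01 := hm 0 1
  have h02 := hm 0 2
  have h03 := hm 0 3
  have h12 := hm 2 1
  have h23 := hm 3 2
  have h31 := hm 1 3
  have d0 : m 0 0 = 0 := eq_of_two_mul_eq (by linear_combination hm 0 0)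
  have d1 : m 1 1 = 0 := eq_of_two_mul_eq (by linear_combination hm 1 1)
  have d2 : m 2 2 = 0 := eq_of_two_mul_eq (by linear_combination hm 2 2)
  have d3 : m 3 3 = 0 := eq_of_two_mul_eq (by linear_combination hm 3 3)
  have k01 := hn 0 1
  have k02 := hn 0 2
  have k03 := hn 0 3
  have k12 := hn 2 1
  have k23 := hn 3 2
  have k31 := hn 1 3
  have e0 : n 0 0 = 0 := eq_of_two_mul_eq (by linear_combination hn 0 0)
  have e1 : n 1 1 = 0 := eq_of_two_mul_eq (by linear_combination hn 1 1)
  have e2 : n 2 2 = 0 := eq_of_two_mul_eq (by linear_combination hn 2 2)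
  have e3 : n 3 3 = 0 := eq_of_two_mul_eq (by linear_combination hn 3 3)
  fin_cases A <;> fin_cases B <;>
    simp [Fin.sum_univ_four, Fin.sum_univ_two, h01, h02, h03, h12, h23, h31, d0, d1, d2, d3,
      k01, k02, k03, k12, k23, k31, e0, e1, e2, e3] <;>
    grind

end DerivationFrame

end

/-! ### Curvature symmetries and the curvature spinor. -/

noncomputable section

namespace DerivationFrame

variable {R : Type*} [CommRing R] [Algebra ℂ R]

lemma rep_add (m n : Fin 4 → Fin 4 → R) : rep (fun j k => m j k + n j k) = rep m + rep n := by
  ext A B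
  simp only [rep, Matrix.add_apply, mul_add, add_mul, Finset.sum_add_distrib]

lemma rep_sub (m n : Fin 4 → Fin 4 → R) : rep (fun j k => m j k - n j k) = rep m - rep n := by
  ext A B
  simp only [rep, Matrix.sub_apply, mul_sub, sub_mul, Finset.sum_sub_distrib]

lemma rep_smul (a : R) (m : Fin 4 → Fin 4 → R) : rep (fun j k => a * m j k) = a • rep m := by
  ext A B
  simp only [rep, Matrix.smul_apply, smul_eq_mul, Finset.mul_sum]
  refine Finset.sum_congr rfl fun _ _ => Finset.sum_congr rfl fun _ _ =>
    Finset.sum_congr rfl fun _ _ => by ring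

lemma rep_sum {ι : Type*} (t : Finset ι) (a : ι → R) (m : ι → Fin 4 → Fin 4 → R) :
    rep (fun j k => ∑ l ∈ t, a l * m l j k) = ∑ l ∈ t, a l • rep (m l) := by
  classical
  induction t using Finset.induction_on with
  | empty => ext A B; simp [rep]
  | insert x t hx ih =>
    simp only [Finset.sum_insert hx]
    rw [rep_add, rep_smul, ih]

lemma rep_map (d : Derivation ℂ R R) (m : Fin 4 → Fin 4 → R) :
    (rep m).map d = rep fun j k => d (m j k) := by
  ext A B
  simp only [rep, Matrix.map_apply, eta, sInv, Derivation.leibniz, map_sum, smul_eq_mul,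
    Derivation.map_algebraMap, mul_zero, add_zero, zero_add]
  congr 1
  refine Finset.sum_congr rfl fun _ _ => Finset.sum_congr rfl fun _ _ =>
    Finset.sum_congr rfl fun _ _ => by ring

variable (δ : Fin 4 → Derivation ℂ R R) (c γ : Fin 4 → Fin 4 → Fin 4 → R)

/-- The Riemann tensor of the connection coefficients `γ_{ijk}`. -/
def riem (i j k l : Fin 4) : R :=
  δ i (γ j k l) - δ j (γ i k l) + ∑ m, eta R m * (γ j k m * γ i m l - γ i k m * γ j m l)
    - ∑ m, c i j m * γ m k l

variable {δ c γ}

/-- `rep` is linear over functions, commutes with derivations and carries the quadratic part of the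
Riemann tensor to matrix commutators, so the curvature of the spin connection is the spinor image of
the Riemann tensor. -/
lemma curv_rep (hγ : ∀ i j k, γ i j k = -γ i k j) (i j : Fin 4) :
    curv δ c (fun i => rep (γ i)) i j = rep (riem δ c γ i j) := by
  have h : riem δ c γ i j = fun k l => (fun k l => (fun k l => (fun k l => δ i (γ j k l)) k l -
      (fun k l => δ j (γ i k l)) k l) k l +
      (fun k l => ∑ m, eta R m * (γ j k m * γ i m l - γ i k m * γ j m l)) k l) k l -
      (fun k l => ∑ m, c i j m * γ m k l) k l := rfl
  rw [h, rep_sub, rep_add, rep_sub, rep_sum _ (fun m => c i j m) γ, ← rep_commutator (hγ i) (hγ j), ← rep_map, ← rep_map,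
    curv]
  abel

lemma riem_swap_left (hc : ∀ i j k, c i j k = eta R k * (γ i j k - γ j i k)) (i j k l : Fin 4) :
    riem δ c γ i j k l = -riem δ c γ j i k l := by
  have h : ∀ m, c i j m = -c j i m := fun m => by rw [hc, hc]; ring
  simp only [riem, h, neg_mul, Finset.sum_neg_distrib, mul_sub, Finset.sum_sub_distrib]
  ring

lemma riem_swap_right (hγ : ∀ i j k, γ i j k = -γ i k j) (i j k l : Fin 4) :
    riem δ c γ i j k l = -riem δ c γ i j l k := by
  have h1 : ∑ m, eta R m * (γ j k m * γ i m l - γ i k m * γ j m l) =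
      -∑ m, eta R m * (γ j l m * γ i m k - γ i l m * γ j m k) := by
    rw [← Finset.sum_neg_distrib]
    refine Finset.sum_congr rfl fun m _ => ?_
    rw [hγ j k m, hγ i m l, hγ i k m, hγ j m l]
    ring
  have h2 : ∑ m, c i j m * γ m k l = -∑ m, c i j m * γ m l k := by
    rw [← Finset.sum_neg_distrib]
    exact Finset.sum_congr rfl fun m _ => by rw [hγ m k l]; ring
  rw [riem, h1, h2, hγ j k l, hγ i k l, riem]
  simp only [map_neg]
  ring

/-- The first Bianchi identity is the Jacobi identity of the frame, once the structure functions are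
replaced by antisymmetrized connection coefficients (no torsion). -/
lemma riem_bianchi (hc : ∀ i j k, c i j k = eta R k * (γ i j k - γ j i k))
    (hJ : ∀ i j k l, δ i (c j k l) + δ j (c k i l) + δ k (c i j l)
      + ∑ m, (c j k m * c i m l + c k i m * c j m l + c i j m * c k m l) = 0) (i j k l : Fin 4) :
    riem δ c γ i j k l + riem δ c γ j k i l + riem δ c γ k i j l = 0 := by
  have hd : ∀ a i j, δ a (c i j l) = eta R l * (δ a (γ i j l) - δ a (γ j i l)) := by
    intro a i j
    rw [hc, Derivation.leibniz, eta, Derivation.map_algebraMap]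
    simp
  have h := hJ i j k l
  simp only [hd] at h
  have hl := eta_mul_self (R := R) l
  have hs : ∑ m, (c j k m * c i m l + c k i m * c j m l + c i j m * c k m l) =
      eta R l * (∑ m, eta R m * (γ j k m * γ i m l - γ i k m * γ j m l)
      + ∑ m, eta R m * (γ k i m * γ j m l - γ j i m * γ k m l)
      + ∑ m, eta R m * (γ i j m * γ k m l - γ k j m * γ i m l)
      - ∑ m, c i j m * γ m k l - ∑ m, c j k m * γ m i l - ∑ m, c k i m * γ m j l) := by
    simp only [← Finset.sum_add_distrib, ← Finset.sum_sub_distrib, Finset.mul_sum]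
    refine Finset.sum_congr rfl fun m _ => ?_
    simp only [hc]
    ring
  rw [hs] at h
  simp only [riem]
  linear_combination eta R l * h - (δ i (γ j k l) - δ i (γ k j l) + (δ j (γ k i l) - δ j (γ i k l))
    + (δ k (γ i j l) - δ k (γ j i l))
    + (∑ m, eta R m * (γ j k m * γ i m l - γ i k m * γ j m l)
      + ∑ m, eta R m * (γ k i m * γ j m l - γ j i m * γ k m l)
      + ∑ m, eta R m * (γ i j m * γ k m l - γ k j m * γ i m l)
      - ∑ m, c i j m * γ m k l - ∑ m, c j k m * γ m i l - ∑ m, c k i m * γ m j l)) * hl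

/-- The classical argument: the cyclic identity at the four rotations of (i, j, k, l), combined with
the two antisymmetries. Halving is allowed because R is a ℂ-algebra. -/
lemma pair_symm_of_bianchi {Q : Fin 4 → Fin 4 → Fin 4 → Fin 4 → R}
    (h1 : ∀ i j k l, Q i j k l = -Q j i k l) (h2 : ∀ i j k l, Q i j k l = -Q i j l k)
    (h3 : ∀ i j k l, Q i j k l + Q j k i l + Q k i j l = 0) (i j k l : Fin 4) :
    Q i j k l = Q k l i j := by
  apply eq_of_two_mul_eq
  have a1 := h3 i j k l
  have a2 := h3 j k l i
  have a3 := h3 k l i j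
  have a4 := h3 l i j k
  have b1 := h2 j k i l
  have b2 := h2 k i j l
  have b3 := h2 k l j i
  have b4 := h2 l j k i
  have b5 := h2 l i k j
  have b6 := h2 i k l j
  have b7 := h2 i j l k
  have b8 := h2 j l i k
  have e1 := h1 i k j l
  have e2 := h1 k i j l
  have e3 := h1 l j i k
  have e4 := h1 l j k i
  have e5 := h1 i k l j
  grind

/-- `s_{[i}^{AA'} s_{j]}^{BB'} ε_{A'B'}`. -/
def biv (A B : Fin 2) (i j : Fin 4) : R :=
  sInv R i A 0 * sInv R j B 1 - sInv R i A 1 * sInv R j B 0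

/-- The curvature spinor of a Riemann tensor, up to a factor. -/
def spinorOf (Q : Fin 4 → Fin 4 → Fin 4 → Fin 4 → R) (A B C D : Fin 2) : R :=
  ∑ i, ∑ j, ∑ k, ∑ l, biv A B i j * biv C D k l * Q i j k l

/-- Lowering the upper index of the spin matrix turns it into a contraction with a bivector symbol.
This identifies the matrix indices of the spin curvature with the last two indices of the curvature
spinor. -/
lemma two_mul_rep_lower {m : Fin 4 → Fin 4 → R} (hm : ∀ j k, m j k = -m k j) (C D : Fin 2) :
    2 * ![-rep m 1 D, rep m 0 D] C = ∑ i, ∑ j, biv C D i j * m i j := by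
  have h1 : 2 * ![-rep m 1 D, rep m 0 D] C = ![-(2 * rep m 1 D), 2 * rep m 0 D] C := by
    fin_cases C <;> simp
  rw [h1]
  simp only [two_mul_rep hm, biv, sInv_eq]
  have hr := algebraMap_sqrt_mul_self (R := R)
  have hI := algebraMap_I_mul_self (R := R)
  generalize algebraMap ℂ R ((Real.sqrt 2 : ℝ) : ℂ)⁻¹ = r at *
  generalize algebraMap ℂ R Complex.I = I at *
  have h01 := hm 0 1
  have h02 := hm 0 2
  have h03 := hm 0 3
  have h12 := hm 2 1
  have h23 := hm 3 2
  have h31 := hm 1 3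
  have d0 : m 0 0 = 0 := eq_of_two_mul_eq (by linear_combination hm 0 0)
  have d1 : m 1 1 = 0 := eq_of_two_mul_eq (by linear_combination hm 1 1)
  have d2 : m 2 2 = 0 := eq_of_two_mul_eq (by linear_combination hm 2 2)
  have d3 : m 3 3 = 0 := eq_of_two_mul_eq (by linear_combination hm 3 3)
  fin_cases C <;> fin_cases D <;>
    simp [Fin.sum_univ_four, h01, h02, h03, h12, h23, h31, d0, d1, d2, d3] <;>
    grind

lemma spinorOf_pair {Q : Fin 4 → Fin 4 → Fin 4 → Fin 4 → R}
    (h : ∀ i j k l, Q i j k l = Q k l i j) (A B C D : Fin 2) :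
    spinorOf Q A B C D = spinorOf Q C D A B := by
  have h1 : ∀ i j, ∑ k, ∑ l, biv A B i j * biv C D k l * Q i j k l =
      ∑ k, ∑ l, biv C D k l * biv A B i j * Q k l i j := fun i j =>
    Finset.sum_congr rfl fun k _ => Finset.sum_congr rfl fun l _ => by rw [h i j k l]; ring
  simp only [spinorOf, h1]
  calc _ = ∑ i, ∑ k, ∑ j, ∑ l, biv C D k l * biv A B i j * Q k l i j :=
        Finset.sum_congr rfl fun _ _ => Finset.sum_comm
    _ = ∑ k, ∑ i, ∑ j, ∑ l, biv C D k l * biv A B i j * Q k l i j := Finset.sum_comm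
    _ = ∑ k, ∑ i, ∑ l, ∑ j, biv C D k l * biv A B i j * Q k l i j :=
        Finset.sum_congr rfl fun _ _ => Finset.sum_congr rfl fun _ _ => Finset.sum_comm
    _ = _ := Finset.sum_congr rfl fun _ _ => Finset.sum_comm

lemma spinorOf_swap {Q : Fin 4 → Fin 4 → Fin 4 → Fin 4 → R}
    (h : ∀ i j k l, Q i j k l = -Q j i k l) (A B C D : Fin 2) :
    spinorOf Q A B C D = spinorOf Q B A C D := by
  rw [spinorOf, Finset.sum_comm, spinorOf]
  refine Finset.sum_congr rfl fun i _ => Finset.sum_congr rfl fun j _ =>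
    Finset.sum_congr rfl fun k _ => Finset.sum_congr rfl fun l _ => ?_
  rw [h j i k l, biv, biv]
  simp only [biv]
  ring

/-- The components of a spinor with four indices in the dyad `g`. -/
def dyadComp (g : Matrix (Fin 2) (Fin 2) R) (T : Fin 2 → Fin 2 → Fin 2 → Fin 2 → R)
    (a b c d : Fin 2) : R :=
  ∑ A, ∑ B, ∑ C, ∑ D, g A a * g B b * g C c * g D d * T A B C D

/-- Symmetrizing in the unprimed indices a, b while the primed slots are 0', 1' amounts to
contracting with ε^{A'B'}. It isolates X_{ABCD} and removes the part of the curvature carrying the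
trace-free Ricci tensor. -/
lemma rotCurv_add_swap {Γ : Fin 4 → Matrix (Fin 2) (Fin 2) R} {g : Matrix (Fin 2) (Fin 2) R}
    {Q : Fin 4 → Fin 4 → Fin 4 → Fin 4 → R} (h1 : ∀ i j k l, Q i j k l = -Q j i k l)
    (h2 : ∀ i j k l, Q i j k l = -Q i j l k) (hK : ∀ i j, curv δ c Γ i j = rep (Q i j))
    (a b e d : Fin 2) :
    2 * ![-(rotCurv δ c Γ g (rot (sInv R) g a 0) (rot (sInv R) g b 1)
      + rotCurv δ c Γ g (rot (sInv R) g b 0) (rot (sInv R) g a 1)) 1 d,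
      (rotCurv δ c Γ g (rot (sInv R) g a 0) (rot (sInv R) g b 1)
      + rotCurv δ c Γ g (rot (sInv R) g b 0) (rot (sInv R) g a 1)) 0 d] e =
      dyadComp g (spinorOf Q) a b e d := by
  have hW : ∑ i, ∑ j, (rot (sInv R) g a 0 i * rot (sInv R) g b 1 j) • curv δ c Γ i j
      + ∑ i, ∑ j, (rot (sInv R) g b 0 i * rot (sInv R) g a 1 j) • curv δ c Γ i j =
      ∑ A, ∑ B, (g A a * g B b) • ∑ i, ∑ j, (biv A B i j : R) • rep (Q i j) := by
    -- Antisymmetry in the two form indices turns the exchange of a and b into an exchange of the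
    -- primed indices with a sign.
    have hs : ∑ i, ∑ j, (rot (sInv R) g b 0 i * rot (sInv R) g a 1 j) • curv δ c Γ i j =
        ∑ i, ∑ j, (-(rot (sInv R) g a 1 i * rot (sInv R) g b 0 j)) • curv δ c Γ i j := by
      rw [Finset.sum_comm]
      refine Finset.sum_congr rfl fun i _ => Finset.sum_congr rfl fun j _ => ?_
      rw [hK, hK, show Q j i = fun k l => (-1) * Q i j k l by
        ext k l; rw [h1]; ring, rep_smul, smul_smul]
      congr 1
      ring
    rw [hs]
    simp only [hK, Finset.smul_sum, smul_smul]
    simp only [← Finset.sum_add_distrib, ← add_smul]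
    have : ∀ i j, ∑ A, ∑ B, (g A a * g B b * biv A B i j) • rep (Q i j) =
        (rot (sInv R) g a 0 i * rot (sInv R) g b 1 j
          + -(rot (sInv R) g a 1 i * rot (sInv R) g b 0 j)) • rep (Q i j) := by
      intro i j
      simp only [← Finset.sum_smul]
      congr 1
      simp only [rot, biv, Fin.sum_univ_two]
      ring
    simp only [← this]
    symm
    calc _ = ∑ A, ∑ i, ∑ B, ∑ j, (g A a * g B b * biv A B i j) • rep (Q i j) :=
          Finset.sum_congr rfl fun _ _ => Finset.sum_comm
      _ = ∑ i, ∑ A, ∑ B, ∑ j, (g A a * g B b * biv A B i j) • rep (Q i j) := Finset.sum_comm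
      _ = ∑ i, ∑ A, ∑ j, ∑ B, (g A a * g B b * biv A B i j) • rep (Q i j) :=
          Finset.sum_congr rfl fun _ _ => Finset.sum_congr rfl fun _ _ => Finset.sum_comm
      _ = _ := Finset.sum_congr rfl fun _ _ => Finset.sum_comm
  have hT : ∀ A B C D, 2 * ![-(∑ i, ∑ j, (biv A B i j : R) • rep (Q i j)) 1 D,
      (∑ i, ∑ j, (biv A B i j : R) • rep (Q i j)) 0 D] C = spinorOf Q A B C D := by
    intro A B C D
    have : ∀ i j, ∑ k, ∑ l, biv A B i j * biv C D k l * Q i j k l =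
        biv A B i j * (2 * ![-rep (Q i j) 1 D, rep (Q i j) 0 D] C) := fun i j => by
      rw [two_mul_rep_lower (h2 i j)]
      simp only [Finset.mul_sum, mul_assoc]
    simp only [spinorOf, this]
    fin_cases C <;>
      simp only [Matrix.sum_apply, Matrix.smul_apply, smul_eq_mul, Finset.mul_sum, mul_left_comm,
        Fin.zero_eta, Fin.mk_one, Matrix.cons_val_zero, Matrix.cons_val_one, mul_neg,
        Finset.sum_neg_distrib]
  rw [rotCurv, rotCurv, ← Matrix.mul_add, ← Matrix.add_mul, hW]
  simp only [dyadComp, ← hT]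
  obtain ⟨W, hWd⟩ : ∃ W : Fin 2 → Fin 2 → Matrix (Fin 2) (Fin 2) R,
      W = fun A B => ∑ i, ∑ j, (biv A B i j : R) • rep (Q i j) := ⟨_, rfl⟩
  have hWd' : ∀ A B, ∑ i, ∑ j, (biv A B i j : R) • rep (Q i j) = W A B := fun A B => by rw [hWd]
  simp only [hWd', Matrix.adjugate_fin_two]
  fin_cases e <;> simp [Fin.sum_univ_two, Matrix.mul_apply] <;> ring

end DerivationFrame

end

/-! ### The repeated principal spinor condition as vanishing of curvature components. -/

noncomputable section

lemma sum_perm_fin_four (f : Fin 4 → Fin 4 → Fin 4 → Fin 4 → ℂ) :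
    ∑ σ : Equiv.Perm (Fin 4), f (σ 0) (σ 1) (σ 2) (σ 3) =
      (((f 0 1 2 3 + f 0 1 3 2) + (f 0 2 1 3 + f 0 2 3 1) + (f 0 3 2 1 + f 0 3 1 2)) + ((f 1 0 2
      3 + f 1 0 3 2) + (f 1 2 0 3 + f 1 2 3 0) + (f 1 3 2 0 + f 1 3 0 2)) + ((f 2 1 0 3 + f 2 1
      3 0) + (f 2 0 1 3 + f 2 0 3 1) + (f 2 3 0 1 + f 2 3 1 0)) + ((f 3 1 2 0 + f 3 1 0 2) + (f
      3 2 1 0 + f 3 2 0 1) + (f 3 0 2 1 + f 3 0 1 2))) := by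
  rw [← Equiv.sum_comp Equiv.Perm.decomposeFin.symm, Fintype.sum_prod_type]
  simp only [Fin.sum_univ_four]
  simp only [← Equiv.sum_comp (Equiv.Perm.decomposeFin (n := 2)).symm, Fintype.sum_prod_type,
    Fin.sum_univ_three]
  simp only [← Equiv.sum_comp (Equiv.Perm.decomposeFin (n := 1)).symm, Fintype.sum_prod_type,
    Fin.sum_univ_two, Fintype.sum_unique]
  rfl

/-- The two symmetries generate a group of order eight, so the 24 permutations give only three
distinct values, one for each splitting of the four indices into pairs. -/
lemma symm4_of_symm {T : Fin 2 → Fin 2 → Fin 2 → Fin 2 → ℂ}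
    (h1 : ∀ A B C D, T A B C D = T B A C D) (h2 : ∀ A B C D, T A B C D = T C D A B)
    (A B C D : Fin 2) : symm4 T A B C D = (T A B C D + T A C B D + T A D B C) / 3 := by
  have h3 : ∀ A B C D, T A B C D = T A B D C := fun A B C D => by
    rw [h2, h1, h2]
  rw [symm4]
  have : (∑ σ : Equiv.Perm (Fin 4),
    T (![A, B, C, D] (σ 0)) (![A, B, C, D] (σ 1)) (![A, B, C, D] (σ 2)) (![A, B, C, D] (σ 3))) =
    8 * (T A B C D + T A C B D + T A D B C) := by
    rw [sum_perm_fin_four fun i j k l =>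
      T (![A, B, C, D] i) (![A, B, C, D] j) (![A, B, C, D] k) (![A, B, C, D] l)]
    simp only [Matrix.cons_val]
    have g1 : ∀ a b c d, T a b c d = T b a c d ∧ T a b c d = T a b d c := fun a b c d => ⟨h1 _ _ _ _, h3 _ _ _ _⟩
    grind
  rw [this]; ring

/-- Contracted with one and the same spinor in three slots, the three values agree after renaming.
Hence Ψ may be replaced by X in the repeated principal condition, and the scalar curvature does not
intervene. -/
lemma symm4_contract {T : Fin 2 → Fin 2 → Fin 2 → Fin 2 → ℂ}
    (h1 : ∀ A B C D, T A B C D = T B A C D) (h2 : ∀ A B C D, T A B C D = T C D A B)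
    (o : Fin 2 → ℂ) (A : Fin 2) :
    ∑ B, ∑ C, ∑ P, symm4 T A B C P * o B * o C * o P =
      ∑ B, ∑ C, ∑ P, T A B C P * o B * o C * o P := by
  simp only [symm4_of_symm h1 h2]
  simp only [Fin.sum_univ_two]
  ring

namespace DerivationFrame

variable {R : Type*} [CommRing R] [Algebra ℂ R] {δ : Fin 4 → Derivation ℂ R R}
  {c γ : Fin 4 → Fin 4 → Fin 4 → R} {g : Matrix (Fin 2) (Fin 2) R}

/-- A metric connection without torsion in an orthonormal frame. -/
structure IsLeviCivita (δ : Fin 4 → Derivation ℂ R R) (c γ : Fin 4 → Fin 4 → Fin 4 → R) :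
    Prop where
  comm : ∀ i j f, δ i (δ j f) - δ j (δ i f) = ∑ k, c i j k * δ k f
  antisymm : ∀ i j k, γ i j k = -γ i k j
  struct_eq : ∀ i j k, c i j k = eta R k * (γ i j k - γ j i k)
  jacobi : ∀ i j k l, δ i (c j k l) + δ j (c k i l) + δ k (c i j l)
      + ∑ m, (c j k m * c i m l + c k i m * c j m l + c i j m * c k m l) = 0

lemma IsLeviCivita.isTorsionFree (h : IsLeviCivita δ c γ) :
    IsTorsionFree δ c (sInv R) (fun i => rep (γ i)) (fun i => repBar (γ i)) where
  comm := h.comm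
  along_s v i A A' := along_algebraMap δ v _
  trace i := rep_trace (h.antisymm i)
  torsion := ⟨fun i j k => eta R k * γ i j k, fun i j k => by rw [h.struct_eq]; ring,
    fun i k B B' => sInv_parallel (h.antisymm i) k B B'⟩

lemma IsLeviCivita.riem_pair (h : IsLeviCivita δ c γ) (i j k l : Fin 4) :
    riem δ c γ i j k l = riem δ c γ k l i j :=
  pair_symm_of_bianchi (riem_swap_left h.struct_eq) (riem_swap_right h.antisymm)
    (riem_bianchi h.struct_eq h.jacobi) i j k l

/-- In dyad components, up to constants, the three expressions are X_{0010}, X_{0100} and X_{0011} -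
X_{1100}. The first two contain three o's and vanish by `hrep`; the third vanishes by pair symmetry
alone. -/
lemma IsLeviCivita.rotCurv_of_principal (h : IsLeviCivita δ c γ)
    (hrep : ∀ A, ∑ B, ∑ C, ∑ D, spinorOf (riem δ c γ) A B C D * g B 0 * g C 0 * g D 0 = 0) :
    rotCurv δ c (fun i => rep (γ i)) g (rot (sInv R) g 0 0) (rot (sInv R) g 0 1) 0 0 = 0 ∧
    rotCurv δ c (fun i => rep (γ i)) g (rot (sInv R) g 0 0) (rot (sInv R) g 1 1) 1 0
      + rotCurv δ c (fun i => rep (γ i)) g (rot (sInv R) g 1 0) (rot (sInv R) g 0 1) 1 0 = 0 ∧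
    rotCurv δ c (fun i => rep (γ i)) g (rot (sInv R) g 0 0) (rot (sInv R) g 0 1) 0 1
      + rotCurv δ c (fun i => rep (γ i)) g (rot (sInv R) g 1 0) (rot (sInv R) g 1 1) 1 0 = 0 := by
  have hm := rotCurv_add_swap (δ := δ) (g := g) (riem_swap_left h.struct_eq) (riem_swap_right h.antisymm)
    (curv_rep h.antisymm)
  have hp := spinorOf_pair h.riem_pair
  have hs := spinorOf_swap (Q := riem δ c γ) (riem_swap_left h.struct_eq)
  have e1 := hm 0 0 1 0
  have e2 := hm 0 1 0 0
  have e3 := hm 0 0 1 1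
  have e4 := hm 1 1 0 0
  have hpa : ∀ a b e d, dyadComp g (spinorOf (riem δ c γ)) a b e d =
      dyadComp g (spinorOf (riem δ c γ)) e d a b := by
    intro a b e d
    simp only [dyadComp, Fin.sum_univ_two, hp 0 0 0 1, hp 0 0 1 0, hp 0 0 1 1, hp 0 1 1 0,
      hp 0 1 1 1, hp 1 0 1 1]
    ring
  have hsa : ∀ a b e d, dyadComp g (spinorOf (riem δ c γ)) a b e d =
      dyadComp g (spinorOf (riem δ c γ)) b a e d := by
    intro a b e d
    simp only [dyadComp, Fin.sum_univ_two, hs 0 1]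
    ring
  have h0 : dyadComp g (spinorOf (riem δ c γ)) 1 0 0 0 = 0 := by
    have : dyadComp g (spinorOf (riem δ c γ)) 1 0 0 0 =
        ∑ A, g A 1 * ∑ B, ∑ C, ∑ D, spinorOf (riem δ c γ) A B C D * g B 0 * g C 0 * g D 0 := by
      simp only [dyadComp, Fin.sum_univ_two]
      ring
    rw [this]
    exact Finset.sum_eq_zero fun A _ => by rw [hrep, mul_zero]
  rw [hpa, h0] at e1
  rw [hsa, h0] at e2
  rw [hpa] at e3
  simp only [Matrix.cons_val_zero, Matrix.cons_val_one, Matrix.add_apply] at e1 e2 e3 e4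
  refine ⟨?_, ?_, ?_⟩
  · apply eq_of_two_mul_eq; apply eq_of_two_mul_eq
    linear_combination e1
  · apply eq_of_two_mul_eq
    linear_combination -e2
  · apply eq_of_two_mul_eq; apply eq_of_two_mul_eq
    linear_combination e3 - e4

end DerivationFrame

end

/-! ### The algebra of functions smooth on an open set, with the frame derivations. -/

noncomputable section

open Filter Topology VectorField DerivationFrame

namespace SpinSpacetime

variable {M : Type*} [TopologicalSpace M] [ChartedSpace (EuclideanSpace ℝ (Fin 4)) M]

/-- Complex functions on `M` that are smooth at the points of `U`. -/
def smoothOn (U : Set M) : Subalgebra ℂ (M → ℂ) where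
  carrier := {f | ∀ x ∈ U, ContMDiffAt (𝓡 4) 𝓘(ℝ, ℂ) ∞ f x}
  mul_mem' hf hg x hx := (hf x hx).mul_complex (hg x hx)
  add_mem' hf hg x hx := (hf x hx).add (hg x hx)
  algebraMap_mem' _ _ _ := contMDiffAt_const

lemma contMDiffAt_indicator {U : Set M} (hU : IsOpen U) {f : M → ℂ} {x : M} (hx : x ∈ U)
    (hf : ContMDiffAt (𝓡 4) 𝓘(ℝ, ℂ) ∞ f x) :
    ContMDiffAt (𝓡 4) 𝓘(ℝ, ℂ) ∞ (U.indicator f) x := by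
  refine hf.congr_of_eventuallyEq ?_
  filter_upwards [hU.mem_nhds hx] with y hy using Set.indicator_of_mem hy f

/-- A function, smooth on `U`, set to zero outside of `U`. -/
def cutoff {U : Set M} (hU : IsOpen U) (f : M → ℂ)
    (hf : ∀ x ∈ U, ContMDiffAt (𝓡 4) 𝓘(ℝ, ℂ) ∞ f x) : smoothOn U :=
  ⟨U.indicator f, fun x hx => contMDiffAt_indicator hU hx (hf x hx)⟩

/-- Evaluation at a point. -/
def evalAt (U : Set M) (x : M) : smoothOn U →ₐ[ℂ] ℂ :=
  (Pi.evalAlgHom ℂ (fun _ : M => ℂ) x).comp (smoothOn U).val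

lemma evalAt_apply {U : Set M} (x : M) (f : smoothOn U) : evalAt U x f = f.1 x := rfl

lemma evalAt_cutoff {U : Set M} (hU : IsOpen U) {f : M → ℂ}
    (hf : ∀ x ∈ U, ContMDiffAt (𝓡 4) 𝓘(ℝ, ℂ) ∞ f x) {x : M} (hx : x ∈ U) :
    evalAt U x (cutoff hU f hf) = f x := Set.indicator_of_mem hx f

lemma evalAt_cutoff_of_notMem {U : Set M} (hU : IsOpen U) {f : M → ℂ}
    (hf : ∀ x ∈ U, ContMDiffAt (𝓡 4) 𝓘(ℝ, ℂ) ∞ f x) {x : M} (hx : x ∉ U) :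
    evalAt U x (cutoff hU f hf) = 0 := Set.indicator_of_notMem hx f

lemma smoothOn_ext {U : Set M} {f g : smoothOn U} (h : ∀ x, evalAt U x f = evalAt U x g) :
    f = g := Subtype.ext (funext h)

lemma evalAt_eta (U : Set M) (x : M) (i : Fin 4) :
    evalAt U x (eta (smoothOn U) i) = (minkowskiSign i : ℂ) :=
  (evalAt U x).commutes _

lemma evalAt_sInv (U : Set M) (x : M) (i : Fin 4) (A A' : Fin 2) :
    evalAt U x (sInv (smoothOn U) i A A') = ivdwInv i A A' :=
  (evalAt U x).commutes _

variable [IsManifold (𝓡 4) ∞ M] (S : SpinSpacetime M)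

lemma d_congr {F : Type*} [NormedAddCommGroup F] [NormedSpace ℝ F] {f g : M → F} {x : M}
    (h : f =ᶠ[𝓝 x] g) (i : Fin 4) : S.d i f x = S.d i g x := by
  have : mfderiv (𝓡 4) 𝓘(ℝ, F) f x = mfderiv (𝓡 4) 𝓘(ℝ, F) g x := h.mfderiv_eq
  exact congrArg (fun L => L (S.E i x)) this

lemma d_add {f g : M → ℂ} {x : M} (hf : ContMDiffAt (𝓡 4) 𝓘(ℝ, ℂ) ∞ f x)
    (hg : ContMDiffAt (𝓡 4) 𝓘(ℝ, ℂ) ∞ g x) (i : Fin 4) :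
    S.d i (f + g) x = S.d i f x + S.d i g x := by
  have h := (hf.mdifferentiableAt (by simp)).hasMFDerivAt.add
    (hg.mdifferentiableAt (by simp)).hasMFDerivAt
  have h2 := h.mfderiv
  exact congrArg (fun L => L (S.E i x)) h2

lemma d_mul {f g : M → ℂ} {x : M} (hf : ContMDiffAt (𝓡 4) 𝓘(ℝ, ℂ) ∞ f x)
    (hg : ContMDiffAt (𝓡 4) 𝓘(ℝ, ℂ) ∞ g x) (i : Fin 4) :
    S.d i (f * g) x = f x * S.d i g x + g x * S.d i f x :=
  mvfderiv_mul_complex (hf.mdifferentiableAt (by simp)) (hg.mdifferentiableAt (by simp)) _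

lemma d_const (z : ℂ) (x : M) (i : Fin 4) : S.d i (fun _ => z) x = 0 := by
  simp [d, mvfderiv_const]

lemma contMDiffAt_d_smooth {f : M → ℂ} {x : M} (hf : ContMDiffAt (𝓡 4) 𝓘(ℝ, ℂ) ∞ f x)
    (i : Fin 4) : ContMDiffAt (𝓡 4) 𝓘(ℝ, ℂ) ∞ (S.d i f) x :=
  S.contMDiffAt_d le_rfl (fun i => S.contMDiffAt_E i x) hf i

/-- The frame derivations of the functions that are smooth on `U`. -/
def frameDeriv {U : Set M} (hU : IsOpen U) (i : Fin 4) :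
    Derivation ℂ (smoothOn U) (smoothOn U) :=
  Derivation.mk'
    -- Derivatives are set to zero outside `U`. Every identity then holds trivially there, and the
    -- frame acts by derivations on the whole algebra although smoothness is known only on `U`.
    { toFun f := cutoff hU (S.d i f.1) fun x hx => S.contMDiffAt_d_smooth (f.2 x hx) i
      map_add' f g := smoothOn_ext fun x => by
        by_cases hx : x ∈ U
        · rw [map_add, evalAt_cutoff hU _ hx, evalAt_cutoff hU _ hx, evalAt_cutoff hU _ hx]
          exact S.d_add (f.2 x hx) (g.2 x hx) i
        · rw [map_add, evalAt_cutoff_of_notMem hU _ hx, evalAt_cutoff_of_notMem hU _ hx,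
            evalAt_cutoff_of_notMem hU _ hx, add_zero]
      map_smul' z f := smoothOn_ext fun x => by
        by_cases hx : x ∈ U
        · rw [RingHom.id_apply, map_smul, evalAt_cutoff hU _ hx, evalAt_cutoff hU _ hx]
          have h := S.d_mul (f := fun _ => z) contMDiffAt_const (f.2 x hx) i
          rw [d_const, mul_zero, add_zero] at h
          exact h
        · rw [RingHom.id_apply, map_smul, evalAt_cutoff_of_notMem hU _ hx,
            evalAt_cutoff_of_notMem hU _ hx, smul_zero] }
    fun f g => smoothOn_ext fun x => by
      simp only [LinearMap.coe_mk, AddHom.coe_mk, smul_eq_mul, map_add, map_mul]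
      by_cases hx : x ∈ U
      · rw [evalAt_cutoff hU _ hx, evalAt_cutoff hU _ hx, evalAt_cutoff hU _ hx]
        exact S.d_mul (f.2 x hx) (g.2 x hx) i
      · rw [evalAt_cutoff_of_notMem hU _ hx, evalAt_cutoff_of_notMem hU _ hx,
          evalAt_cutoff_of_notMem hU _ hx, mul_zero, mul_zero, add_zero]

lemma evalAt_frameDeriv {U : Set M} (hU : IsOpen U) (i : Fin 4) (f : smoothOn U) {x : M}
    (hx : x ∈ U) : evalAt U x (S.frameDeriv hU i f) = S.d i f.1 x :=
  evalAt_cutoff hU (fun x hx => S.contMDiffAt_d_smooth (f.2 x hx) i) hx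

lemma evalAt_frameDeriv_of_notMem {U : Set M} (hU : IsOpen U) (i : Fin 4) (f : smoothOn U)
    {x : M} (hx : x ∉ U) : evalAt U x (S.frameDeriv hU i f) = 0 :=
  evalAt_cutoff_of_notMem hU (fun x hx => S.contMDiffAt_d_smooth (f.2 x hx) i) hx

lemma evalAt_frameDeriv_cutoff {U : Set M} (hU : IsOpen U) (i : Fin 4) {f : M → ℂ}
    (hf : ∀ x ∈ U, ContMDiffAt (𝓡 4) 𝓘(ℝ, ℂ) ∞ f x) {x : M} (hx : x ∈ U) :
    evalAt U x (S.frameDeriv hU i (cutoff hU f hf)) = S.d i f x := by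
  rw [S.evalAt_frameDeriv hU i _ hx]
  refine S.d_congr ?_ i
  filter_upwards [hU.mem_nhds hx] with y hy using Set.indicator_of_mem hy f

/-- The structure functions as elements of the ring of functions. -/
def structOn {U : Set M} (hU : IsOpen U) (i j k : Fin 4) : smoothOn U :=
  cutoff hU (fun x => (S.struct i j k x : ℂ)) fun x _ =>
    (S.contMDiffAt_struct le_rfl (fun i => S.contMDiffAt_E i x) i j k).complex_ofReal

/-- The connection coefficients as elements of the ring of functions. -/
def gamOn {U : Set M} (hU : IsOpen U) (i j k : Fin 4) : smoothOn U :=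
  cutoff hU (fun x => (S.gam i j k x : ℂ)) fun x _ =>
    (S.contMDiffAt_gam le_rfl (fun i => S.contMDiffAt_E i x) i j k).complex_ofReal

/-- The spacetime supplies a model of the abstract moving frame: commutators, metric compatibility,
absence of torsion and the Jacobi identity are the pointwise facts already proved on `U`, and reduce
to 0 = 0 elsewhere. -/
lemma isLeviCivita {U : Set M} (hU : IsOpen U) :
    IsLeviCivita (S.frameDeriv hU) (S.structOn hU) (S.gamOn hU) where
  comm i j f := smoothOn_ext fun x => by
    simp only [map_sub, map_sum, map_mul]
    by_cases hx : x ∈ U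
    · have h : ∀ i j, evalAt U x (S.frameDeriv hU i (S.frameDeriv hU j f)) =
          S.d i (S.d j f.1) x := fun i j => S.evalAt_frameDeriv_cutoff hU i
            (fun x hx => S.contMDiffAt_d_smooth (f.2 x hx) j) hx
      rw [h, h, S.commutator (f.2 x hx)]
      refine Finset.sum_congr rfl fun k _ => ?_
      rw [structOn, evalAt_cutoff hU _ hx, S.evalAt_frameDeriv hU k f hx]
    · simp only [S.evalAt_frameDeriv_of_notMem hU _ _ hx, mul_zero, Finset.sum_const_zero,
        sub_zero]
  antisymm i j k := smoothOn_ext fun x => by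
    by_cases hx : x ∈ U
    · rw [map_neg, gamOn, gamOn, evalAt_cutoff hU _ hx, evalAt_cutoff hU _ hx, S.gam_antisymm]
      push_cast; ring
    · rw [map_neg, gamOn, gamOn, evalAt_cutoff_of_notMem hU _ hx,
        evalAt_cutoff_of_notMem hU _ hx, neg_zero]
  struct_eq i j k := smoothOn_ext fun x => by
    rw [map_mul, map_sub, evalAt_eta]
    by_cases hx : x ∈ U
    · rw [structOn, gamOn, gamOn, evalAt_cutoff hU _ hx, evalAt_cutoff hU _ hx,
        evalAt_cutoff hU _ hx, S.struct_eq_gam]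
      push_cast; ring
    · rw [structOn, gamOn, gamOn, evalAt_cutoff_of_notMem hU _ hx,
        evalAt_cutoff_of_notMem hU _ hx, evalAt_cutoff_of_notMem hU _ hx, sub_zero, mul_zero]
  jacobi i j k l := smoothOn_ext fun x => by
    simp only [map_add, map_sum, map_mul, map_zero]
    by_cases hx : x ∈ U
    · have h : ∀ a i j, evalAt U x (S.frameDeriv hU a (S.structOn hU i j l)) =
          ((S.d a (S.struct i j l) x : ℝ) : ℂ) := fun a i j => by
        rw [structOn, S.evalAt_frameDeriv_cutoff hU a _ hx]
        exact mvfderiv_ofReal (S.mdiffAt_struct i j l x) _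
      have h2 : ∀ i j k, evalAt U x (S.structOn hU i j k) = (S.struct i j k x : ℂ) :=
        fun i j k => evalAt_cutoff hU _ hx
      simp only [h, h2]
      exact_mod_cast S.jacobi x i j k l
    · have h2 : ∀ i j k, evalAt U x (S.structOn hU i j k) = 0 :=
        fun i j k => evalAt_cutoff_of_notMem hU _ hx
      simp only [S.evalAt_frameDeriv_of_notMem hU _ _ hx, h2, mul_zero, add_zero,
        Finset.sum_const_zero]

lemma evalAt_riem {U : Set M} (hU : IsOpen U) {x : M} (hx : x ∈ U) (i j k l : Fin 4) :
    evalAt U x (riem (S.frameDeriv hU) (S.structOn hU) (S.gamOn hU) i j k l) =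
      (S.riemann x i j k l : ℂ) := by
  have h : ∀ a i j l, evalAt U x (S.frameDeriv hU a (S.gamOn hU i j l)) =
      ((S.d a (S.gam i j l) x : ℝ) : ℂ) := fun a i j l => by
    rw [gamOn, S.evalAt_frameDeriv_cutoff hU a _ hx]
    exact mvfderiv_ofReal (S.mdiffAt_gam i j l x) _
  have h1 : ∀ i j k, evalAt U x (S.gamOn hU i j k) = (S.gam i j k x : ℂ) :=
    fun i j k => evalAt_cutoff hU _ hx
  have h2 : ∀ i j k, evalAt U x (S.structOn hU i j k) = (S.struct i j k x : ℂ) :=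
    fun i j k => evalAt_cutoff hU _ hx
  rw [riemann_eq, riem]
  simp only [map_add, map_sub, map_sum, map_mul, h, h1, h2, evalAt_eta]
  push_cast
  rfl

lemma evalAt_riem_of_notMem {U : Set M} (hU : IsOpen U) {x : M} (hx : x ∉ U) (i j k l : Fin 4) :
    evalAt U x (riem (S.frameDeriv hU) (S.structOn hU) (S.gamOn hU) i j k l) = 0 := by
  have h1 : ∀ i j k, evalAt U x (S.gamOn hU i j k) = 0 :=
    fun i j k => evalAt_cutoff_of_notMem hU _ hx
  rw [riem]
  simp only [map_add, map_sub, map_sum, map_mul, S.evalAt_frameDeriv_of_notMem hU _ _ hx, h1,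
    mul_zero, sub_zero, add_zero, Finset.sum_const_zero]

lemma evalAt_spinorOf {U : Set M} (hU : IsOpen U) {x : M} (hx : x ∈ U) (A B C D : Fin 2) :
    evalAt U x (spinorOf (riem (S.frameDeriv hU) (S.structOn hU) (S.gamOn hU)) A B C D) =
      4 * S.curvSpinor x A B C D := by
  simp only [spinorOf, map_sum, map_mul, S.evalAt_riem hU hx, biv, map_sub, evalAt_sInv,
    curvSpinor]
  have h4 : ∀ z : ℂ, 4 * (z / 4) = z := fun z => by ring
  rw [h4]
  simp only [Fin.sum_univ_two, spinEps]
  simp only [Matrix.of_apply, Matrix.cons_val', Matrix.cons_val_zero, Matrix.cons_val_one,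
    Matrix.cons_val_fin_one, zero_mul, mul_zero, add_zero, zero_add, one_mul, mul_one, neg_mul,
    mul_neg, neg_neg, neg_zero, ← Finset.sum_neg_distrib, ← Finset.sum_add_distrib]
  refine Finset.sum_congr rfl fun i _ => Finset.sum_congr rfl fun j _ =>
    Finset.sum_congr rfl fun k _ => Finset.sum_congr rfl fun l _ => ?_
  ring

end SpinSpacetime

end

/-! ### The dyad connection and the integrability identities on the manifold. -/

noncomputable section

open Filter Topology VectorField DerivationFrame

namespace SpinDyad

variable {M : Type*} [TopologicalSpace M] [ChartedSpace (EuclideanSpace ℝ (Fin 4)) M]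
  (D : SpinDyad M)

/-- The dyad as a matrix, `ε_a^A = mat A a` with `ε_0 = o`, `ε_1 = ι`. -/
def mat (x : M) (A a : Fin 2) : ℂ := ![D.o x A, D.iota x A] a

/-- The frame components of `e_{aA'} = ε_a^A ∇_{AA'}`. -/
def vec (a A' : Fin 2) (x : M) (i : Fin 4) : ℂ := ∑ A, D.mat x A a * ivdwInv i A A'

lemma normalized' (x : M) : D.o x 0 * D.iota x 1 - D.o x 1 * D.iota x 0 = 1 := by
  have h := D.normalized x
  simp [lowerIdx, spinEps] at h
  linear_combination h

lemma contMDiffAt_mat {n : WithTop ℕ∞} {x : M}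
    (ho : ContMDiffAt (𝓡 4) 𝓘(ℝ, Fin 2 → ℂ) n D.o x)
    (hi : ContMDiffAt (𝓡 4) 𝓘(ℝ, Fin 2 → ℂ) n D.iota x) (A a : Fin 2) :
    ContMDiffAt (𝓡 4) 𝓘(ℝ, ℂ) n (fun y => D.mat y A a) x := by
  fin_cases a
  · exact (contMDiffAt_pi_space.1 ho) A
  · exact (contMDiffAt_pi_space.1 hi) A

end SpinDyad

namespace SpinSpacetime

variable {M : Type*} [TopologicalSpace M] [ChartedSpace (EuclideanSpace ℝ (Fin 4)) M]
  (D : SpinDyad M) {U : Set M}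

/-- The dyad as a matrix over the ring of functions. -/
def dyadOn (U : Set M) : Matrix (Fin 2) (Fin 2) (smoothOn U) := fun A a =>
  ⟨fun x => D.mat x A a, fun x _ => D.contMDiffAt_mat (D.contMDiff_o x) (D.contMDiff_iota x) A a⟩

lemma evalAt_dyadOn (x : M) (A a : Fin 2) : evalAt U x (dyadOn D U A a) = D.mat x A a := rfl

lemma det_dyadOn : (dyadOn D U).det = 1 := smoothOn_ext fun x => by
  rw [Matrix.det_fin_two]
  simp only [map_sub, map_mul, evalAt_dyadOn, map_one]
  simp only [SpinDyad.mat, Matrix.cons_val_zero, Matrix.cons_val_one]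
  linear_combination D.normalized' x

lemma evalAt_algebraMap (x : M) (z : ℂ) : evalAt U x (algebraMap ℂ (smoothOn U) z) = z :=
  (evalAt U x).commutes z

lemma evalAt_rot (x : M) (a A' : Fin 2) (i : Fin 4) :
    evalAt U x (rot (sInv (smoothOn U)) (dyadOn D U) a A' i) = D.vec a A' x i := by
  simp only [rot, map_sum, map_mul, evalAt_sInv, evalAt_dyadOn, SpinDyad.vec]

variable [IsManifold (𝓡 4) ∞ M] (S : SpinSpacetime M)

/-- The derivative `ε_a^A ∇_{AA'} f`. -/
def dir (a A' : Fin 2) (f : M → ℂ) (x : M) : ℂ := ∑ i, D.vec a A' x i * S.d i f x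

/-- The coefficients of the spin connection in the dyad,
`ε_a^A ∇_{AA'} ε_b^B = conn a A' c b ε_c^B`. -/
def conn (a A' i j : Fin 2) (x : M) : ℂ :=
  (!![D.mat x 1 1, -D.mat x 0 1; -D.mat x 1 0, D.mat x 0 0] *
    (Matrix.of fun A b => S.dir D a A' (fun y => D.mat y A b) x
      + ∑ B, (∑ k, D.vec a A' x k * S.spinConn x k A B) * D.mat x B b)) i j

/-- The conjugate spin connection in the direction of `o^A ∇_{AA'}`. -/
def connBar (A' C' B' : Fin 2) (x : M) : ℂ :=
  ∑ i, D.vec 0 A' x i * repBar (fun j k => (S.gam i j k x : ℂ)) C' B'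

variable (hU : IsOpen U)

/-- The spin connection over the ring of functions. -/
def spinConnOn (i : Fin 4) : Matrix (Fin 2) (Fin 2) (smoothOn U) :=
  rep (S.gamOn hU i)

/-- The conjugate spin connection over the ring of functions. -/
def spinConnBarOn (i : Fin 4) :
    Matrix (Fin 2) (Fin 2) (smoothOn U) :=
  repBar (S.gamOn hU i)

lemma evalAt_spinConnOn {x : M} (hx : x ∈ U) (i : Fin 4) (A B : Fin 2) :
    evalAt U x (S.spinConnOn hU i A B) = S.spinConn x i A B := by
  have h1 : ∀ i j k, evalAt U x (S.gamOn hU i j k) = (S.gam i j k x : ℂ) :=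
    fun i j k => evalAt_cutoff hU _ hx
  simp only [spinConnOn, rep, map_mul, map_sum, evalAt_algebraMap, h1, evalAt_eta, evalAt_sInv,
    spinConn, g_leviCivita_E_E]
  push_cast
  ring

lemma evalAt_spinConnBarOn {x : M} (hx : x ∈ U) (i : Fin 4) (A B : Fin 2) :
    evalAt U x (S.spinConnBarOn hU i A B) = repBar (fun j k => (S.gam i j k x : ℂ)) A B := by
  have h1 : ∀ i j k, evalAt U x (S.gamOn hU i j k) = (S.gam i j k x : ℂ) :=
    fun i j k => evalAt_cutoff hU _ hx
  simp only [spinConnBarOn, repBar, map_mul, map_sum, evalAt_algebraMap, h1, evalAt_eta,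
    evalAt_sInv]
  rfl

lemma evalAt_along {x : M} (hx : x ∈ U) (a A' : Fin 2) (f : smoothOn U) :
    evalAt U x (along (S.frameDeriv hU) (rot (sInv (smoothOn U)) (dyadOn D U) a A') f) =
      S.dir D a A' f.1 x := by
  simp only [along, map_sum, map_mul, evalAt_rot, S.evalAt_frameDeriv hU _ _ hx, dir]

/-- The explicit first factor in `conn` is the adjugate, hence the inverse, of the dyad matrix of
determinant 1, as in `connForm`. -/
lemma evalAt_gauge {x : M} (hx : x ∈ U) (a A' i j : Fin 2) :
    evalAt U x (connForm (S.frameDeriv hU) (S.spinConnOn hU) (dyadOn D U)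
      (rot (sInv (smoothOn U)) (dyadOn D U) a A') i j) = S.conn D a A' i j x := by
  have h : ∀ A b, evalAt U x (((dyadOn D U).map (along (S.frameDeriv hU)
      (rot (sInv (smoothOn U)) (dyadOn D U) a A')) + lin (S.spinConnOn hU)
      (rot (sInv (smoothOn U)) (dyadOn D U) a A') * dyadOn D U) A b) =
      S.dir D a A' (fun y => D.mat y A b) x
      + ∑ B, (∑ k, D.vec a A' x k * S.spinConn x k A B) * D.mat x B b := by
    intro A b
    simp only [Matrix.add_apply, Matrix.map_apply, map_add, S.evalAt_along D hU hx,
      Matrix.mul_apply, map_sum, map_mul, lin, Matrix.sum_apply, Matrix.smul_apply, smul_eq_mul,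
      evalAt_rot, S.evalAt_spinConnOn hU hx, evalAt_dyadOn]
    rfl
  rw [connForm, conn, Matrix.mul_apply, map_sum, Matrix.mul_apply]
  refine Finset.sum_congr rfl fun A _ => ?_
  rw [map_mul, h, Matrix.of_apply, Matrix.adjugate_fin_two]
  congr 1
  fin_cases i <;> fin_cases A <;> simp [evalAt_dyadOn]

lemma evalAt_gauge_of_notMem {x : M} (hx : x ∉ U) (v : Fin 4 → smoothOn U) (i j : Fin 2) :
    evalAt U x (connForm (S.frameDeriv hU) (S.spinConnOn hU) (dyadOn D U) v i j) = 0 := by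
  have h1 : ∀ i j k, evalAt U x (S.gamOn hU i j k) = 0 :=
    fun i j k => evalAt_cutoff_of_notMem hU _ hx
  simp only [connForm, Matrix.mul_apply, Matrix.add_apply, Matrix.map_apply, map_sum, map_mul,
    map_add, along, lin, Matrix.sum_apply, Matrix.smul_apply, smul_eq_mul, spinConnOn, rep,
    S.evalAt_frameDeriv_of_notMem hU _ _ hx, h1, mul_zero, zero_mul, add_zero,
    Finset.sum_const_zero]

lemma evalAt_lin_bar {x : M} (hx : x ∈ U) (A' C' B' : Fin 2) :
    evalAt U x (lin (S.spinConnBarOn hU) (rot (sInv (smoothOn U)) (dyadOn D U) 0 A') C' B') =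
      S.connBar D A' C' B' x := by
  simp only [lin, Matrix.sum_apply, Matrix.smul_apply, smul_eq_mul, map_sum, map_mul, evalAt_rot,
    S.evalAt_spinConnBarOn hU hx, connBar]

/-- The `X_{0'}` coefficient of `[X_{0'}, X_{1'}]`, where `X_{A'} = o^A ∇_{AA'}`. -/
def lam0 (x : M) : ℂ := -S.conn D 0 1 0 0 x + S.connBar D 0 0 1 x - S.connBar D 1 0 0 x

/-- The `X_{1'}` coefficient of `[X_{0'}, X_{1'}]`, where `X_{A'} = o^A ∇_{AA'}`. -/
def lam1 (x : M) : ℂ := S.conn D 0 0 0 0 x + S.connBar D 0 1 1 x - S.connBar D 1 1 0 x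

lemma isTorsionFree : IsTorsionFree (S.frameDeriv hU) (S.structOn hU) (sInv (smoothOn U))
    (S.spinConnOn hU) (S.spinConnBarOn hU) := (S.isLeviCivita hU).isTorsionFree

lemma gauge_ray (hS : ∀ x A', S.conn D 0 A' 1 0 x = 0) (A' : Fin 2) :
    connForm (S.frameDeriv hU) (S.spinConnOn hU) (dyadOn D U)
      (rot (sInv (smoothOn U)) (dyadOn D U) 0 A') 1 0 = 0 := smoothOn_ext fun x => by
  rw [map_zero]
  by_cases hx : x ∈ U
  · rw [S.evalAt_gauge D hU hx, hS]
  · exact S.evalAt_gauge_of_notMem D hU hx _ _ _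

lemma dir_congr {f g : M → ℂ} {x : M} (h : f =ᶠ[𝓝 x] g) (a A' : Fin 2) :
    S.dir D a A' f x = S.dir D a A' g x := by
  simp only [dir, S.d_congr h]

/-- Geometric meaning of shear-freeness: the Y components of [X_{0'}, X_{1'}] have coefficients
Γ_{0A'}^1_0, so X_{0'} and X_{1'} span an involutive distribution. The primed connection enters only
through `lam0` and `lam1`. -/
lemma ray_commutator {U : Set M} (hU : IsOpen U) (hS : ∀ x A', S.conn D 0 A' 1 0 x = 0) {f : M → ℂ}
    (hf : ∀ x ∈ U, ContMDiffAt (𝓡 4) 𝓘(ℝ, ℂ) ∞ f x) {x : M} (hx : x ∈ U) :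
    S.dir D 0 0 (S.dir D 0 1 f) x - S.dir D 0 1 (S.dir D 0 0 f) x =
      S.lam0 D x * S.dir D 0 0 f x + S.lam1 D x * S.dir D 0 1 f x := by
  have hT := S.isTorsionFree hU
  have h1 := along_comm hT.comm (rot (sInv (smoothOn U)) (dyadOn D U) 0 0)
    (rot (sInv (smoothOn U)) (dyadOn D U) 0 1) ⟨f, hf⟩
  have h2 := hT.bracket_ray (det_dyadOn D) (S.gauge_ray D hU hS)
    (alongLin (S.frameDeriv hU) ⟨f, hf⟩)
  simp only [alongLin_apply] at h2
  rw [h2] at h1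
  have h3 := congrArg (evalAt U x) h1
  have h4 : ∀ A', (along (S.frameDeriv hU) (rot (sInv (smoothOn U)) (dyadOn D U) 0 A')
      ⟨f, hf⟩).1 =ᶠ[𝓝 x] S.dir D 0 A' f := fun A' => by
    filter_upwards [hU.mem_nhds hx] with y hy using S.evalAt_along D hU hy 0 A' ⟨f, hf⟩
  simp only [map_sub, map_add, map_mul, map_neg, S.evalAt_along D hU hx, S.evalAt_gauge D hU hx,
    S.evalAt_lin_bar D hU hx] at h3
  rw [S.dir_congr D (h4 0), S.dir_congr D (h4 1)] at h3
  exact h3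

/-- The symmetries of X, inherited from the Riemann tensor by evaluation, are what allows
`symm4_contract` to pass from Ψ to X. -/
lemma hrep_of_repeated (hP : S.IsRepeatedPrincipal D) (A : Fin 2) :
    ∑ B, ∑ C, ∑ P, spinorOf (riem (S.frameDeriv hU) (S.structOn hU) (S.gamOn hU)) A B C P *
      dyadOn D U B 0 * dyadOn D U C 0 * dyadOn D U P 0 = 0 := smoothOn_ext fun x => by
  simp only [map_sum, map_mul, map_zero, evalAt_dyadOn]
  by_cases hx : x ∈ U
  · have hL := S.isLeviCivita hU
    have h1 : ∀ A B C P, S.curvSpinor x A B C P = S.curvSpinor x B A C P := fun A B C P => by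
      have := congrArg (evalAt U x) (spinorOf_swap (Q := riem (S.frameDeriv hU) (S.structOn hU)
        (S.gamOn hU)) (riem_swap_left hL.struct_eq) A B C P)
      rw [S.evalAt_spinorOf hU hx, S.evalAt_spinorOf hU hx] at this
      exact mul_left_cancel₀ (by norm_num) this
    have h2 : ∀ A B C P, S.curvSpinor x A B C P = S.curvSpinor x C P A B := fun A B C P => by
      have := congrArg (evalAt U x) (spinorOf_pair hL.riem_pair A B C P)
      rw [S.evalAt_spinorOf hU hx, S.evalAt_spinorOf hU hx] at this
      exact mul_left_cancel₀ (by norm_num) this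
    have h3 := hP x A
    simp only [weylSpinor] at h3
    rw [symm4_contract h1 h2] at h3
    simp only [S.evalAt_spinorOf hU hx, mul_assoc, ← Finset.mul_sum]
    simp only [← mul_assoc]
    exact mul_eq_zero_of_right 4 h3
  · simp only [spinorOf, map_sum, map_mul, S.evalAt_riem_of_notMem hU hx, mul_zero, zero_mul,
      Finset.sum_const_zero]

lemma rotCurv_of_repeated (hP : S.IsRepeatedPrincipal D) :
    rotCurv (S.frameDeriv hU) (S.structOn hU) (S.spinConnOn hU) (dyadOn D U)
      (rot (sInv (smoothOn U)) (dyadOn D U) 0 0) (rot (sInv (smoothOn U)) (dyadOn D U) 0 1) 0 0 = 0 ∧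
    rotCurv (S.frameDeriv hU) (S.structOn hU) (S.spinConnOn hU) (dyadOn D U)
      (rot (sInv (smoothOn U)) (dyadOn D U) 0 0) (rot (sInv (smoothOn U)) (dyadOn D U) 1 1) 1 0
      + rotCurv (S.frameDeriv hU) (S.structOn hU) (S.spinConnOn hU) (dyadOn D U)
      (rot (sInv (smoothOn U)) (dyadOn D U) 1 0) (rot (sInv (smoothOn U)) (dyadOn D U) 0 1) 1 0 = 0 ∧
    rotCurv (S.frameDeriv hU) (S.structOn hU) (S.spinConnOn hU) (dyadOn D U)
      (rot (sInv (smoothOn U)) (dyadOn D U) 0 0) (rot (sInv (smoothOn U)) (dyadOn D U) 0 1) 0 1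
      + rotCurv (S.frameDeriv hU) (S.structOn hU) (S.spinConnOn hU) (dyadOn D U)
      (rot (sInv (smoothOn U)) (dyadOn D U) 1 0) (rot (sInv (smoothOn U)) (dyadOn D U) 1 1) 1 0 = 0 := by
  have h1 := S.hrep_of_repeated D hU hP
  have h := (S.isLeviCivita hU).rotCurv_of_principal (g := dyadOn D U) h1
  have e : S.spinConnOn hU = fun i => rep (S.gamOn hU i) := rfl
  rw [e]
  exact h

/-- Together with `ray_closed` this makes the zeroth order coefficients of the equation for η a flat
connection along the ray distribution. -/
lemma ray_flat (hS : ∀ x A', S.conn D 0 A' 1 0 x = 0) (hP : S.IsRepeatedPrincipal D) (x : M) :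
    S.dir D 0 0 (S.conn D 0 1 0 0) x - S.dir D 0 1 (S.conn D 0 0 0 0) x =
      S.lam0 D x * S.conn D 0 0 0 0 x + S.lam1 D x * S.conn D 0 1 0 0 x := by
  have hx : x ∈ (Set.univ : Set M) := Set.mem_univ x
  have hU : IsOpen (Set.univ : Set M) := isOpen_univ
  have h := (S.isTorsionFree hU).flat_of_curv (det_dyadOn D) (S.gauge_ray D hU hS)
    (S.rotCurv_of_repeated D hU hP).1
  have h3 := congrArg (evalAt Set.univ x) h
  have h4 : ∀ a A' i j, (connForm (S.frameDeriv hU) (S.spinConnOn hU) (dyadOn D Set.univ)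
      (rot (sInv (smoothOn Set.univ)) (dyadOn D Set.univ) a A') i j).1 = S.conn D a A' i j :=
    fun a A' i j => funext fun y => S.evalAt_gauge D hU (Set.mem_univ y) a A' i j
  simp only [map_sub, map_add, map_mul, map_neg, S.evalAt_along D hU hx, S.evalAt_gauge D hU hx,
    S.evalAt_lin_bar D hU hx, h4] at h3
  exact h3

/-- The integrability condition of X_{A'} log φ = -Γ_{1A'}^1_0. -/
lemma ray_closed (hS : ∀ x A', S.conn D 0 A' 1 0 x = 0) (hP : S.IsRepeatedPrincipal D) (x : M) :
    S.dir D 0 0 (S.conn D 1 1 1 0) x - S.dir D 0 1 (S.conn D 1 0 1 0) x =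
      S.lam0 D x * S.conn D 1 0 1 0 x + S.lam1 D x * S.conn D 1 1 1 0 x := by
  have hx : x ∈ (Set.univ : Set M) := Set.mem_univ x
  have hU : IsOpen (Set.univ : Set M) := isOpen_univ
  have h := (S.isTorsionFree hU).closed_of_curv (det_dyadOn D) (S.gauge_ray D hU hS)
    (S.rotCurv_of_repeated D hU hP).2.1
  have h3 := congrArg (evalAt Set.univ x) h
  have h4 : ∀ a A' i j, (connForm (S.frameDeriv hU) (S.spinConnOn hU) (dyadOn D Set.univ)
      (rot (sInv (smoothOn Set.univ)) (dyadOn D Set.univ) a A') i j).1 = S.conn D a A' i j :=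
    fun a A' i j => funext fun y => S.evalAt_gauge D hU (Set.mem_univ y) a A' i j
  simp only [map_sub, map_add, map_mul, map_neg, S.evalAt_along D hU hx, S.evalAt_gauge D hU hx,
    S.evalAt_lin_bar D hU hx, h4] at h3
  exact h3

/-- The integrability condition of the inhomogeneous equation for η. It uses that `u` already solves
its own equation on an open set, since derivatives of that equation are taken. -/
lemma ray_compat {U : Set M} (hU : IsOpen U) (hS : ∀ x A', S.conn D 0 A' 1 0 x = 0)
    (hP : S.IsRepeatedPrincipal D) {u : M → ℂ}
    (hu : ∀ x ∈ U, ContMDiffAt (𝓡 4) 𝓘(ℝ, ℂ) ∞ u x)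
    (hXu : ∀ x ∈ U, ∀ A', S.dir D 0 A' u x = -S.conn D 1 A' 1 0 x) {x : M} (hx : x ∈ U) :
    S.dir D 0 0 (fun y => S.dir D 1 1 u y + S.conn D 0 1 0 1 y) x
      - S.dir D 0 1 (fun y => S.dir D 1 0 u y + S.conn D 0 0 0 1 y) x
      - (-S.conn D 1 1 1 0 x + 2 * S.conn D 0 1 0 0 x) * (S.dir D 1 0 u x + S.conn D 0 0 0 1 x)
      + (-S.conn D 1 0 1 0 x + 2 * S.conn D 0 0 0 0 x) * (S.dir D 1 1 u x + S.conn D 0 1 0 1 x) =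
      S.lam0 D x * (S.dir D 1 0 u x + S.conn D 0 0 0 1 x)
      + S.lam1 D x * (S.dir D 1 1 u x + S.conn D 0 1 0 1 x) := by
  let F := along (S.frameDeriv hU)
  have h := (S.isTorsionFree hU).compat_of_curv (det_dyadOn D) (S.gauge_ray D hU hS)
    (S.rotCurv_of_repeated D hU hP).2.2
    -- The equations for `u` are known only on `U`. Extended by zero they hold at every point,
    -- because the connection form in the algebra also evaluates to zero outside `U`.
    (u := cutoff hU u hu) (fun A' => smoothOn_ext fun y => by
      by_cases hy : y ∈ U
      · rw [S.evalAt_along D hU hy, map_neg, S.evalAt_gauge D hU hy, ← hXu y hy]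
        refine S.dir_congr D ?_ 0 A'
        filter_upwards [hU.mem_nhds hy] with z hz using Set.indicator_of_mem hz u
      · rw [map_neg, S.evalAt_gauge_of_notMem D hU hy, neg_zero]
        simp only [along, map_sum, map_mul, S.evalAt_frameDeriv_of_notMem hU _ _ hy, mul_zero,
          Finset.sum_const_zero])
  have h3 := congrArg (evalAt U x) h
  have hcu : ∀ y ∈ U, ∀ a A', S.dir D a A' (cutoff hU u hu).1 y = S.dir D a A' u y :=
    fun y hy a A' => S.dir_congr D
      (by filter_upwards [hU.mem_nhds hy] with z hz using Set.indicator_of_mem hz u) a A'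
  have h4 : ∀ A', (along (S.frameDeriv hU) (rot (sInv (smoothOn U)) (dyadOn D U) 1 A')
      (cutoff hU u hu) + connForm (S.frameDeriv hU) (S.spinConnOn hU) (dyadOn D U)
      (rot (sInv (smoothOn U)) (dyadOn D U) 0 A') 0 1).1 =ᶠ[𝓝 x]
      fun y => S.dir D 1 A' u y + S.conn D 0 A' 0 1 y := fun A' => by
    filter_upwards [hU.mem_nhds hx] with y hy
    rw [← evalAt_apply, map_add, S.evalAt_along D hU hy, S.evalAt_gauge D hU hy, hcu y hy]
  simp only [map_sub, map_add, map_mul, map_neg, map_ofNat, S.evalAt_along D hU hx,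
    S.evalAt_gauge D hU hx, S.evalAt_lin_bar D hU hx, hcu x hx] at h3
  rw [S.dir_congr D (h4 0), S.dir_congr D (h4 1)] at h3
  exact h3

end SpinSpacetime

end

/-! ### Covariant derivatives in dyad components. -/

noncomputable section

open Filter Topology VectorField DerivationFrame

namespace SpinDyad

variable {M : Type*} [TopologicalSpace M] [ChartedSpace (EuclideanSpace ℝ (Fin 4)) M]
  (D : SpinDyad M)

lemma lowerIdx_eq (κ : Fin 2 → ℂ) (A : Fin 2) : lowerIdx κ A = ![-κ 1, κ 0] A := by
  fin_cases A <;> simp [lowerIdx, spinEps]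

lemma oLow_zero (x : M) : D.oLow x 0 = -D.o x 1 := lowerIdx_eq _ 0
lemma oLow_one (x : M) : D.oLow x 1 = D.o x 0 := lowerIdx_eq _ 1
lemma iotaLow_zero (x : M) : D.iotaLow x 0 = -D.iota x 1 := lowerIdx_eq _ 0
lemma iotaLow_one (x : M) : D.iotaLow x 1 = D.iota x 0 := lowerIdx_eq _ 1

lemma o_oLow (x : M) : ∑ A, D.o x A * D.oLow x A = 0 := by
  rw [Fin.sum_univ_two, oLow_zero, oLow_one]; ring

lemma iota_oLow (x : M) : ∑ A, D.iota x A * D.oLow x A = 1 := by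
  rw [Fin.sum_univ_two, oLow_zero, oLow_one]; linear_combination D.normalized' x

lemma o_iotaLow (x : M) : ∑ A, D.o x A * D.iotaLow x A = -1 := by
  rw [Fin.sum_univ_two, iotaLow_zero, iotaLow_one]; linear_combination -D.normalized' x

lemma iota_iotaLow (x : M) : ∑ A, D.iota x A * D.iotaLow x A = 0 := by
  rw [Fin.sum_univ_two, iotaLow_zero, iotaLow_one]; ring

lemma mdiffAt_o (x : M) (A : Fin 2) :
    MDifferentiableAt (𝓡 4) 𝓘(ℝ, ℂ) (fun y => D.o y A) x :=
  (contMDiffAt_pi_space.1 (D.contMDiff_o x) A).mdifferentiableAt (by simp)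

lemma mdiffAt_iota (x : M) (A : Fin 2) :
    MDifferentiableAt (𝓡 4) 𝓘(ℝ, ℂ) (fun y => D.iota y A) x :=
  (contMDiffAt_pi_space.1 (D.contMDiff_iota x) A).mdifferentiableAt (by simp)

lemma resolve_covector (x : M) (α : Fin 2 → ℂ) (A : Fin 2) :
    α A = D.oLow x A * ∑ B, D.mat x B 1 * α B - D.iotaLow x A * ∑ B, D.mat x B 0 * α B := by
  have h := D.normalized' x
  simp only [Fin.sum_univ_two, mat, Matrix.cons_val_zero, Matrix.cons_val_one]
  fin_cases A
  · simp only [Fin.zero_eta, oLow_zero, iotaLow_zero]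
    linear_combination (-α 0) * h
  · simp only [Fin.mk_one, oLow_one, iotaLow_one]
    linear_combination (-α 1) * h

end SpinDyad

namespace SpinSpacetime

variable {M : Type*} [TopologicalSpace M] [ChartedSpace (EuclideanSpace ℝ (Fin 4)) M]
  [IsManifold (𝓡 4) ∞ M] (S : SpinSpacetime M) (D : SpinDyad M)

lemma spinConn_trace (x : M) (i : Fin 4) : S.spinConn x i 1 1 = -S.spinConn x i 0 0 := by
  have hU : IsOpen (Set.univ : Set M) := isOpen_univ
  rw [← S.evalAt_spinConnOn hU (Set.mem_univ x), ← S.evalAt_spinConnOn hU (Set.mem_univ x),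
    ← map_neg, spinConnOn, rep_trace ((S.isLeviCivita hU).antisymm i)]

/-- The derivative `∇_{AA'} κ^C`. -/
def nablaUp (κ : M → Fin 2 → ℂ) (x : M) (A A' C : Fin 2) : ℂ :=
  ∑ i, ivdwInv i A A' * (S.d i (fun y => κ y C) x + ∑ B, S.spinConn x i C B * κ x B)

/-- Lowering commutes with ∇ because the spin connection is trace-free, that is, ε_{AB} is parallel.
-/
lemma nabla1_lowerIdx {κ : M → Fin 2 → ℂ} {x : M}
    (hκ : ∀ C, MDifferentiableAt (𝓡 4) 𝓘(ℝ, ℂ) (fun y => κ y C) x) (A A' B : Fin 2) :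
    S.nabla1 (fun y => lowerIdx (κ y)) x A A' B = lowerIdx (S.nablaUp κ x A A') B := by
  have hneg : ∀ v, mvfderiv (𝓡 4) (fun y => -κ y 1) x v = -mvfderiv (𝓡 4) (fun y => κ y 1) x v :=
    fun v => mvfderiv_clm_comp (-ContinuousLinearMap.id ℝ ℂ) (hκ 1) v
  have ht := S.spinConn_trace x
  rw [SpinDyad.lowerIdx_eq]
  fin_cases B
  · simp only [nabla1, SpinDyad.lowerIdx_eq, Fin.zero_eta, Matrix.cons_val_zero, hneg, nablaUp,
      ← Finset.sum_neg_distrib, Fin.sum_univ_two, Matrix.cons_val_one, ht, d]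
    exact Finset.sum_congr rfl fun i _ => by ring
  · simp only [nabla1, SpinDyad.lowerIdx_eq, Fin.mk_one, Matrix.cons_val_zero, nablaUp,
      Fin.sum_univ_two, Matrix.cons_val_one, ht, d]
    exact Finset.sum_congr rfl fun i _ => by ring

/-- This is the defining property of `conn`: the adjugate in its definition is undone by the
normalization of the dyad. -/
lemma sum_mat_nablaUp (a A' b C : Fin 2) (x : M) :
    ∑ A, D.mat x A a * S.nablaUp (fun y C => D.mat y C b) x A A' C =
      ∑ e, D.mat x C e * S.conn D a A' e b x := by
  have h : ∀ C, ∑ A, D.mat x A a * S.nablaUp (fun y C => D.mat y C b) x A A' C =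
      S.dir D a A' (fun y => D.mat y C b) x
      + ∑ B, (∑ k, D.vec a A' x k * S.spinConn x k C B) * D.mat x B b := by
    intro C
    simp only [nablaUp, dir, SpinDyad.vec, Fin.sum_univ_two, Finset.mul_sum, Finset.sum_mul,
      ← Finset.sum_add_distrib]
    exact Finset.sum_congr rfl fun i _ => by ring
  have hN : D.mat x 0 0 * D.mat x 1 1 - D.mat x 1 0 * D.mat x 0 1 = 1 := D.normalized' x
  obtain ⟨y, hy⟩ : ∃ y : Fin 2 → ℂ, y = fun C => S.dir D a A' (fun y => D.mat y C b) x
      + ∑ B, (∑ k, D.vec a A' x k * S.spinConn x k C B) * D.mat x B b := ⟨_, rfl⟩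
  have hc : ∀ e, S.conn D a A' e b x = ![D.mat x 1 1 * y 0 - D.mat x 0 1 * y 1,
      -D.mat x 1 0 * y 0 + D.mat x 0 0 * y 1] e := by
    intro e
    rw [hy]
    fin_cases e
    · simp only [conn, Matrix.mul_apply, Fin.sum_univ_two (f := fun A => _ * Matrix.of _ A b)]
      simp only [Matrix.of_apply, Fin.zero_eta, Matrix.cons_val_zero, Matrix.cons_val_one,
        Matrix.cons_val', Matrix.cons_val_fin_one]
      ring
    · simp only [conn, Matrix.mul_apply, Fin.sum_univ_two (f := fun A => _ * Matrix.of _ A b)]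
      simp only [Matrix.of_apply, Fin.mk_one, Matrix.cons_val_zero, Matrix.cons_val_one,
        Matrix.cons_val', Matrix.cons_val_fin_one]
  rw [h, ← congrFun hy C, Fin.sum_univ_two, hc, hc]
  fin_cases C
  · simp only [Fin.zero_eta, Matrix.cons_val_zero, Matrix.cons_val_one]
    linear_combination (-y 0) * hN
  · simp only [Fin.mk_one, Matrix.cons_val_zero, Matrix.cons_val_one]
    linear_combination (-y 1) * hN

lemma nabla0_eq (f : M → ℂ) (x : M) (A A' : Fin 2) :
    S.nabla0 f x A A' = D.oLow x A * S.dir D 1 A' f x - D.iotaLow x A * S.dir D 0 A' f x := by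
  rw [D.resolve_covector x (fun A => S.nabla0 f x A A') A]
  have h : ∀ a, ∑ B, D.mat x B a * S.nabla0 f x B A' = S.dir D a A' f x := by
    intro a
    simp only [nabla0, dir, SpinDyad.vec, Fin.sum_univ_two, Finset.mul_sum,
      ← Finset.sum_add_distrib, d]
    exact Finset.sum_congr rfl fun i _ => by ring
  rw [h, h]

lemma nabla1_mat (b : Fin 2) (x : M) (A A' B : Fin 2) :
    S.nabla1 (fun y => lowerIdx fun C => D.mat y C b) x A A' B =
      D.oLow x A * (S.conn D 1 A' 0 b x * D.oLow x B + S.conn D 1 A' 1 b x * D.iotaLow x B)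
      - D.iotaLow x A * (S.conn D 0 A' 0 b x * D.oLow x B
        + S.conn D 0 A' 1 b x * D.iotaLow x B) := by
  have hd : ∀ C, MDifferentiableAt (𝓡 4) 𝓘(ℝ, ℂ) (fun y => D.mat y C b) x := fun C =>
    (D.contMDiffAt_mat (D.contMDiff_o x) (D.contMDiff_iota x) C b).mdifferentiableAt (by simp)
  rw [S.nabla1_lowerIdx hd, D.resolve_covector x
    (fun A => lowerIdx (S.nablaUp (fun y C => D.mat y C b) x A A') B) A]
  have h : ∀ a, ∑ E, D.mat x E a * lowerIdx (S.nablaUp (fun y C => D.mat y C b) x E A') B =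
      S.conn D a A' 0 b x * D.oLow x B + S.conn D a A' 1 b x * D.iotaLow x B := by
    intro a
    have h0 := S.sum_mat_nablaUp D a A' b 0 x
    have h1 := S.sum_mat_nablaUp D a A' b 1 x
    simp only [Fin.sum_univ_two, SpinDyad.lowerIdx_eq] at h0 h1 ⊢
    fin_cases B
    · simp [SpinDyad.oLow_zero, SpinDyad.iotaLow_zero, SpinDyad.mat] at h1 ⊢
      linear_combination -h1
    · simp [SpinDyad.oLow_one, SpinDyad.iotaLow_one, SpinDyad.mat] at h0 ⊢
      linear_combination h0
  rw [h, h]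

lemma conn_trace (a A' : Fin 2) (x : M) : S.conn D a A' 1 1 x = -S.conn D a A' 0 0 x := by
  have hU : IsOpen (Set.univ : Set M) := isOpen_univ
  rw [← S.evalAt_gauge D hU (Set.mem_univ x), ← S.evalAt_gauge D hU (Set.mem_univ x),
    ← map_neg, gauge_trace (det_dyadOn D) (S.isTorsionFree hU).trace]

lemma nabla1_oLow (x : M) (A A' B : Fin 2) : S.nabla1 D.oLow x A A' B =
      D.oLow x A * (S.conn D 1 A' 0 0 x * D.oLow x B + S.conn D 1 A' 1 0 x * D.iotaLow x B)
      - D.iotaLow x A * (S.conn D 0 A' 0 0 x * D.oLow x B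
        + S.conn D 0 A' 1 0 x * D.iotaLow x B) := S.nabla1_mat D 0 x A A' B

lemma nabla1_iotaLow (x : M) (A A' B : Fin 2) : S.nabla1 D.iotaLow x A A' B =
      D.oLow x A * (S.conn D 1 A' 0 1 x * D.oLow x B - S.conn D 1 A' 0 0 x * D.iotaLow x B)
      - D.iotaLow x A * (S.conn D 0 A' 0 1 x * D.oLow x B
        - S.conn D 0 A' 0 0 x * D.iotaLow x B) := by
  refine (S.nabla1_mat D 1 x A A' B).trans ?_
  rw [conn_trace, conn_trace]
  ring

/-- Since o^B o_B = 0 and o^B ι_B = -1, the contraction o^A o^B ∇_{AA'} o_B retains only the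
coefficient Γ_{0A'}^1_0. -/
lemma conn_ray (h : S.IsShearFreeRay D) (x : M) (A' : Fin 2) : S.conn D 0 A' 1 0 x = 0 := by
  have h1 := h x A'
  simp only [nabla1_oLow] at h1
  have e1 := D.o_oLow x
  have e2 := D.o_iotaLow x
  simp only [Fin.sum_univ_two] at h1 e1 e2
  grind

end SpinSpacetime

end

/-! ### The conformal-GHP forms and parallelism of the dyad. -/

noncomputable section

open Filter Topology VectorField DerivationFrame

namespace SpinSpacetime

variable {M : Type*} [TopologicalSpace M] [ChartedSpace (EuclideanSpace ℝ (Fin 4)) M]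
  (D : SpinDyad M)

/-- A primed spinor is determined by its contractions with the conjugate dyad. -/
lemma resolve_conj (x : M) (F : Fin 2 → ℂ) (A' : Fin 2) :
    lowerIdx (D.oBar x) A' * ∑ B', D.iotaBar x B' * F B'
      - lowerIdx (D.iotaBar x) A' * ∑ B', D.oBar x B' * F B' = F A' := by
  have h := congrArg star (D.normalized' x)
  simp only [star_sub, star_mul', star_one] at h
  simp only [SpinDyad.lowerIdx_eq, Fin.sum_univ_two, SpinDyad.oBar, SpinDyad.iotaBar]
  fin_cases A'
  · simp only [Fin.zero_eta, Matrix.cons_val_zero]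
    linear_combination F 0 * h
  · simp only [Fin.mk_one, Matrix.cons_val_zero, Matrix.cons_val_one]
    linear_combination F 1 * h

variable [IsManifold (𝓡 4) ∞ M] (S : SpinSpacetime M)

lemma contract_of_nabla1 {κ : M → Fin 2 → ℂ} {x : M} {a b c d : Fin 2 → ℂ}
    (h : ∀ A A' B, S.nabla1 κ x A A' B =
      D.oLow x A * (a A' * D.oLow x B + b A' * D.iotaLow x B)
      - D.iotaLow x A * (c A' * D.oLow x B + d A' * D.iotaLow x B)) (ξ α β : M → Fin 2 → ℂ) :
    S.contract ξ α β κ x = ∑ A', β x A' *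
      ((∑ A, α x A * D.oLow x A) * (a A' * ∑ B, ξ x B * D.oLow x B + b A' * ∑ B, ξ x B * D.iotaLow x B)
      - (∑ A, α x A * D.iotaLow x A) *
        (c A' * ∑ B, ξ x B * D.oLow x B + d A' * ∑ B, ξ x B * D.iotaLow x B)) := by
  simp only [contract, h, Fin.sum_univ_two]
  ring

lemma contract_oLow (x : M) (ξ α β : M → Fin 2 → ℂ) :
    S.contract ξ α β D.oLow x = ∑ A', β x A' *
      ((∑ A, α x A * D.oLow x A) * (S.conn D 1 A' 0 0 x * ∑ B, ξ x B * D.oLow x B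
        + S.conn D 1 A' 1 0 x * ∑ B, ξ x B * D.iotaLow x B)
      - (∑ A, α x A * D.iotaLow x A) * (S.conn D 0 A' 0 0 x * ∑ B, ξ x B * D.oLow x B
        + S.conn D 0 A' 1 0 x * ∑ B, ξ x B * D.iotaLow x B)) :=
  S.contract_of_nabla1 D (a := fun A' => S.conn D 1 A' 0 0 x) (b := fun A' => S.conn D 1 A' 1 0 x)
    (c := fun A' => S.conn D 0 A' 0 0 x) (d := fun A' => S.conn D 0 A' 1 0 x)
    (S.nabla1_oLow D x) ξ α β

lemma contract_iotaLow (x : M) (ξ α β : M → Fin 2 → ℂ) :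
    S.contract ξ α β D.iotaLow x = ∑ A', β x A' *
      ((∑ A, α x A * D.oLow x A) * (S.conn D 1 A' 0 1 x * ∑ B, ξ x B * D.oLow x B
        + -S.conn D 1 A' 0 0 x * ∑ B, ξ x B * D.iotaLow x B)
      - (∑ A, α x A * D.iotaLow x A) * (S.conn D 0 A' 0 1 x * ∑ B, ξ x B * D.oLow x B
        + -S.conn D 0 A' 0 0 x * ∑ B, ξ x B * D.iotaLow x B)) :=
  S.contract_of_nabla1 D (a := fun A' => S.conn D 1 A' 0 1 x) (b := fun A' => -S.conn D 1 A' 0 0 x)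
    (c := fun A' => S.conn D 0 A' 0 1 x) (d := fun A' => -S.conn D 0 A' 0 0 x)
    (fun A A' B => by rw [S.nabla1_iotaLow D x]; ring) ξ α β

/-- Each pair of GHP coefficients consists of the two contractions of one primed spinor Γ_{aA'}^i_j
with ō and ῑ. `resolve_conj` reassembles the pair, and the conjugate dyad disappears. -/
lemma fForm_eq (x : M) (A A' : Fin 2) : S.fForm D x A A' =
    D.iotaLow x A * S.conn D 1 A' 1 0 x - D.oLow x A * S.conn D 0 A' 0 1 x := by
  rw [← resolve_conj D x (fun A' => S.conn D 1 A' 1 0 x) A',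
    ← resolve_conj D x (fun A' => S.conn D 0 A' 0 1 x) A']
  simp only [fForm, rho, tau, rho', tau', contract_oLow, contract_iotaLow, D.o_oLow, D.iota_oLow,
    D.o_iotaLow, D.iota_iotaLow, SpinDyad.n, SpinDyad.l, SpinDyad.m, SpinDyad.mBar,
    Fin.sum_univ_two]
  ring

lemma omegaForm_eq (x : M) (A A' : Fin 2) : S.omegaForm D x A A' =
    D.iotaLow x A * S.conn D 0 A' 0 0 x - D.oLow x A * S.conn D 1 A' 0 0 x := by
  rw [← resolve_conj D x (fun A' => S.conn D 0 A' 0 0 x) A',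
    ← resolve_conj D x (fun A' => S.conn D 1 A' 0 0 x) A']
  simp only [omegaForm, epsilon, epsilon', beta, beta', contract_oLow, contract_iotaLow, D.o_oLow,
    D.iota_oLow, D.o_iotaLow, D.iota_iotaLow, SpinDyad.n, SpinDyad.l, SpinDyad.m, SpinDyad.mBar,
    Fin.sum_univ_two]
  ring

lemma bForm_eq (x : M) (A A' : Fin 2) : S.bForm D x A A' =
    -(D.iotaLow x A * S.conn D 1 A' 1 0 x) := by
  rw [← resolve_conj D x (fun A' => S.conn D 1 A' 1 0 x) A']
  simp only [bForm, rho, tau, contract_oLow, D.o_oLow, D.iota_oLow, D.o_iotaLow, D.iota_iotaLow,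
    SpinDyad.n, SpinDyad.mBar, Fin.sum_univ_two]
  ring

/-- Contraction with o^A sends f, ω, B to -Γ_{1A'}^1_0, -Γ_{0A'}^0_0, Γ_{1A'}^1_0. With p = w = 1
the terms from f and B cancel, ω cancels the derivative of o_B, and the last term vanishes since o^A
o_A = 0. -/
lemma confProj1_oLow (hS : ∀ x A', S.conn D 0 A' 1 0 x = 0) (x : M) (A' B : Fin 2) :
    S.confProj1 D 1 1 D.oLow x A' B = 0 := by
  have e1 := D.o_oLow x
  have e2 := D.o_iotaLow x
  simp only [Fin.sum_univ_two] at e1 e2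
  simp only [confProj1, conf1, nabla1_oLow, hS, fForm_eq, omegaForm_eq, bForm_eq,
    Fin.sum_univ_two]
  push_cast
  ring

/-- Here o^A ι_A = -1 turns the last term into +f_{BA'}. Its ι_B part cancels B and its o_B part
cancels the o_B component of o^A ∇_{AA'} ι_B; the form ω cancels the rest. -/
lemma confProj1_iotaLow (x : M) (A' B : Fin 2) :
    S.confProj1 D (-1) 0 D.iotaLow x A' B = 0 := by
  have e1 := D.o_oLow x
  have e2 := D.o_iotaLow x
  simp only [Fin.sum_univ_two] at e1 e2
  simp only [confProj1, conf1, nabla1_iotaLow, fForm_eq, omegaForm_eq, bForm_eq, Fin.sum_univ_two]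
  push_cast
  linear_combination (S.conn D 1 A' 0 1 x * D.oLow x B) * e1

lemma confProj0_eq (η : M → ℂ) (x : M) (A' : Fin 2) : S.confProj0 D (-2) (-1) η x A' =
    S.dir D 0 A' η x + (-S.conn D 1 A' 1 0 x + 2 * S.conn D 0 A' 0 0 x) * η x := by
  have e1 := D.o_oLow x
  have e2 := D.o_iotaLow x
  simp only [Fin.sum_univ_two] at e1 e2
  simp only [confProj0, conf0, S.nabla0_eq D, fForm_eq, omegaForm_eq, bForm_eq, Fin.sum_univ_two]
  push_cast
  linear_combination (S.dir D 1 A' η x + (S.conn D 0 A' 0 1 x + 2 * S.conn D 1 A' 0 0 x) * η x) * e1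
    + (-S.dir D 0 A' η x + (S.conn D 1 A' 1 0 x - 2 * S.conn D 0 A' 0 0 x) * η x) * e2

end SpinSpacetime

end

/-! ### From potentials to the projected Killing spinor equation. -/

noncomputable section

open Filter Topology VectorField DerivationFrame

namespace SpinDyad

variable {M : Type*} [TopologicalSpace M] [ChartedSpace (EuclideanSpace ℝ (Fin 4)) M]
  (D : SpinDyad M)

lemma mdiffAt_lowerIdx {κ : M → Fin 2 → ℂ} {x : M}
    (h : ∀ A, MDifferentiableAt (𝓡 4) 𝓘(ℝ, ℂ) (fun y => κ y A) x) (A : Fin 2) :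
    MDifferentiableAt (𝓡 4) 𝓘(ℝ, ℂ) (fun y => lowerIdx (κ y) A) x := by
  simp only [lowerIdx_eq]
  fin_cases A
  · exact (h 1).neg
  · exact h 0

lemma mdiffAt_oLow (x : M) (A : Fin 2) :
    MDifferentiableAt (𝓡 4) 𝓘(ℝ, ℂ) (fun y => D.oLow y A) x := mdiffAt_lowerIdx (D.mdiffAt_o x) A

lemma mdiffAt_iotaLow (x : M) (A : Fin 2) :
    MDifferentiableAt (𝓡 4) 𝓘(ℝ, ℂ) (fun y => D.iotaLow y A) x :=
  mdiffAt_lowerIdx (D.mdiffAt_iota x) A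

end SpinDyad

section

variable {M : Type*} [TopologicalSpace M] [ChartedSpace (EuclideanSpace ℝ (Fin 4)) M]

lemma MDifferentiableAt.mul_complex {f g : M → ℂ} {x : M}
    (hf : MDifferentiableAt (𝓡 4) 𝓘(ℝ, ℂ) f x) (hg : MDifferentiableAt (𝓡 4) 𝓘(ℝ, ℂ) g x) :
    MDifferentiableAt (𝓡 4) 𝓘(ℝ, ℂ) (fun y => f y * g y) x :=
  (hf.hasMFDerivAt.mul hg.hasMFDerivAt).mdifferentiableAt

lemma MDifferentiableAt.add_complex {f g : M → ℂ} {x : M}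
    (hf : MDifferentiableAt (𝓡 4) 𝓘(ℝ, ℂ) f x) (hg : MDifferentiableAt (𝓡 4) 𝓘(ℝ, ℂ) g x) :
    MDifferentiableAt (𝓡 4) 𝓘(ℝ, ℂ) (fun y => f y + g y) x :=
  (hf.hasMFDerivAt.add hg.hasMFDerivAt).mdifferentiableAt

lemma mvfderiv_add_complex {f g : M → ℂ} {x : M} (hf : MDifferentiableAt (𝓡 4) 𝓘(ℝ, ℂ) f x)
    (hg : MDifferentiableAt (𝓡 4) 𝓘(ℝ, ℂ) g x) (v : TangentSpace (𝓡 4) x) :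
    mvfderiv (𝓡 4) (fun y => f y + g y) x v = mvfderiv (𝓡 4) f x v + mvfderiv (𝓡 4) g x v :=
  congrArg (fun L => L v) (hf.hasMFDerivAt.add hg.hasMFDerivAt).mfderiv

lemma MDifferentiableAt.complex_comp {f : M → ℂ} {h : ℂ → ℂ} {x : M}
    (hh : DifferentiableAt ℂ h (f x)) (hf : MDifferentiableAt (𝓡 4) 𝓘(ℝ, ℂ) f x) :
    MDifferentiableAt (𝓡 4) 𝓘(ℝ, ℂ) (fun y => h (f y)) x :=
  (hh.restrictScalars ℝ).mdifferentiableAt.comp x hf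

lemma mvfderiv_complex_comp {f : M → ℂ} {h : ℂ → ℂ} {x : M}
    (hh : DifferentiableAt ℂ h (f x)) (hf : MDifferentiableAt (𝓡 4) 𝓘(ℝ, ℂ) f x)
    (v : TangentSpace (𝓡 4) x) :
    mvfderiv (𝓡 4) (fun y => h (f y)) x v = deriv h (f x) * mvfderiv (𝓡 4) f x v := by
  have h1 : mfderiv (𝓡 4) 𝓘(ℝ, ℂ) (h ∘ f) x = (mfderiv 𝓘(ℝ, ℂ) 𝓘(ℝ, ℂ) h (f x)).comp
      (mfderiv (𝓡 4) 𝓘(ℝ, ℂ) f x) :=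
    mfderiv_comp x (hh.restrictScalars ℝ).mdifferentiableAt hf
  have h2 : mvfderiv (𝓡 4) (fun y => h (f y)) x v = mfderiv (𝓡 4) 𝓘(ℝ, ℂ) (h ∘ f) x v := rfl
  have h3 : fderiv ℝ h (f x) = (deriv h (f x)) • (1 : ℂ →L[ℝ] ℂ) := by
    rw [(hh.hasDerivAt.hasFDerivAt.restrictScalars ℝ).fderiv]
    ext
    simp [mul_comm]
  rw [h2, h1, mfderiv_eq_fderiv, h3]
  rfl

end

namespace SpinSpacetime

variable {M : Type*} [TopologicalSpace M] [ChartedSpace (EuclideanSpace ℝ (Fin 4)) M]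
  [IsManifold (𝓡 4) ∞ M] (S : SpinSpacetime M) (D : SpinDyad M)

lemma nabla0_mul {f g : M → ℂ} {x : M} (hf : MDifferentiableAt (𝓡 4) 𝓘(ℝ, ℂ) f x)
    (hg : MDifferentiableAt (𝓡 4) 𝓘(ℝ, ℂ) g x) (A A' : Fin 2) :
    S.nabla0 (fun y => f y * g y) x A A' = f x * S.nabla0 g x A A' + g x * S.nabla0 f x A A' := by
  simp only [nabla0, mvfderiv_mul_complex hf hg, Finset.mul_sum, ← Finset.sum_add_distrib]
  exact Finset.sum_congr rfl fun i _ => by ring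

lemma nabla0_comp {f : M → ℂ} {h : ℂ → ℂ} {x : M} (hh : DifferentiableAt ℂ h (f x))
    (hf : MDifferentiableAt (𝓡 4) 𝓘(ℝ, ℂ) f x) (A A' : Fin 2) :
    S.nabla0 (fun y => h (f y)) x A A' = deriv h (f x) * S.nabla0 f x A A' := by
  simp only [nabla0, mvfderiv_complex_comp hh hf, Finset.mul_sum]
  exact Finset.sum_congr rfl fun i _ => by ring

lemma nabla2_mul {f : M → ℂ} {α β : M → Fin 2 → ℂ} {x : M}
    (hf : MDifferentiableAt (𝓡 4) 𝓘(ℝ, ℂ) f x)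
    (hα : ∀ B, MDifferentiableAt (𝓡 4) 𝓘(ℝ, ℂ) (fun y => α y B) x)
    (hβ : ∀ B, MDifferentiableAt (𝓡 4) 𝓘(ℝ, ℂ) (fun y => β y B) x) (A A' B C : Fin 2) :
    S.nabla2 (fun y B C => f y * (α y B * β y C)) x A A' B C =
      S.nabla0 f x A A' * (α x B * β x C) + f x * (S.nabla1 α x A A' B * β x C
        + α x B * S.nabla1 β x A A' C) := by
  simp only [nabla2, nabla1, nabla0, mvfderiv_mul_complex hf ((hα B).mul_complex (hβ C)),
    mvfderiv_mul_complex (hα B) (hβ C), Finset.sum_mul, Finset.mul_sum, Fin.sum_univ_two,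
    ← Finset.sum_add_distrib]
  exact Finset.sum_congr rfl fun i _ => by ring

lemma nabla2_add {K L : M → Fin 2 → Fin 2 → ℂ} {x : M}
    (hK : ∀ B C, MDifferentiableAt (𝓡 4) 𝓘(ℝ, ℂ) (fun y => K y B C) x)
    (hL : ∀ B C, MDifferentiableAt (𝓡 4) 𝓘(ℝ, ℂ) (fun y => L y B C) x) (A A' B C : Fin 2) :
    S.nabla2 (fun y B C => K y B C + L y B C) x A A' B C =
      S.nabla2 K x A A' B C + S.nabla2 L x A A' B C := by
  simp only [nabla2, mvfderiv_add_complex (hK B C) (hL B C), Fin.sum_univ_two,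
    ← Finset.sum_add_distrib]
  exact Finset.sum_congr rfl fun i _ => by ring

/-- A direct computation: after ∇φ is eliminated, the scalar η enters both through the conformal
correction and through differentiation of K, and the symmetrized contraction with o^A cancels
everything. -/
lemma isProjectedKillingSpinor_of_isPotentialPair (hS : ∀ x A', S.conn D 0 A' 1 0 x = 0)
    {U : Set M} {φ η : M → ℂ} (hφ : ∀ x ∈ U, MDifferentiableAt (𝓡 4) 𝓘(ℝ, ℂ) φ x)
    (hη : ∀ x ∈ U, MDifferentiableAt (𝓡 4) 𝓘(ℝ, ℂ) η x) (h : S.IsPotentialPair D φ η U) :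
    S.IsProjectedKillingSpinor D (projKillingField D φ η) U := by
  intro x hx A' B C
  obtain ⟨h0, hf⟩ := h x hx
  have hinv : DifferentiableAt ℂ (fun z : ℂ => z⁻¹) (φ x) := differentiableAt_inv h0
  have hk : MDifferentiableAt (𝓡 4) 𝓘(ℝ, ℂ) (fun y => (φ y)⁻¹) x :=
    (hφ x hx).complex_comp (h := fun z => z⁻¹) hinv
  have hc : ∀ z : ℂ, MDifferentiableAt (𝓡 4) 𝓘(ℝ, ℂ) (fun _ : M => z) x :=
    fun z => mdifferentiableAt_const
  have hK : projKillingField D φ η = fun y B C =>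
      ((φ y)⁻¹ * (1 / 2)) * (D.oLow y B * D.iotaLow y C)
      + (((φ y)⁻¹ * (1 / 2)) * (D.iotaLow y B * D.oLow y C)
      + ((φ y)⁻¹ * ((-1) * η y)) * (D.oLow y B * D.oLow y C)) := by
    ext y B C; simp only [projKillingField]; ring
  have hk2 := hk.mul_complex (hc (1 / 2))
  have hkη := hk.mul_complex ((hc (-1)).mul_complex (hη x hx))
  have n0 : ∀ z A A', S.nabla0 (fun _ => z) x A A' = 0 := fun z A A' => by
    simp [nabla0, mvfderiv_const]
  have nk : ∀ A A', S.nabla0 (fun y => (φ y)⁻¹) x A A' =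
      -(φ x)⁻¹ * ((φ x)⁻¹ * S.nabla0 φ x A A') := fun A A' => by
    rw [S.nabla0_comp (h := fun z => z⁻¹) hinv (hφ x hx), deriv_inv]
    field_simp
  -- The potential equation replaces φ⁻¹ ∇φ by f plus a multiple of o_A; afterwards no derivative of
  -- φ is left.
  have hL : ∀ A A', (φ x)⁻¹ * S.nabla0 φ x A A' = S.fForm D x A A'
      + D.oLow x A * S.confProj0 D (-2) (-1) η x A' := fun A A' => by rw [hf A A']; ring
  have hT : ∀ A B C, S.nabla2 (projKillingField D φ η) x A A' B C =
      -(φ x)⁻¹ * (S.fForm D x A A' + D.oLow x A * S.confProj0 D (-2) (-1) η x A') *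
        ((D.oLow x B * D.iotaLow x C + D.iotaLow x B * D.oLow x C) / 2
          - η x * (D.oLow x B * D.oLow x C))
      + (φ x)⁻¹ * ((S.nabla1 D.oLow x A A' B * D.iotaLow x C
          + D.oLow x B * S.nabla1 D.iotaLow x A A' C + (S.nabla1 D.iotaLow x A A' B * D.oLow x C
          + D.iotaLow x B * S.nabla1 D.oLow x A A' C)) / 2
        - η x * (S.nabla1 D.oLow x A A' B * D.oLow x C + D.oLow x B * S.nabla1 D.oLow x A A' C)
        - S.nabla0 η x A A' * (D.oLow x B * D.oLow x C)) := fun A B C => by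
    rw [hK, S.nabla2_add (fun B C => hk2.mul_complex ((D.mdiffAt_oLow x B).mul_complex
        (D.mdiffAt_iotaLow x C))) (fun B C =>
        (hk2.mul_complex ((D.mdiffAt_iotaLow x B).mul_complex (D.mdiffAt_oLow x C))).add_complex
        (hkη.mul_complex ((D.mdiffAt_oLow x B).mul_complex (D.mdiffAt_oLow x C)))),
      S.nabla2_add (fun B C => hk2.mul_complex ((D.mdiffAt_iotaLow x B).mul_complex
        (D.mdiffAt_oLow x C))) (fun B C => hkη.mul_complex ((D.mdiffAt_oLow x B).mul_complex
        (D.mdiffAt_oLow x C))),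
      S.nabla2_mul hk2 (D.mdiffAt_oLow x) (D.mdiffAt_iotaLow x),
      S.nabla2_mul hk2 (D.mdiffAt_iotaLow x) (D.mdiffAt_oLow x),
      S.nabla2_mul hkη (D.mdiffAt_oLow x) (D.mdiffAt_oLow x),
      S.nabla0_mul hk (hc _), S.nabla0_mul hk ((hc _).mul_complex (hη x hx)),
      S.nabla0_mul (hc _) (hη x hx), n0, n0, nk, hL]
    ring
  -- All derivatives are now dyad coefficients. With the shear-free coefficient set to zero, the
  -- equation becomes a polynomial identity in these and in the components of o and ι.
  simp only [symm3, hT, confProj0_eq, fForm_eq, S.nabla1_oLow D, S.nabla1_iotaLow D,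
    S.nabla0_eq D η, hS, Fin.sum_univ_two, SpinDyad.oLow_zero, SpinDyad.oLow_one, SpinDyad.iotaLow_zero, SpinDyad.iotaLow_one]
  generalize S.dir D 0 A' η x = x1
  generalize S.dir D 1 A' η x = x2
  generalize S.conn D 0 A' 0 0 x = c
  generalize S.conn D 0 A' 0 1 x = e
  generalize S.conn D 1 A' 0 0 x = p
  generalize S.conn D 1 A' 0 1 x = q
  generalize S.conn D 1 A' 1 0 x = r
  generalize (φ x)⁻¹ = k
  generalize η x = t
  fin_cases B <;> fin_cases C <;>
    simp only [Fin.zero_eta, Fin.mk_one, SpinDyad.oLow_zero, SpinDyad.oLow_one, SpinDyad.iotaLow_zero, SpinDyad.iotaLow_one] <;> ring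

end SpinSpacetime

end

/-! ### Passage to coordinates. -/

noncomputable section

open Filter Topology VectorField DerivationFrame

section

variable {M : Type*} [TopologicalSpace M] [ChartedSpace (EuclideanSpace ℝ (Fin 4)) M]

lemma ContMDiffAt.analyticAt_comp_symm {f : M → ℂ} {p : M}
    (hf : ContMDiffAt (𝓡 4) 𝓘(ℝ, ℂ) ω f p) :
    AnalyticAt ℝ (f ∘ (extChartAt (𝓡 4) p).symm) (extChartAt (𝓡 4) p p) := by
  have h := (contMDiffAt_iff.1 hf).2
  rw [modelWithCornersSelf_coe, Set.range_id, contDiffWithinAt_univ] at h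
  exact h.analyticAt

lemma AnalyticAt.contMDiffAt_comp_extChartAt [IsManifold (𝓡 4) ω M]
    {u : EuclideanSpace ℝ (Fin 4) → ℂ} {p : M} (hu : AnalyticAt ℝ u (extChartAt (𝓡 4) p p)) :
    ContMDiffAt (𝓡 4) 𝓘(ℝ, ℂ) ω (u ∘ extChartAt (𝓡 4) p) p :=
  ContMDiffAt.comp p (hu.contDiffAt.contMDiffAt) contMDiffAt_extChartAt

lemma eventually_extChartAt_symm {p : M} {P : M → Prop} (h : ∀ᶠ x in 𝓝 p, P x) :
    ∀ᶠ y in 𝓝 (extChartAt (𝓡 4) p p), P ((extChartAt (𝓡 4) p).symm y) := by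
  have h1 := (continuousAt_extChartAt_symm (I := 𝓡 4) p).tendsto
  rw [extChartAt_to_inv] at h1
  exact h1.eventually h

lemma eventually_mem_extChartAt_target (p : M) :
    ∀ᶠ y in 𝓝 (extChartAt (𝓡 4) p p), y ∈ (extChartAt (𝓡 4) p).target :=
  extChartAt_target_mem_nhds p

/-- The complex-valued `k`-th coordinate function of the preferred chart at `p`. -/
def coordFun (p : M) (k : Fin 4) (x : M) : ℂ := ((extChartAt (𝓡 4) p x k : ℝ) : ℂ)

lemma contMDiffAt_coord {n : WithTop ℕ∞} [IsManifold (𝓡 4) n M] {p x : M}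
    (hx : x ∈ (extChartAt (𝓡 4) p).source) (k : Fin 4) :
    ContMDiffAt (𝓡 4) 𝓘(ℝ, ℝ) n (fun x => extChartAt (𝓡 4) p x k) x := by
  rw [extChartAt_source] at hx
  exact ((EuclideanSpace.proj (𝕜 := ℝ) k).contDiff.contDiffAt.contMDiffAt).comp x
    (contMDiffAt_extChartAt' hx)

lemma contMDiffAt_coordFun {n : WithTop ℕ∞} [IsManifold (𝓡 4) n M] {p x : M}
    (hx : x ∈ (extChartAt (𝓡 4) p).source) (k : Fin 4) :
    ContMDiffAt (𝓡 4) 𝓘(ℝ, ℂ) n (coordFun p k) x := (contMDiffAt_coord hx k).complex_ofReal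

lemma mvfderiv_coord [IsManifold (𝓡 4) 1 M] {p x : M} (hx : x ∈ (extChartAt (𝓡 4) p).source)
    (k : Fin 4) (v : TangentSpace (𝓡 4) x) :
    mvfderiv (𝓡 4) (fun x => extChartAt (𝓡 4) p x k) x v =
      mvfderiv (𝓡 4) (extChartAt (𝓡 4) p) x v k := by
  rw [extChartAt_source] at hx
  exact mvfderiv_clm_comp (EuclideanSpace.proj (𝕜 := ℝ) k)
    (mdifferentiableAt_extChartAt hx) v

/-- The chain rule through the chart, with the components of the vector obtained as its derivatives
of the coordinate functions. -/
lemma mvfderiv_eq_sum_pd [IsManifold (𝓡 4) 1 M] {p x : M} (hx : x ∈ (extChartAt (𝓡 4) p).source)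
    {f : M → ℂ} (hf : MDifferentiableAt (𝓡 4) 𝓘(ℝ, ℂ) f x) (v : TangentSpace (𝓡 4) x) :
    mvfderiv (𝓡 4) f x v = ∑ k, mvfderiv (𝓡 4) (coordFun p k) x v *
      pd k (f ∘ (extChartAt (𝓡 4) p).symm) (extChartAt (𝓡 4) p x) := by
  set e := extChartAt (𝓡 4) p with he
  have hx' : x ∈ (chartAt (EuclideanSpace ℝ (Fin 4)) p).source := by
    rwa [he, extChartAt_source] at hx
  have hed : MDifferentiableAt (𝓡 4) 𝓘(ℝ, EuclideanSpace ℝ (Fin 4)) e x :=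
    mdifferentiableAt_extChartAt hx'
  have hy : e x ∈ e.target := e.map_source hx
  have hsd : MDifferentiableAt 𝓘(ℝ, EuclideanSpace ℝ (Fin 4)) (𝓡 4) e.symm (e x) :=
    ((contMDiffOn_extChartAt_symm (n := 1) p).contMDiffAt
      ((isOpen_extChartAt_target p).mem_nhds hy)).mdifferentiableAt one_ne_zero
  have hxx : e.symm (e x) = x := e.left_inv hx
  have hfd : MDifferentiableAt 𝓘(ℝ, EuclideanSpace ℝ (Fin 4)) 𝓘(ℝ, ℂ) (f ∘ e.symm) (e x) :=
    MDifferentiableAt.comp (e x) (by rwa [hxx]) hsd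
  have hfe : f =ᶠ[𝓝 x] (f ∘ e.symm) ∘ e := by
    filter_upwards [(isOpen_extChartAt_source p).mem_nhds hx] with z hz
    simp only [Function.comp_apply]
    rw [e.left_inv hz]
  have h1 : mvfderiv (𝓡 4) f x v = fderiv ℝ (f ∘ e.symm) (e x)
      (mvfderiv (𝓡 4) e x v) := by
    have h2 : mvfderiv (𝓡 4) f x v = mfderiv (𝓡 4) 𝓘(ℝ, ℂ) f x v := rfl
    rw [h2, hfe.mfderiv_eq, mfderiv_comp x hfd hed, mfderiv_eq_fderiv]
    rfl
  have h3 : ∀ k, mvfderiv (𝓡 4) (coordFun p k) x v =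
      ((mvfderiv (𝓡 4) e x v k : ℝ) : ℂ) := fun k => by
    rw [← mvfderiv_coord hx k v]
    exact mvfderiv_ofReal ((contMDiffAt_coord (n := 1) hx k).mdifferentiableAt one_ne_zero) v
  rw [h1]
  simp only [h3]
  generalize mvfderiv (𝓡 4) e x v = w
  conv_lhs => rw [← (EuclideanSpace.basisFun (Fin 4) ℝ).sum_repr w]
  simp only [map_sum, map_smul, EuclideanSpace.basisFun_apply, EuclideanSpace.basisFun_repr, pd,
    Complex.real_smul]

end

/-- Linear independence of two vectors survives an invertible matrix: the minors of v, w are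
combinations of the minors of v J, w J with coefficients from the right inverse K. -/
lemma exists_minor_ne_zero {J K : Matrix (Fin 4) (Fin 4) ℂ} (hJ : J * K = 1) {v w : Fin 4 → ℂ}
    {a b : Fin 4} (h : v a * w b - w a * v b ≠ 0) : ∃ k l,
      (∑ i, v i * J i k) * (∑ i, w i * J i l) - (∑ i, w i * J i k) * (∑ i, v i * J i l) ≠ 0 := by
  by_contra! hc
  apply h
  have h1 : ∀ (v : Fin 4 → ℂ) a, v a = ∑ k, (∑ i, v i * J i k) * K k a := fun v a => by
    have h2 : Matrix.vecMul (Matrix.vecMul v J) K a = v a := by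
      rw [Matrix.vecMul_vecMul, hJ, Matrix.vecMul_one]
    exact h2.symm
  rw [h1 v a, h1 w b, h1 w a, h1 v b, Finset.sum_mul_sum, Finset.sum_mul_sum,
    ← Finset.sum_sub_distrib]
  refine Finset.sum_eq_zero fun k _ => ?_
  rw [← Finset.sum_sub_distrib]
  refine Finset.sum_eq_zero fun l _ => ?_
  linear_combination (K k a * K l b) * hc k l

namespace SpinSpacetime

variable {M : Type*} [TopologicalSpace M] [ChartedSpace (EuclideanSpace ℝ (Fin 4)) M]
  (D : SpinDyad M)

/-- X_{0'} and X_{1'} are linearly independent. Vanishing of the minors (0,1) and (0,2) would give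
o_0² - o_1² = 0 and o_0² + o_1² = 0 for the components of o, hence o = 0, against the normalization.
-/
lemma vec_minor_ne_zero (x : M) : ∃ a b,
    D.vec 0 0 x a * D.vec 0 1 x b - D.vec 0 1 x a * D.vec 0 0 x b ≠ 0 := by
  by_contra! hc
  have h1 := hc 0 1
  have h2 := hc 0 2
  have hs : ((Real.sqrt 2 : ℝ) : ℂ) ^ 2 = 2 := by
    rw [← Complex.ofReal_pow, Real.sq_sqrt (by norm_num)]
    norm_num
  have hs0 : ((Real.sqrt 2 : ℝ) : ℂ) ≠ 0 := fun h => by simp [h] at hs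
  have hN := D.normalized' x
  have hI := Complex.I_mul_I
  have e1 : D.o x 0 ^ 2 - D.o x 1 ^ 2 = 0 := by
    simp [SpinDyad.vec, SpinDyad.mat, ivdwInv, ivdw, spinEps, minkowskiSign, Fin.sum_univ_two]
      at h1
    field_simp at h1
    linear_combination h1
  have e2 : D.o x 0 ^ 2 + D.o x 1 ^ 2 = 0 := by
    simp [SpinDyad.vec, SpinDyad.mat, ivdwInv, ivdw, spinEps, minkowskiSign, Fin.sum_univ_two]
      at h2
    field_simp at h2
    linear_combination Complex.I * h2 + (D.o x 0 ^ 2 + D.o x 1 ^ 2) * hI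
  have z0 : D.o x 0 = 0 := pow_eq_zero_iff two_ne_zero |>.1 (by linear_combination (e1 + e2) / 2)
  have z1 : D.o x 1 = 0 := pow_eq_zero_iff two_ne_zero |>.1 (by linear_combination (e2 - e1) / 2)
  simp [z0, z1] at hN

variable [IsManifold (𝓡 4) ∞ M] (S : SpinSpacetime M)

lemma dir_eq_vf {p x : M} (hx : x ∈ (extChartAt (𝓡 4) p).source) {f : M → ℂ}
    (hf : MDifferentiableAt (𝓡 4) 𝓘(ℝ, ℂ) f x) (a A' : Fin 2) :
    S.dir D a A' f x = vf (fun k => S.dir D a A' (coordFun p k) ∘ (extChartAt (𝓡 4) p).symm)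
      (f ∘ (extChartAt (𝓡 4) p).symm) (extChartAt (𝓡 4) p x) := by
  have : IsManifold (𝓡 4) 1 M := IsManifold.of_le (n := ∞) (by simp)
  have hz : ∀ k, S.dir D a A' (coordFun p k)
      ((extChartAt (𝓡 4) p).symm (extChartAt (𝓡 4) p x)) = S.dir D a A' (coordFun p k) x :=
    fun k => by rw [(extChartAt (𝓡 4) p).left_inv hx]
  simp only [vf, Function.comp_apply, hz]
  simp only [dir, d, mvfderiv_eq_sum_pd hx hf, Finset.sum_mul, Finset.mul_sum]
  rw [Finset.sum_comm]
  exact Finset.sum_congr rfl fun k _ => Finset.sum_congr rfl fun i _ => by ring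

/-- The frame is independent and the differential of the chart is invertible at `p`, so independence
of the ray fields carries over from frame to coordinate components. -/
lemma exists_coord_minor_ne_zero (p : M) : ∃ k l,
    S.dir D 0 0 (coordFun p k) p * S.dir D 0 1 (coordFun p l) p
      - S.dir D 0 1 (coordFun p k) p * S.dir D 0 0 (coordFun p l) p ≠ 0 := by
  have : IsManifold (𝓡 4) 1 M := IsManifold.of_le (n := ∞) (by simp)
  obtain ⟨a, b, hab⟩ := vec_minor_ne_zero D p
  have hp : p ∈ (extChartAt (𝓡 4) p).source := mem_extChartAt_source p
  let L : TangentSpace (𝓡 4) p →L[ℝ] EuclideanSpace ℝ (Fin 4) := mvfderiv (𝓡 4) (extChartAt (𝓡 4) p) p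
  have hL : Function.Injective L := (isInvertible_mfderiv_extChartAt hp).injective
  let J : Matrix (Fin 4) (Fin 4) ℝ := fun i k => L (S.E i p) k
  have hJ : IsUnit J := by
    rw [← Matrix.linearIndependent_rows_iff_isUnit]
    have h1 : LinearIndependent ℝ fun i => L (S.E i p) :=
      (S.linearIndependent_E p).map' L.toLinearMap (LinearMap.ker_eq_bot.2 hL)
    exact h1.map' (WithLp.linearEquiv 2 ℝ (Fin 4 → ℝ)).toLinearMap
      (LinearEquiv.ker _)
  obtain ⟨⟨J', K, hJK, -⟩, rfl : J' = J⟩ := hJ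
  have hJC : J.map Complex.ofRealHom * K.map Complex.ofRealHom = 1 := by
    rw [← Matrix.map_mul, hJK]; simp
  obtain ⟨k, l, h⟩ := exists_minor_ne_zero hJC hab
  refine ⟨k, l, ?_⟩
  have hd : ∀ i k, S.d i (coordFun p k) p = (J.map Complex.ofRealHom) i k := fun i k => by
    have h1 := mvfderiv_ofReal ((contMDiffAt_coord (n := 1) hp k).mdifferentiableAt one_ne_zero)
      (S.E i p)
    rw [mvfderiv_coord hp] at h1
    exact h1
  simpa only [dir, hd] using h

end SpinSpacetime

end

/-! ### Local solvability along the ray distribution. -/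

noncomputable section

open Filter Topology VectorField DerivationFrame

namespace SpinSpacetime

variable {M : Type*} [TopologicalSpace M] [ChartedSpace (EuclideanSpace ℝ (Fin 4)) M]
  (D : SpinDyad M)

lemma contMDiffAt_vec {n : WithTop ℕ∞} {x : M}
    (hD : ∀ A a, ContMDiffAt (𝓡 4) 𝓘(ℝ, ℂ) n (fun y => D.mat y A a) x) (a A' : Fin 2) (i : Fin 4) :
    ContMDiffAt (𝓡 4) 𝓘(ℝ, ℂ) n (fun y => D.vec a A' y i) x :=
  contMDiffAt_finsetSum fun A _ => (hD A a).mul_complex contMDiffAt_const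

variable [IsManifold (𝓡 4) ∞ M] (S : SpinSpacetime M)

lemma spinConn_eq (i : Fin 4) (A B : Fin 2) (x : M) : S.spinConn x i A B =
    (∑ A', ∑ j, ∑ k, (S.gam i j k x : ℂ) *
      ((minkowskiSign k : ℂ) * ivdw k A A' * ivdwInv j B A')) * (1 / 2) := by
  simp only [spinConn, g_leviCivita_E_E, Complex.ofReal_mul, div_eq_mul_inv, one_mul]
  congr 1
  exact Finset.sum_congr rfl fun _ _ => Finset.sum_congr rfl fun _ _ =>
    Finset.sum_congr rfl fun _ _ => by ring

section

variable {n : WithTop ℕ∞} [IsManifold (𝓡 4) n M] {p : M}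

lemma contMDiffAt_spinConn (hn : ∞ ≤ n)
    (hE : ∀ i, ContMDiffAt (𝓡 4) (𝓡 4).tangent n
      (fun x => (⟨x, S.E i x⟩ : TangentBundle (𝓡 4) M)) p)
    (i : Fin 4) (A B : Fin 2) :
    ContMDiffAt (𝓡 4) 𝓘(ℝ, ℂ) n (fun x => S.spinConn x i A B) p := by
  simp only [spinConn_eq]
  exact ContMDiffAt.mul_complex (contMDiffAt_finsetSum fun A' _ => contMDiffAt_finsetSum fun j _ =>
    contMDiffAt_finsetSum fun k _ =>
      (S.contMDiffAt_gam hn hE i j k).complex_ofReal.mul_complex contMDiffAt_const) contMDiffAt_const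

lemma contMDiffAt_dir (hn : ∞ ≤ n)
    (hE : ∀ i, ContMDiffAt (𝓡 4) (𝓡 4).tangent n
      (fun x => (⟨x, S.E i x⟩ : TangentBundle (𝓡 4) M)) p)
    (hD : ∀ A a, ContMDiffAt (𝓡 4) 𝓘(ℝ, ℂ) n (fun y => D.mat y A a) p)
    {f : M → ℂ} (hf : ContMDiffAt (𝓡 4) 𝓘(ℝ, ℂ) n f p) (a A' : Fin 2) :
    ContMDiffAt (𝓡 4) 𝓘(ℝ, ℂ) n (S.dir D a A' f) p :=
  contMDiffAt_finsetSum fun i _ =>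
    (contMDiffAt_vec D hD a A' i).mul_complex (S.contMDiffAt_d hn hE hf i)

lemma contMDiffAt_conn (hn : ∞ ≤ n)
    (hE : ∀ i, ContMDiffAt (𝓡 4) (𝓡 4).tangent n
      (fun x => (⟨x, S.E i x⟩ : TangentBundle (𝓡 4) M)) p)
    (hD : ∀ A a, ContMDiffAt (𝓡 4) 𝓘(ℝ, ℂ) n (fun y => D.mat y A a) p)
    (a A' i j : Fin 2) :
    ContMDiffAt (𝓡 4) 𝓘(ℝ, ℂ) n (S.conn D a A' i j) p := by
  have h1 : ∀ A b, ContMDiffAt (𝓡 4) 𝓘(ℝ, ℂ) n (fun x => S.dir D a A' (fun y => D.mat y A b) x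
      + ∑ B, (∑ k, D.vec a A' x k * S.spinConn x k A B) * D.mat x B b) p := fun A b =>
    (S.contMDiffAt_dir D hn hE hD (hD A b) a A').add (contMDiffAt_finsetSum fun B _ =>
      (contMDiffAt_finsetSum fun k _ => (contMDiffAt_vec D hD a A' k).mul_complex
        (S.contMDiffAt_spinConn hn hE k A B)).mul_complex (hD B b))
  have h2 : ∀ A, ContMDiffAt (𝓡 4) 𝓘(ℝ, ℂ) n (fun x =>
      !![D.mat x 1 1, -D.mat x 0 1; -D.mat x 1 0, D.mat x 0 0] i A) p := fun A => by
    fin_cases i <;> fin_cases A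
    · exact hD 1 1
    · exact (hD 0 1).neg
    · exact (hD 1 0).neg
    · exact hD 0 0
  unfold conn
  simp only [Matrix.mul_apply, Matrix.of_apply]
  exact contMDiffAt_finsetSum fun A _ => (h2 A).mul_complex (h1 A j)

lemma contMDiffAt_connBar (hn : ∞ ≤ n)
    (hE : ∀ i, ContMDiffAt (𝓡 4) (𝓡 4).tangent n
      (fun x => (⟨x, S.E i x⟩ : TangentBundle (𝓡 4) M)) p)
    (hD : ∀ A a, ContMDiffAt (𝓡 4) 𝓘(ℝ, ℂ) n (fun y => D.mat y A a) p)
    (A' C' B' : Fin 2) :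
    ContMDiffAt (𝓡 4) 𝓘(ℝ, ℂ) n (S.connBar D A' C' B') p := by
  unfold connBar
  refine contMDiffAt_finsetSum fun i _ => (contMDiffAt_vec D hD 0 A' i).mul_complex ?_
  exact contMDiffAt_const.mul_complex (contMDiffAt_finsetSum fun A _ =>
    contMDiffAt_finsetSum fun j _ => contMDiffAt_finsetSum fun k _ =>
    ((contMDiffAt_const.mul_complex (S.contMDiffAt_gam hn hE i j k).complex_ofReal).mul_complex
      contMDiffAt_const).mul_complex contMDiffAt_const)

lemma contMDiffAt_lam1 (hn : ∞ ≤ n)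
    (hE : ∀ i, ContMDiffAt (𝓡 4) (𝓡 4).tangent n
      (fun x => (⟨x, S.E i x⟩ : TangentBundle (𝓡 4) M)) p)
    (hD : ∀ A a, ContMDiffAt (𝓡 4) 𝓘(ℝ, ℂ) n (fun y => D.mat y A a) p) : ContMDiffAt (𝓡 4) 𝓘(ℝ, ℂ) n (S.lam1 D) p :=
  ((S.contMDiffAt_conn D hn hE hD 0 0 0 0).add (S.contMDiffAt_connBar D hn hE hD 0 1 1)).sub
    (S.contMDiffAt_connBar D hn hE hD 1 1 0)

end

variable [IsManifold (𝓡 4) ω M]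

/-- Local solvability of `o^A ∇_{AA'} u + c_{A'} u = g_{A'}` along an analytic shear-free ray. -/
lemma exists_ray_solution (hE : S.IsAnalytic) (hD : D.IsAnalytic)
    (hS : ∀ x A', S.conn D 0 A' 1 0 x = 0) {p : M} {c g : Fin 2 → M → ℂ}
    (hc : ∀ A', ContMDiffAt (𝓡 4) 𝓘(ℝ, ℂ) ω (c A') p)
    (hg : ∀ A', ContMDiffAt (𝓡 4) 𝓘(ℝ, ℂ) ω (g A') p)
    (hflat : ∀ᶠ x in 𝓝 p, S.dir D 0 0 (c 1) x - S.dir D 0 1 (c 0) x =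
      S.lam0 D x * c 0 x + S.lam1 D x * c 1 x)
    (hcomp : ∀ᶠ x in 𝓝 p, S.dir D 0 0 (g 1) x - S.dir D 0 1 (g 0) x - c 1 x * g 0 x
      + c 0 x * g 1 x = S.lam0 D x * g 0 x + S.lam1 D x * g 1 x) :
    ∃ u, ContMDiffAt (𝓡 4) 𝓘(ℝ, ℂ) ω u p ∧
      ∀ᶠ x in 𝓝 p, ∀ A', S.dir D 0 A' u x + c A' x * u x = g A' x := by
  have hn : (∞ : WithTop ℕ∞) ≤ ω := le_top
  have hEp : ∀ i, ContMDiffAt (𝓡 4) (𝓡 4).tangent ω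
    (fun x => (⟨x, S.E i x⟩ : TangentBundle (𝓡 4) M)) p := fun i => (hE i) p
  have hDp : ∀ A a, ContMDiffAt (𝓡 4) 𝓘(ℝ, ℂ) ω (fun y => D.mat y A a) p := fun A a =>
    D.contMDiffAt_mat (hD.1 p) (hD.2 p) A a
  set e := extChartAt (𝓡 4) p with he
  have hp : p ∈ e.source := mem_extChartAt_source p
  have hcf : ∀ A' k, ContMDiffAt (𝓡 4) 𝓘(ℝ, ℂ) ω (S.dir D 0 A' (coordFun p k)) p := fun A' k =>
    S.contMDiffAt_dir D hn hEp hDp (contMDiffAt_coordFun hp k) 0 A'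
  -- Near `p` the ray derivatives are coordinate vector fields, whose components are the derivatives
  -- of the coordinate functions.
  have htr : ∀ {f : M → ℂ}, ContMDiffAt (𝓡 4) 𝓘(ℝ, ℂ) ω f p → ∀ A', ∀ᶠ x in 𝓝 p,
      S.dir D 0 A' f x = vf (fun k => S.dir D 0 A' (coordFun p k) ∘ e.symm) (f ∘ e.symm) (e x) :=
    fun hf A' => by
      filter_upwards [hf.eventually_mdifferentiableAt hn,
        (isOpen_extChartAt_source p).mem_nhds hp] with x hx hxs
      exact S.dir_eq_vf D hxs hx 0 A'
  have htr' : ∀ {f : M → ℂ}, ContMDiffAt (𝓡 4) 𝓘(ℝ, ℂ) ω f p → ∀ A', ∀ᶠ y in 𝓝 (e p),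
      vf (fun k => S.dir D 0 A' (coordFun p k) ∘ e.symm) (f ∘ e.symm) y =
        S.dir D 0 A' f (e.symm y) := fun hf A' => by
    filter_upwards [eventually_extChartAt_symm (htr hf A'), eventually_mem_extChartAt_target p]
      with y hy hyt
    rw [hy, ← he, e.right_inv hyt]
  -- Some minor of the two fields is nonzero, so X_{0'} has a nonzero component in one of its two
  -- columns; exchanging the columns if necessary makes that coordinate noncharacteristic.
  obtain ⟨k, l, hkl⟩ : ∃ k l, S.dir D 0 0 (coordFun p k) p ≠ 0 ∧
      S.dir D 0 0 (coordFun p k) p * S.dir D 0 1 (coordFun p l) p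
        - S.dir D 0 1 (coordFun p k) p * S.dir D 0 0 (coordFun p l) p ≠ 0 := by
    obtain ⟨k, l, h⟩ := S.exists_coord_minor_ne_zero D p
    by_cases h0 : S.dir D 0 0 (coordFun p k) p = 0
    · refine ⟨l, k, fun h1 => h (by rw [h0, h1]; ring), fun h1 => h ?_⟩
      linear_combination -h1
    · exact ⟨k, l, h0, h⟩
  have hpe : e.symm (e p) = p := e.left_inv hp
  obtain ⟨u, hu, hX, hY⟩ := exists_frobenius (p := e p)
    (X := fun k => S.dir D 0 0 (coordFun p k) ∘ e.symm)
    (Y := fun k => S.dir D 0 1 (coordFun p k) ∘ e.symm)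
    (a := S.lam0 D ∘ e.symm) (b := S.lam1 D ∘ e.symm) (c := c 0 ∘ e.symm) (d := c 1 ∘ e.symm)
    (g := g 0 ∘ e.symm) (h := g 1 ∘ e.symm) (i := k) (j := l)
    (fun k => (hcf 0 k).analyticAt_comp_symm) (fun k => (hcf 1 k).analyticAt_comp_symm)
    (S.contMDiffAt_lam1 D hn hEp hDp).analyticAt_comp_symm
    (hc 0).analyticAt_comp_symm (hc 1).analyticAt_comp_symm
    (hg 0).analyticAt_comp_symm (hg 1).analyticAt_comp_symm
    (by simpa only [Function.comp_apply, hpe] using hkl.1)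
    (by simpa only [Function.comp_apply, hpe] using hkl.2)
    (by
      filter_upwards [eventually_all.2 fun k => htr' (hcf 1 k) 0,
        eventually_all.2 fun k => htr' (hcf 0 k) 1, eventually_mem_extChartAt_target p]
        with y h0 h1 hy k
      rw [h0 k, h1 k]
      exact S.ray_commutator D (isOpen_extChartAt_source p) hS
        (fun x hx => contMDiffAt_coordFun hx k) (e.map_target hy))
    (by
      filter_upwards [htr' (hc 1) 0, htr' (hc 0) 1, eventually_extChartAt_symm hflat] with y h0 h1 h
      rw [h0, h1]
      exact h)
    (by
      filter_upwards [htr' (hg 1) 0, htr' (hg 0) 1, eventually_extChartAt_symm hcomp] with y h0 h1 h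
      rw [h0, h1]
      exact h)
  have huc : ContMDiffAt (𝓡 4) 𝓘(ℝ, ℂ) ω (u ∘ e) p := hu.contMDiffAt_comp_extChartAt
  have hue : ∀ᶠ y in 𝓝 (e p), ((u ∘ e) ∘ e.symm) y = u y := by
    filter_upwards [eventually_mem_extChartAt_target p] with y hy
    simp only [Function.comp_apply]
    rw [e.right_inv hy]
  have hce := (continuousAt_extChartAt (I := 𝓡 4) p).tendsto
  refine ⟨u ∘ e, huc, ?_⟩
  filter_upwards [htr huc 0, htr huc 1, hce.eventually hX, hce.eventually hY,
    hce.eventually hue.eventually_nhds, (isOpen_extChartAt_source p).mem_nhds hp]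
    with x h0 h1 hXx hYx hux hx A'
  have hv : ∀ X, vf X ((u ∘ e) ∘ e.symm) (e x) = vf X u (e x) := fun X => vf_congr X hux
  rw [hv] at h0 h1
  simp only [Function.comp_apply] at hXx hYx ⊢
  rw [← he, e.left_inv hx] at hXx hYx
  fin_cases A'
  · simp only [Fin.zero_eta]
    rw [← hXx]; exact congrArg (· + _) h0
  · simp only [Fin.mk_one]
    rw [← hYx]; exact congrArg (· + _) h1

end SpinSpacetime

end

/-! ### Existence of the potentials and the main theorem. -/

noncomputable section

open Filter Topology VectorField DerivationFrame

namespace SpinSpacetime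

variable {M : Type*} [TopologicalSpace M] [ChartedSpace (EuclideanSpace ℝ (Fin 4)) M]
  [IsManifold (𝓡 4) ∞ M] (S : SpinSpacetime M) (D : SpinDyad M)

lemma dir_const_mul_add {f g : M → ℂ} {x : M} (hf : MDifferentiableAt (𝓡 4) 𝓘(ℝ, ℂ) f x)
    (hg : MDifferentiableAt (𝓡 4) 𝓘(ℝ, ℂ) g x) (r s : ℂ) (a A' : Fin 2) :
    S.dir D a A' (fun y => r * f y + s * g y) x = r * S.dir D a A' f x + s * S.dir D a A' g x := by
  have hc : ∀ z : ℂ, MDifferentiableAt (𝓡 4) 𝓘(ℝ, ℂ) (fun _ : M => z) x :=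
    fun z => mdifferentiableAt_const
  have h0 : ∀ (z : ℂ) v, mvfderiv (𝓡 4) (fun _ : M => z) x v = 0 := fun z v => by
    simp [mvfderiv_const]
  simp only [dir, d, mvfderiv_add_complex ((hc r).mul_complex hf) ((hc s).mul_complex hg),
    mvfderiv_mul_complex (hc r) hf, mvfderiv_mul_complex (hc s) hg, h0, Finset.mul_sum,
    ← Finset.sum_add_distrib]
  exact Finset.sum_congr rfl fun i _ => by ring

/-- With φ = exp u the logarithmic derivative is ∇u. The equation for u along X is the ι_A part of
the potential equation, and the equation for η is its o_A part. -/
lemma isPotentialPair_exp {U : Set M} {u η : M → ℂ}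
    (hu : ∀ x ∈ U, MDifferentiableAt (𝓡 4) 𝓘(ℝ, ℂ) u x)
    (hXu : ∀ x ∈ U, ∀ A', S.dir D 0 A' u x = -S.conn D 1 A' 1 0 x)
    (hXη : ∀ x ∈ U, ∀ A', S.dir D 0 A' η x + (-S.conn D 1 A' 1 0 x + 2 * S.conn D 0 A' 0 0 x) * η x =
      S.dir D 1 A' u x + S.conn D 0 A' 0 1 x) :
    S.IsPotentialPair D (fun x => Complex.exp (u x)) η U := by
  intro x hx
  refine ⟨Complex.exp_ne_zero _, fun A A' => ?_⟩
  rw [S.nabla0_comp Complex.differentiableAt_exp (hu x hx), Complex.deriv_exp,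
    inv_mul_cancel_left₀ (Complex.exp_ne_zero _), fForm_eq, nabla0_eq, confProj0_eq, hXη x hx,
    hXu x hx]
  ring

theorem exists_isPotentialPair [IsManifold (𝓡 4) ω M] (hE : S.IsAnalytic) (hD : D.IsAnalytic)
    (hS : ∀ x A', S.conn D 0 A' 1 0 x = 0) (hP : S.IsRepeatedPrincipal D) (p : M) :
    ∃ U : Set M, IsOpen U ∧ p ∈ U ∧ ∃ φ η : M → ℂ,
      ContMDiffOn (𝓡 4) 𝓘(ℝ, ℂ) ω φ U ∧ ContMDiffOn (𝓡 4) 𝓘(ℝ, ℂ) ω η U ∧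
      S.IsPotentialPair D φ η U := by
  have hn : (∞ : WithTop ℕ∞) ≤ ω := le_top
  have hEp : ∀ i, ContMDiffAt (𝓡 4) (𝓡 4).tangent ω
    (fun x => (⟨x, S.E i x⟩ : TangentBundle (𝓡 4) M)) p := fun i => (hE i) p
  have hDp : ∀ A a, ContMDiffAt (𝓡 4) 𝓘(ℝ, ℂ) ω (fun y => D.mat y A a) p := fun A a =>
    D.contMDiffAt_mat (hD.1 p) (hD.2 p) A a
  have hconn := S.contMDiffAt_conn D hn hEp hDp
  have hcd : ∀ a A' i j x, MDifferentiableAt (𝓡 4) 𝓘(ℝ, ℂ) (S.conn D a A' i j) x :=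
    fun a A' i j x => (S.contMDiffAt_conn D le_rfl (fun i => S.contMDiff_E i x)
      (D.contMDiffAt_mat (D.contMDiff_o x) (D.contMDiff_iota x)) a A' i j).mdifferentiableAt
      (by simp)
  have hcm : ∀ (r s : ℂ) a A' i j a₁ A'₁ i₁ j₁, ContMDiffAt (𝓡 4) 𝓘(ℝ, ℂ) ω
      (fun x => r * S.conn D a A' i j x + s * S.conn D a₁ A'₁ i₁ j₁ x) p := fun _ _ _ _ _ _ _ _ _ _ =>
    (contMDiffAt_const.mul_complex (hconn _ _ _ _)).add
      (contMDiffAt_const.mul_complex (hconn _ _ _ _))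
  -- The equation for u = log φ has no zeroth order term. The summand with factor 0 only gives the
  -- right side the shape of a combination of two coefficients, as in the equation for η.
  obtain ⟨u, hu, hXu⟩ := S.exists_ray_solution D hE hD hS (p := p) (c := fun A' x => 0)
    (g := fun A' x => (-1) * S.conn D 1 A' 1 0 x + 0 * S.conn D 1 A' 1 0 x)
    (fun _ => contMDiffAt_const) (fun A' => hcm _ _ _ _ _ _ _ _ _ _)
    (Eventually.of_forall fun x => by simp [dir, d, mvfderiv_const])
    (Eventually.of_forall fun x => by
      simp only [S.dir_const_mul_add D (hcd _ _ _ _ x) (hcd _ _ _ _ x)]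
      linear_combination -S.ray_closed D hS hP x)
  -- The compatibility condition for η differentiates the equation for u, so that equation and the
  -- regularity of u are needed on an open set.
  obtain ⟨V, hV, hVo, hpV⟩ := eventually_nhds_iff.1
    (((contMDiffAt_iff_contMDiffAt_nhds (by simp)).1 hu).and hXu)
  have hVu : ∀ x ∈ V, ∀ A', S.dir D 0 A' u x = -S.conn D 1 A' 1 0 x := fun x hx A' => by
    have := (hV x hx).2 A'
    linear_combination this
  obtain ⟨η, hη, hXη⟩ := S.exists_ray_solution D hE hD hS (p := p)
    (c := fun A' x => (-1) * S.conn D 1 A' 1 0 x + 2 * S.conn D 0 A' 0 0 x)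
    (g := fun A' x => S.dir D 1 A' u x + S.conn D 0 A' 0 1 x)
    (fun A' => hcm _ _ _ _ _ _ _ _ _ _)
    (fun A' => (S.contMDiffAt_dir D hn hEp hDp hu 1 A').add (hconn _ _ _ _))
    (Eventually.of_forall fun x => by
      simp only [S.dir_const_mul_add D (hcd _ _ _ _ x) (hcd _ _ _ _ x)]
      linear_combination -S.ray_closed D hS hP x + 2 * S.ray_flat D hS hP x)
    -- The inhomogeneity of the equation for η is compatible by `ray_compat`, applied on the open
    -- set `V` where `u` solves its equation.
    (by
      filter_upwards [hVo.mem_nhds hpV] with x hx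
      linear_combination S.ray_compat D hVo hS hP (fun y hy => (hV y hy).1.of_le hn) hVu hx)
  obtain ⟨W, hW, hWo, hpW⟩ := eventually_nhds_iff.1
    (((contMDiffAt_iff_contMDiffAt_nhds (by simp)).1 hη).and hXη)
  refine ⟨V ∩ W, hVo.inter hWo, ⟨hpV, hpW⟩, fun x => Complex.exp (u x), η,
    fun x hx => ?_, fun x hx => (hW x hx.2).1.contMDiffWithinAt,
    S.isPotentialPair_exp D
      (fun x hx => (hV x hx.1).1.mdifferentiableAt (by simp)) (fun x hx => hVu x hx.1)
      fun x hx A' => ?_⟩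
  · have hexp : ContDiff ℝ ω Complex.exp := Complex.contDiff_exp
    exact (hexp.contDiffAt.contMDiffAt.comp x (hV x hx.1).1).contMDiffWithinAt
  · have := (hW x hx.2).2 A'
    linear_combination this

end SpinSpacetime

end

theorem mainTheorem4 {M : Type*} [TopologicalSpace M]
    [ChartedSpace (EuclideanSpace ℝ (Fin 4)) M] [IsManifold (𝓡 4) ∞ M]
    (S : SpinSpacetime M) (D : SpinDyad M) (hSFR : S.IsShearFreeRay D) :
    -- parallel spinors: `o_B` has weights `{1,0}`, `w = 1` and `ι_B` has weights `{-1,0}`, `w = 0`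
    ((∀ x A' B, S.confProj1 D 1 1 D.oLow x A' B = 0) ∧
      (∀ x A' B, S.confProj1 D (-1) 0 D.iotaLow x A' B = 0)) ∧
    (IsManifold (𝓡 4) ω M → S.IsAnalytic → D.IsAnalytic → S.IsRepeatedPrincipal D →
      -- potentials exist near every point
      (∀ x : M, ∃ U : Set M, IsOpen U ∧ x ∈ U ∧ ∃ φ η : M → ℂ,
        ContMDiffOn (𝓡 4) 𝓘(ℝ, ℂ) ω φ U ∧ ContMDiffOn (𝓡 4) 𝓘(ℝ, ℂ) ω η U ∧
        S.IsPotentialPair D φ η U) ∧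
      -- any potentials yield a solution of the projected Killing spinor equation
      (∀ (U : Set M) (φ η : M → ℂ), IsOpen U →
        ContMDiffOn (𝓡 4) 𝓘(ℝ, ℂ) 1 φ U → ContMDiffOn (𝓡 4) 𝓘(ℝ, ℂ) 1 η U →
        S.IsPotentialPair D φ η U →
        S.IsProjectedKillingSpinor D (projKillingField D φ η) U)) := by
  have hS := S.conn_ray D hSFR
  refine ⟨⟨S.confProj1_oLow D hS, S.confProj1_iotaLow D⟩, fun hM hE hD hP =>
    ⟨S.exists_isPotentialPair D hE hD hS hP, fun U φ η hU hφ hη h => ?_⟩⟩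
  exact S.isProjectedKillingSpinor_of_isPotentialPair D hS
    (fun x hx => (hφ.contMDiffAt (hU.mem_nhds hx)).mdifferentiableAt one_ne_zero)
    (fun x hx => (hη.contMDiffAt (hU.mem_nhds hx)).mdifferentiableAt one_ne_zero) h
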